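/- Let $\mathbb{R}^{2,3}$ be $\mathbb{R}^5$ with the inner product $\langle x,y\rangle=x_1y_3+x_2y_4+x_3y_1+x_4y_2-x_5y_5$, the volume form $\mathrm{dVol}=dx_1\wedge\dots\wedge dx_5$ and the time-like (negative definite) $3$-plane $W$ oriented by its basis $(w_1,w_2,w_3)=(e_1-e_3,\,e_2-e_4,\,e_5)$. Let $\mathrm{Ein}^{1,2}$ be the space of isotropic lines of $\mathbb{R}^{2,3}$, and $\mathrm{SO}_0(2,3)$ the group of linear isometries of $\mathbb{R}^{2,3}$ preserving the orientation and the time-orientation. A light-like polygon with $k$ vertices is an oriented embedded closed polygon $\Delta\subset\mathrm{Ein}^{1,2}$, with cyclically enumerated vertices, each of whose edges is a segment in the projection of an isotropic plane. It is negative and future-directed if it lifts to a cone $\widetilde\Delta\subset\mathbb{R}^{2,3}\setminus\{0\}$, invariant under positive scalars, such that - $\langle x,y\rangle\le 0$ for all non-collinear $x,y\in\widetilde\Delta$, with equality if and only if $x$ and $y$ project to the same edge of $\Delta$; - $\mathrm{dVol}(v,v',w_1,w_2,w_3)>0$ for all $v,v'\in\widetilde\Delta$ that project to consecutive vertices of $\Delta$;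 - the closed curve of half-lines given by $\widetilde\Delta$ generates the fundamental group $\cong\mathbb{Z}$ of the space of isotropic half-lines (the double cover $S^1\times S^2$ of $\mathrm{Ein}^{1,2}$). Such a $\Delta$ has exactly two lifts, $\widetilde\Delta$ and $-\widetilde\Delta$. Polygons are topologized by their vertices, and quotients carry the quotient topology. Let $\mathcal{MLP}^-_k$ be the moduli space (quotient by $\mathrm{SO}_0(2,3)$) of future-directed negative light-like polygons with $k$ vertices, $\mathcal{TLP}^-_k$ the moduli space of such polygons with a marked vertex, and $\widehat{\mathcal{TLP}}{}^-_k$ the moduli space of such polygons with a marked vertex and a chosen lift. The group $\mathbb{Z}_k$ acts on $\mathcal{TLP}^-_k$ by change of marking. **Theorem.** Let $k\ge 6$. 1. $\mathcal{MLP}^-_k$ is a non-empty, possibly disconnected, real (smooth) orbifold of dimension $2(k-5)$. 2. Forgetting the marking induces a homeomorphism $\mathcal{TLP}^-_k/\mathbb{Z}_k\cong\mathcal{MLP}^-_k$. 3. $\mathcal{TLP}^-_k$ is a real orbifold of dimension $2(k-5)$; it is a topological manifold of dimension $2(k-5)$ if $k$ is odd or $k=6$. 4. For every $k\ge 6$,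 $\widehat{\mathcal{TLP}}{}^-_k$ is a topological manifold of dimension $2(k-5)$, and $\mathcal{TLP}^-_k$ is its quotient by the involution $\widetilde\Delta\mapsto-\widetilde\Delta$. -/

import Mathlib

open scoped LinearAlgebra.Projectivization ContDiff

noncomputable section

/-! ## The pseudo-Euclidean space of signature (2,3) and the group of its symmetries -/

/-- The vector space underlying `ℝ^{2,3}`. -/
abbrev R23 : Type := Fin 5 → ℝ

namespace R23

/-- The inner product `x₁y₃ + x₂y₄ + x₃y₁ + x₄y₂ - x₅y₅`, of signature (2,3). -/
def form (x y : R23) : ℝ := x 0 * y 2 + x 1 * y 3 + x 2 * y 0 + x 3 * y 1 - x 4 * y 4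

/-- The standard volume form `dx₁ ∧ ⋯ ∧ dx₅`. -/
def dVol (a b c d e : R23) : ℝ := Matrix.det (Matrix.of ![a, b, c, d, e])

/-- The ordered basis `e₁ - e₃, e₂ - e₄, e₅` of the fixed oriented time-like 3-plane `W`. -/
def timeFrame : Fin 3 → R23 := ![![1, 0, -1, 0, 0], ![0, 1, 0, -1, 0], ![0, 0, 0, 0, 1]]

/-- The ordered basis `e₁ + e₃, e₂ + e₄` of the positive definite plane orthogonal to `W`. -/
def spaceFrame : Fin 2 → R23 := ![![1, 0, 1, 0, 0], ![0, 1, 0, 1, 0]]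

/-- `u` is a basis of a time-like (that is, negative definite) 3-plane. -/
def IsTimelikeFrame (u : Fin 3 → R23) : Prop :=
  ∀ c : Fin 3 → ℝ, c ≠ 0 → form (∑ i, c i • u i) (∑ i, c i • u i) < 0

/-- The orthogonal projection onto `W` carries the time-like frame `u` to a basis of `W` that has
the orientation of `timeFrame`. -/
def IsPositiveFrame (u : Fin 3 → R23) : Prop :=
  0 < dVol (spaceFrame 0) (spaceFrame 1) (u 0) (u 1) (u 2)

/-- `SO₀(2,3)`: the linear isometries of `ℝ^{2,3}` that preserve the orientation and the
time-orientation (the orientation of time-like 3-planes). -/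
def SO0 : Subgroup (R23 ≃ₗ[ℝ] R23) where
  carrier := {A | (∀ x y, form (A x) (A y) = form x y) ∧
    LinearMap.det (A : R23 →ₗ[ℝ] R23) = 1 ∧
    ∀ u, IsTimelikeFrame u → (IsPositiveFrame (fun i => A (u i)) ↔ IsPositiveFrame u)}
  one_mem' := by
    refine ⟨fun x y => rfl, ?_, fun u _ => Iff.rfl⟩
    exact LinearMap.det_id
  mul_mem' := by
    rintro A B ⟨hA, hA', hA''⟩ ⟨hB, hB', hB''⟩
    refine ⟨fun x y => ?_, ?_, fun u hu => ?_⟩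
    · simp only [LinearEquiv.mul_apply, hA, hB]
    · have : ((A * B : R23 ≃ₗ[ℝ] R23) : R23 →ₗ[ℝ] R23)
          = (A : R23 →ₗ[ℝ] R23) * (B : R23 →ₗ[ℝ] R23) := rfl
      rw [this, map_mul, hA', hB', one_mul]
    · have hBu : IsTimelikeFrame (fun i => B (u i)) := by
        intro c hc
        have h := hu c hc
        rw [← hB] at h
        simpa only [map_sum, map_smul] using h
      exact (hA'' _ hBu).trans (hB'' u hu)
  inv_mem' := by
    rintro A ⟨hA, hA', hA''⟩
    have hinv : ∀ x, A (A⁻¹ x) = x := fun x => A.apply_symm_apply x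
    refine ⟨fun x y => ?_, ?_, fun u hu => ?_⟩
    · rw [← hA, hinv, hinv]
    · have h := LinearEquiv.det_mul_det_symm A
      rw [hA', one_mul] at h
      exact h
    · have hBu : IsTimelikeFrame (fun i => A⁻¹ (u i)) := by
        intro c hc
        have h := hu c hc
        rw [← hA]
        simpa only [map_sum, map_smul, hinv] using h
      have h := hA'' _ hBu
      simp only [hinv] at h
      exact h.symm

end R23

open R23

/-! ## The Einstein universe -/

/-- The Einstein universe `Ein^{1,2}`: the isotropic lines of `ℝ^{2,3}`. -/
def Ein : Type := {p : ℙ ℝ R23 // form p.rep p.rep = 0}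

namespace Ein

/-- The subspace topology from the projective space (with its quotient topology). -/
instance : TopologicalSpace Ein :=
  TopologicalSpace.induced (fun p : Ein => p.1)
    (TopologicalSpace.coinduced (Projectivization.mk' ℝ (V := R23)) inferInstance)

/-- `x` is a non-zero vector on the isotropic line `p`. -/
def IsRep (x : R23) (p : Ein) : Prop := ∃ h : x ≠ 0, Projectivization.mk ℝ x h = p.1

lemma IsRep.form_eq_zero {x : R23} {p : Ein} (h : IsRep x p) : form x x = 0 := by
  obtain ⟨hx, hp⟩ := h
  obtain ⟨a, ha⟩ := Projectivization.exists_smul_eq_mk_rep ℝ x hx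
  have h0 := p.2
  rw [← hp, ← ha] at h0
  have h1 : form (a • x) (a • x) = (a : ℝ) ^ 2 * form x x := by
    simp only [form, Units.smul_def, Pi.smul_apply, smul_eq_mul]
    ring
  rw [h1] at h0
  exact (mul_eq_zero.mp h0).resolve_left (pow_ne_zero 2 a.ne_zero)

/-- The point of the Einstein universe defined by a non-zero isotropic vector. -/
def mk (x : R23) (hx : x ≠ 0) (h : form x x = 0) : Ein :=
  ⟨Projectivization.mk ℝ x hx, by
    obtain ⟨a, ha⟩ := Projectivization.exists_smul_eq_mk_rep ℝ x hx
    rw [← ha]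
    have h1 : form (a • x) (a • x) = (a : ℝ) ^ 2 * form x x := by
      simp only [form, Units.smul_def, Pi.smul_apply, smul_eq_mul]
      ring
    rw [h1, h, mul_zero]⟩

lemma exists_isRep (p : Ein) : ∃ x, IsRep x p :=
  ⟨p.1.rep, p.1.rep_nonzero, p.1.mk_rep⟩

lemma IsRep.eq {x : R23} {p q : Ein} (hp : IsRep x p) (hq : IsRep x q) : p = q := by
  obtain ⟨_, h⟩ := hp
  obtain ⟨_, h'⟩ := hq
  exact Subtype.ext (h.symm.trans h')

/-- The action of `SO₀(2,3)` on the Einstein universe. -/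
instance : MulAction SO0 Ein where
  smul A p := ⟨A • p.1, by
    obtain ⟨x, hx, hp⟩ := exists_isRep p
    have hx0 : form x x = 0 := IsRep.form_eq_zero ⟨hx, hp⟩
    rw [← hp]
    exact (mk (A • x) ((smul_ne_zero_iff_ne A).mpr hx) ((A.2.1 x x).trans hx0)).2⟩
  one_smul p := Subtype.ext (one_smul _ _)
  mul_smul A B p := Subtype.ext (mul_smul A B p.1)

lemma IsRep.smul {x : R23} {p : Ein} (h : IsRep x p) (A : SO0) :
    IsRep (A.1 x) (A • p) := by
  obtain ⟨hx, hp⟩ := h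
  refine ⟨(smul_ne_zero_iff_ne A).mpr hx, ?_⟩
  change _ = A • p.1
  rw [← hp]
  rfl

lemma IsRep.of_smul {x : R23} {p : Ein} {A : SO0} (h : IsRep (A.1 x) (A • p)) : IsRep x p := by
  have h' := h.smul A⁻¹
  rw [inv_smul_smul] at h'
  have : (A⁻¹ : SO0).1 (A.1 x) = x := A.1.symm_apply_apply x
  rwa [this] at h'

/-- The projection to the Einstein universe of the Euclidean segment from `u` to `w`. -/
def segment (u w : R23) : Set Ein :=
  {p | ∃ a b : ℝ, 0 ≤ a ∧ 0 ≤ b ∧ IsRep (a • u + b • w) p}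

lemma smul_segment (A : SO0) (u w : R23) :
    (fun p => A • p) '' segment u w = segment (A.1 u) (A.1 w) := by
  have key : ∀ a b : ℝ, A.1 (a • u + b • w) = a • A.1 u + b • A.1 w := by
    intro a b
    rw [map_add, map_smul, map_smul]
  ext q
  constructor
  · rintro ⟨p, ⟨a, b, ha, hb, h⟩, rfl⟩
    exact ⟨a, b, ha, hb, key a b ▸ h.smul A⟩
  · rintro ⟨a, b, ha, hb, h⟩
    refine ⟨A⁻¹ • q, ⟨a, b, ha, hb, ?_⟩, smul_inv_smul A q⟩
    apply IsRep.of_smul (A := A)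
    rw [smul_inv_smul, key]
    exact h

end Ein

open Ein

/-! ## Light-like polygons -/

/-- An oriented embedded light-like polygon in `Ein^{1,2}` with `k` vertices and a marked vertex.
The marking and the orientation are recorded by the cyclic enumeration of the vertices (the marked
one is `vertex 0`); `edge i` joins `vertex i` to `vertex (i + 1)`. -/
@[ext]
structure MarkedPolygon (k : ℕ) where
  vertex : ZMod k → Ein
  edge : ZMod k → Set Ein
  /-- Every edge is a segment in the projection of an isotropic plane, from one vertex to the
  next one. -/
  edge_photon : ∀ i, ∃ u w : R23, LinearIndependent ℝ ![u, w] ∧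
    form u u = 0 ∧ form u w = 0 ∧ form w w = 0 ∧
    IsRep u (vertex i) ∧ IsRep w (vertex (i + 1)) ∧ edge i = segment u w
  vertex_injective : Function.Injective vertex
  /-- Distinct edges meet at most in common vertices. -/
  edge_inter : ∀ i j, i ≠ j → ∀ p ∈ edge i, p ∈ edge j →
    ∃ l, (l = i ∨ l = i + 1) ∧ (l = j ∨ l = j + 1) ∧ p = vertex l

namespace MarkedPolygon

variable {k : ℕ}

/-- Change of marking: the marked vertex is moved `a` steps along the polygon. -/
instance : AddAction (ZMod k) (MarkedPolygon k) where
  vadd a P :=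
    { vertex := fun i => P.vertex (i + a)
      edge := fun i => P.edge (i + a)
      edge_photon := fun i => by
        obtain ⟨u, w, h⟩ := P.edge_photon (i + a)
        refine ⟨u, w, ?_⟩
        rwa [add_right_comm] at h
      vertex_injective := fun i j h => add_right_cancel (P.vertex_injective h)
      edge_inter := fun i j hij p hi hj => by
        obtain ⟨l, h1, h2, h3⟩ := P.edge_inter (i + a) (j + a)
          (fun h => hij (add_right_cancel h)) p hi hj
        refine ⟨l - a, ?_, ?_, by rw [sub_add_cancel]; exact h3⟩
        · rcases h1 with h1 | h1
          · left; rw [h1]; ring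
          · right; rw [h1]; ring
        · rcases h2 with h2 | h2
          · left; rw [h2]; ring
          · right; rw [h2]; ring }
  zero_vadd P := by
    apply MarkedPolygon.ext
    · funext i; exact congrArg P.vertex (add_zero i)
    · funext i; exact congrArg P.edge (add_zero i)
  add_vadd a b P := by
    apply MarkedPolygon.ext
    · funext i
      change P.vertex (i + (a + b)) = P.vertex (i + a + b)
      rw [add_assoc]
    · funext i
      change P.edge (i + (a + b)) = P.edge (i + a + b)
      rw [add_assoc]

/-- The action of `SO₀(2,3)` on light-like polygons. -/
instance : MulAction SO0 (MarkedPolygon k) where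
  smul A P :=
    { vertex := fun i => A • P.vertex i
      edge := fun i => (fun p => A • p) '' P.edge i
      edge_photon := fun i => by
        obtain ⟨u, w, h1, h2, h3, h4, h5, h6, h7⟩ := P.edge_photon i
        refine ⟨A.1 u, A.1 w, ?_, ?_, ?_, ?_, h5.smul A, h6.smul A, ?_⟩
        · have := h1.map' (A.1 : R23 →ₗ[ℝ] R23) (LinearEquiv.ker A.1)
          have h8 : (A.1 : R23 →ₗ[ℝ] R23) ∘ ![u, w] = ![A.1 u, A.1 w] := by
            funext j
            fin_cases j <;> rfl
          rwa [h8] at this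
        · rw [A.2.1, h2]
        · rw [A.2.1, h3]
        · rw [A.2.1, h4]
        · rw [h7, smul_segment]
      vertex_injective := fun i j h => P.vertex_injective (MulAction.injective A h)
      edge_inter := fun i j hij p hi hj => by
        obtain ⟨q, hq, rfl⟩ := hi
        obtain ⟨q', hq', h⟩ := hj
        have h' : q' = q := MulAction.injective A h
        rw [h'] at hq'
        obtain ⟨l, h1, h2, h3⟩ := P.edge_inter i j hij q hq hq'
        exact ⟨l, h1, h2, congrArg (fun p => A • p) h3⟩ }
  one_smul P := by
    apply MarkedPolygon.ext
    · funext i; exact one_smul _ _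
    · funext i
      change (fun p => (1 : SO0) • p) '' P.edge i = P.edge i
      simp
  mul_smul A B P := by
    apply MarkedPolygon.ext
    · funext i; exact mul_smul _ _ _
    · funext i
      change (fun p => (A * B) • p) '' P.edge i
        = (fun p => A • p) '' ((fun p => B • p) '' P.edge i)
      rw [Set.image_image]
      simp only [mul_smul]

/-- `v` generates the half-lines over the vertices in a lift of `P` to a cone in
`ℝ^{2,3} ∖ {0}` that is invariant under positive scalars. -/
def IsLift (P : MarkedPolygon k) (v : ZMod k → R23) : Prop :=
  ∀ i, IsRep (v i) (P.vertex i) ∧ P.edge i = segment (v i) (v (i + 1))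

/-- The cone generated by the segments `[v i, v (i + 1)]`. -/
def cone (v : ZMod k → R23) : Set R23 :=
  {x | x ≠ 0 ∧ ∃ (i : ZMod k) (a b : ℝ), 0 ≤ a ∧ 0 ≤ b ∧ x = a • v i + b • v (i + 1)}

/-- The lifted cone is negative: the inner product of any two non-collinear points is non-positive,
and it vanishes if and only if their projections belong to the same edge. -/
def IsNegativeLift (P : MarkedPolygon k) (v : ZMod k → R23) : Prop :=
  ∀ x ∈ cone v, ∀ y ∈ cone v, LinearIndependent ℝ ![x, y] →
    form x y ≤ 0 ∧ (form x y = 0 ↔ ∃ i, ∃ p ∈ P.edge i, ∃ q ∈ P.edge i, IsRep x p ∧ IsRep y q)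

/-- The lifted cone is future-directed. -/
def IsFutureLift (v : ZMod k → R23) : Prop :=
  ∀ i, 0 < dVol (v i) (v (i + 1)) (timeFrame 0) (timeFrame 1) (timeFrame 2)

/-- The orthogonal projection of `x` to the positive definite plane spanned by `spaceFrame`, in
complex notation. It does not vanish at non-zero isotropic vectors. -/
def spacePart (x : R23) : ℂ := ⟨(x 0 + x 2) / 2, (x 1 + x 3) / 2⟩

/-- The total angle by which the space-like part turns along the closed polygonal path through the
`v i`. -/
def turningAngle (v : ZMod k → R23) : ℝ :=
  ∑ᶠ i, Complex.arg (spacePart (v (i + 1)) / spacePart (v i))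

/-- The lifted polygon generates the fundamental group `ℤ` of the space of isotropic half-lines
(the double cover `S¹ × S²` of the Einstein universe): its winding number around the `S¹` factor
is `± 1`. -/
def IsGeneratingLift (v : ZMod k → R23) : Prop :=
  |turningAngle v| = 2 * Real.pi

/-- `v` generates a lift of `P` that exhibits `P` as a future-directed negative light-like
polygon. -/
def IsFutureNegativeLift (P : MarkedPolygon k) (v : ZMod k → R23) : Prop :=
  P.IsLift v ∧ P.IsNegativeLift v ∧ IsFutureLift v ∧ IsGeneratingLift v

/-- Future-directed negative light-like polygons. -/
def IsFutureNegative (P : MarkedPolygon k) : Prop :=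
  ∃ v : ZMod k → R23, P.IsFutureNegativeLift v

lemma IsFutureNegative.vadd {P : MarkedPolygon k} (h : P.IsFutureNegative) (a : ZMod k) :
    (a +ᵥ P).IsFutureNegative := by
  obtain ⟨v, h1, h2, h3, h4⟩ := h
  have hadd : ∀ i : ZMod k, i + 1 + a = i + a + 1 := fun i => add_right_comm i 1 a
  have hcone : cone (fun i => v (i + a)) = cone v := by
    ext x
    constructor
    · rintro ⟨hx, i, s, t, hs, ht, h⟩
      refine ⟨hx, i + a, s, t, hs, ht, ?_⟩
      simp only [h, hadd]
    · rintro ⟨hx, i, s, t, hs, ht, h⟩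
      refine ⟨hx, i - a, s, t, hs, ht, ?_⟩
      simp only [h, hadd, sub_add_cancel]
  refine ⟨fun i => v (i + a), fun i => ?_, ?_, fun i => ?_, ?_⟩
  · refine ⟨(h1 (i + a)).1, ?_⟩
    change P.edge (i + a) = _
    simp only [(h1 (i + a)).2, hadd]
  · intro x hx y hy hxy
    rw [hcone] at hx hy
    obtain ⟨h5, h6⟩ := h2 x hx y hy hxy
    refine ⟨h5, h6.trans ⟨?_, ?_⟩⟩
    · rintro ⟨i, p, hp, q, hq, h⟩
      refine ⟨i - a, p, ?_, q, ?_, h⟩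
      · change p ∈ P.edge (i - a + a)
        rwa [sub_add_cancel]
      · change q ∈ P.edge (i - a + a)
        rwa [sub_add_cancel]
    · rintro ⟨i, p, hp, q, hq, h⟩
      exact ⟨i + a, p, hp, q, hq, h⟩
  · have := h3 (i + a)
    rwa [← hadd] at this
  · unfold IsGeneratingLift at h4 ⊢
    rw [← h4]
    congr 1
    have := finsum_comp_equiv (Equiv.addRight a)
      (f := fun i : ZMod k => Complex.arg (spacePart (v (i + 1)) / spacePart (v i)))
    rw [turningAngle, turningAngle, ← this]
    simp only [Equiv.coe_addRight, hadd]

end MarkedPolygon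

/-! ## The moduli spaces -/

/-- The space of future-directed negative light-like polygons with `k` vertices and a marked
vertex. -/
def MarkedLP (k : ℕ) : Type := {P : MarkedPolygon k // P.IsFutureNegative}

/-- Polygons are topologized by their vertices. -/
instance (k : ℕ) : TopologicalSpace (MarkedLP k) :=
  TopologicalSpace.induced (fun P => P.1.vertex) inferInstance

/-- Change of marking. -/
instance (k : ℕ) : AddAction (ZMod k) (MarkedLP k) where
  vadd a P := ⟨a +ᵥ P.1, P.2.vadd a⟩
  zero_vadd _ := Subtype.ext (zero_vadd _ _)
  add_vadd _ _ _ := Subtype.ext (add_vadd _ _ _)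

/-- Two marked polygons are equivalent if an element of `SO₀(2,3)` maps one to the other. -/
instance MarkedLP.setoid (k : ℕ) : Setoid (MarkedLP k) where
  r P Q := ∃ A : SO0, A • P.1 = Q.1
  iseqv :=
    { refl := fun P => ⟨1, one_smul _ _⟩
      symm := by
        rintro P Q ⟨A, h⟩
        exact ⟨A⁻¹, by rw [← h, inv_smul_smul]⟩
      trans := by
        rintro P Q R ⟨A, h⟩ ⟨B, h'⟩
        exact ⟨B * A, by rw [mul_smul, h, h']⟩ }

lemma MarkedLP.equiv_vadd {k : ℕ} {P Q : MarkedLP k} (h : P ≈ Q) (a : ZMod k) :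
    a +ᵥ P ≈ a +ᵥ Q := by
  obtain ⟨A, h⟩ := h
  refine ⟨A, ?_⟩
  change A • (a +ᵥ P.1) = a +ᵥ Q.1
  rw [← h]
  rfl

/-- The moduli space of future-directed negative light-like polygons with `k` vertices and a
marked vertex, with the quotient topology. -/
def TLP (k : ℕ) : Type := Quotient (MarkedLP.setoid k)

instance (k : ℕ) : TopologicalSpace (TLP k) :=
  inferInstanceAs (TopologicalSpace (Quotient (MarkedLP.setoid k)))

/-- The class of a marked polygon. -/
def TLP.mk {k : ℕ} (P : MarkedLP k) : TLP k := Quotient.mk _ P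

/-- Change of marking on the moduli space. -/
instance (k : ℕ) : AddAction (ZMod k) (TLP k) where
  vadd a := Quotient.map (fun P => a +ᵥ P) (fun _ _ h => MarkedLP.equiv_vadd h a)
  zero_vadd := by
    rintro ⟨P⟩
    exact congrArg TLP.mk (zero_vadd _ P)
  add_vadd a b := by
    rintro ⟨P⟩
    exact congrArg TLP.mk (add_vadd a b P)

/-- Generators of the half-lines over the vertices in the lifts of future-directed negative
light-like polygons with `k` vertices and a marked vertex. -/
def LiftedLP (k : ℕ) : Type :=
  {v : ZMod k → R23 // ∃ P : MarkedPolygon k, P.IsFutureNegativeLift v}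

instance (k : ℕ) : TopologicalSpace (LiftedLP k) :=
  TopologicalSpace.induced (fun v => v.1) inferInstance

/-- Two generating families are equivalent if an element of `SO₀(2,3)` maps the half-lines of one
to those of the other. -/
instance LiftedLP.setoid (k : ℕ) : Setoid (LiftedLP k) where
  r v w := ∃ (A : SO0) (c : ZMod k → ℝ), (∀ i, 0 < c i) ∧ ∀ i, w.1 i = c i • A.1 (v.1 i)
  iseqv :=
    { refl := fun v => ⟨1, 1, fun _ => one_pos, fun i => (one_smul ℝ (v.1 i)).symm⟩
      symm := by
        rintro v w ⟨A, c, hc, h⟩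
        refine ⟨A⁻¹, fun i => (c i)⁻¹, fun i => inv_pos.mpr (hc i), fun i => ?_⟩
        have : (A⁻¹ : SO0).1 (A.1 (v.1 i)) = v.1 i := A.1.symm_apply_apply _
        rw [h i, map_smul, this, inv_smul_smul₀ (hc i).ne']
      trans := by
        rintro u v w ⟨A, c, hc, h⟩ ⟨B, d, hd, h'⟩
        refine ⟨B * A, fun i => d i * c i, fun i => mul_pos (hd i) (hc i), fun i => ?_⟩
        rw [h' i, h i, map_smul, mul_smul]
        rfl }

/-- The moduli space of pairs of a future-directed negative light-like polygon with `k` vertices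
and a marked vertex, and a lift of it to a cone, with the quotient topology. -/
def LTLP (k : ℕ) : Type := Quotient (LiftedLP.setoid k)

instance (k : ℕ) : TopologicalSpace (LTLP k) :=
  inferInstanceAs (TopologicalSpace (Quotient (LiftedLP.setoid k)))

/-- The class of a lifted marked polygon. -/
def LTLP.mk {k : ℕ} (v : LiftedLP k) : LTLP k := Quotient.mk _ v

/-- The space of (unmarked, oriented) future-directed negative light-like polygons with `k`
vertices, with the quotient topology. -/
def LP (k : ℕ) : Type := AddAction.orbitRel.Quotient (ZMod k) (MarkedLP k)

instance (k : ℕ) : TopologicalSpace (LP k) :=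
  inferInstanceAs (TopologicalSpace (Quotient (AddAction.orbitRel (ZMod k) (MarkedLP k))))

/-- The polygon obtained by forgetting the marked vertex. -/
def LP.mk {k : ℕ} (P : MarkedLP k) : LP k := Quotient.mk _ P

lemma LP.mk_eq_mk {k : ℕ} {P Q : MarkedLP k} :
    LP.mk P = LP.mk Q ↔ ∃ a : ZMod k, a +ᵥ Q = P :=
  Quotient.eq.trans AddAction.orbitRel_apply

/-- Two polygons are equivalent if an element of `SO₀(2,3)` maps one to the other. -/
instance LP.setoid (k : ℕ) : Setoid (LP k) where
  r p q := ∃ (P Q : MarkedLP k) (A : SO0), LP.mk P = p ∧ LP.mk Q = q ∧ A • P.1 = Q.1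
  iseqv :=
    { refl := by
        rintro ⟨P⟩
        exact ⟨P, P, 1, rfl, rfl, one_smul _ _⟩
      symm := by
        rintro p q ⟨P, Q, A, hP, hQ, h⟩
        exact ⟨Q, P, A⁻¹, hQ, hP, by rw [← h, inv_smul_smul]⟩
      trans := by
        rintro p q r ⟨P, Q, A, hP, hQ, h⟩ ⟨Q', R, B, hQ', hR, h'⟩
        obtain ⟨a, ha⟩ := LP.mk_eq_mk.mp (hQ'.trans hQ.symm)
        refine ⟨a +ᵥ P, R, B * A, ?_, hR, ?_⟩
        · rw [← hP]
          exact LP.mk_eq_mk.mpr ⟨a, rfl⟩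
        · have h1 : A • (a +ᵥ P.1) = Q'.1 := by
            rw [← ha]
            change _ = a +ᵥ Q.1
            rw [← h]
            rfl
          change (B * A) • (a +ᵥ P.1) = R.1
          rw [mul_smul, h1, h'] }

/-- The moduli space of future-directed negative light-like polygons with `k` vertices: the quotient
by `SO₀(2,3)`, with the quotient topology. -/
def MLP (k : ℕ) : Type := Quotient (LP.setoid k)

instance (k : ℕ) : TopologicalSpace (MLP k) :=
  inferInstanceAs (TopologicalSpace (Quotient (LP.setoid k)))

/-- The class of a polygon. -/
def MLP.mk {k : ℕ} (p : LP k) : MLP k := Quotient.mk _ p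

/-! ## Manifolds and orbifolds -/

/-- `X` is a topological manifold of dimension `n`. -/
def IsTopologicalManifold (n : ℕ) (X : Type) [TopologicalSpace X] : Prop :=
  T2Space X ∧ SecondCountableTopology X ∧ Nonempty (ChartedSpace (EuclideanSpace ℝ (Fin n)) X)

/-- An orbifold chart of dimension `n` on `X`: a finite group acting effectively and smoothly on an
open set of `ℝⁿ`, and an invariant map to `X` that identifies the orbit space with an open set of
`X`. -/
structure OrbifoldChart (n : ℕ) (X : Type) [TopologicalSpace X] where
  source : TopologicalSpace.Opens (EuclideanSpace ℝ (Fin n))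
  group : Type
  [instGroup : Group group]
  [instFinite : Finite group]
  [instAction : MulAction group source]
  effective : FaithfulSMul group source
  smooth_smul : ∀ g : group, ∃ f : EuclideanSpace ℝ (Fin n) → EuclideanSpace ℝ (Fin n),
    ContDiffOn ℝ ∞ f source ∧ ∀ x : source, ((g • x : source) : EuclideanSpace ℝ (Fin n)) = f x
  proj : source → X
  continuous_proj : Continuous proj
  isOpenMap_proj : IsOpenMap proj
  proj_eq_iff : ∀ x y, proj x = proj y ↔ ∃ g : group, g • x = y

/-- Two orbifold charts are compatible: points over the same point of `X` have neighbourhoods that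
are identified by a diffeomorphism over `X`. -/
def OrbifoldChart.Compatible {n : ℕ} {X : Type} [TopologicalSpace X] (c d : OrbifoldChart n X) :
    Prop :=
  ∀ (x : c.source) (y : d.source), c.proj x = d.proj y →
    ∃ h : OpenPartialHomeomorph (EuclideanSpace ℝ (Fin n)) (EuclideanSpace ℝ (Fin n)),
      (x : EuclideanSpace ℝ (Fin n)) ∈ h.source ∧ h x = y ∧
      h.source ⊆ c.source ∧ h.target ⊆ d.source ∧
      ContDiffOn ℝ ∞ h h.source ∧ ContDiffOn ℝ ∞ h.symm h.target ∧
      ∀ (z : c.source) (w : d.source), (z : EuclideanSpace ℝ (Fin n)) ∈ h.source →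
        h z = w → c.proj z = d.proj w

/-- `X` is a real (smooth, effective) orbifold of dimension `n`: a second countable Hausdorff space
that is covered by pairwise compatible orbifold charts of dimension `n`. -/
def IsOrbifold (n : ℕ) (X : Type) [TopologicalSpace X] : Prop :=
  T2Space X ∧ SecondCountableTopology X ∧
    ∃ atlas : Set (OrbifoldChart n X),
      (∀ x : X, ∃ c ∈ atlas, x ∈ Set.range c.proj) ∧
      ∀ c ∈ atlas, ∀ d ∈ atlas, c.Compatible d

end

/-!
The moduli space of lifted marked polygons has a global chart, and the other two moduli spaces are
its quotients by finite groups that act smoothly in this chart.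

A lift of a polygon is determined by vectors `v i` on the half-lines over its vertices. The
families that occur are those in which all `v i` are isotropic, consecutive ones are orthogonal
and span future-directed planes, and all other products are negative (`IsNegativeCycle`).
Conversely such a family always generates a lift (`exists_isFutureNegativeLift_iff`): the polygon
is embedded, and the space-like part of the cone turns exactly once, because by negativity the
edges contain no second point with the space-like part of a vertex.

Seen from the vertex `0`, the polygon is a light-like path in Minkowski space of signature (1,2),
which joins the vertices `2, …, k - 2`, continued at both ends by light rays whose limits at
infinity are the vertices `1` and `k - 1`. Null vectors of the future cone are parametrized by
vectors of the plane up to sign (`nullVec`), so the directions of the rays and of the steps are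
given by `p 0, …, p (k - 3)` in `ℝ²`, and `form (nullVec p) (nullVec q) = 2 * wedge p q ^ 2`. The
signs can be chosen such that consecutive areas `wedge (p j) (p (j + 1))` are positive, and the
only further condition on the `p j` is that `p (k - 3)` and `p 0` are not parallel
(`isNegativeCycle_polygonVec`). The group `SO₀(2,3)` and the positive rescalings of the `v i` make
it possible to normalise the areas with `j = 0, 1, k - 4` to one, and to put the path in standard
position (`exists_eq_smul_map_cycle`). The remaining `k - 6` consecutive areas and the `k - 4`
areas `wedge (p j) (p (j + 2))` determine the `p j` recursively. They are smooth invariants of the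
`v i` (`coordMap`), and they identify the moduli space with an open subset of `ℝ^{2(k-5)}`
(`LTLP.chart`).

Changes of marking and the exchange of the two lifts act by diffeomorphisms in this chart, which
yields the orbifold structures (`isOrbifold_of_symmetries`). The exchange of the lifts changes the
signs of the areas `wedge (p j) (p (j + 2))` and fixes the other coordinates
(`TLP.ofCoord_eq_iff`). If `k` is odd, it has no fixed points, as a fixed point would have
`p (k - 3)` parallel to `p 0`. If `k = 6`, it is `-1` on an open subset of the plane, and the
squaring map of `ℂ` identifies the quotient with an open subset of the plane.
-/

noncomputable section

/-! ### The form, the volume form and the time-orientation -/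

namespace R23

lemma form_comm (x y : R23) : form x y = form y x := by simp only [form]; ring

@[simp] lemma form_add_left (x y z : R23) : form (x + y) z = form x z + form y z := by
  simp only [form, Pi.add_apply]; ring

@[simp] lemma form_add_right (x y z : R23) : form x (y + z) = form x y + form x z := by
  simp only [form, Pi.add_apply]; ring

@[simp] lemma form_smul_left (a : ℝ) (x y : R23) : form (a • x) y = a * form x y := by
  simp only [form, Pi.smul_apply, smul_eq_mul]; ring

@[simp] lemma form_smul_right (a : ℝ) (x y : R23) : form x (a • y) = a * form x y := by
  simp only [form, Pi.smul_apply, smul_eq_mul]; ring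

@[simp] lemma form_neg_left (x y : R23) : form (-x) y = -form x y := by
  simp only [form, Pi.neg_apply]; ring

@[simp] lemma form_neg_right (x y : R23) : form x (-y) = -form x y := by
  simp only [form, Pi.neg_apply]; ring

@[simp] lemma form_zero_left (x : R23) : form 0 x = 0 := by simp [form]

@[simp] lemma form_zero_right (x : R23) : form x 0 = 0 := by simp [form]

/-- Laplace expansion of the volume form along the first two vectors. -/
lemma dVol_eq (a b c d e : R23) : dVol a b c d e =
    (a 0 * b 1 - a 1 * b 0) * (c 2 * (d 3 * e 4 - d 4 * e 3) - c 3 * (d 2 * e 4 - d 4 * e 2)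
      + c 4 * (d 2 * e 3 - d 3 * e 2))
    - (a 0 * b 2 - a 2 * b 0) * (c 1 * (d 3 * e 4 - d 4 * e 3) - c 3 * (d 1 * e 4 - d 4 * e 1)
      + c 4 * (d 1 * e 3 - d 3 * e 1))
    + (a 0 * b 3 - a 3 * b 0) * (c 1 * (d 2 * e 4 - d 4 * e 2) - c 2 * (d 1 * e 4 - d 4 * e 1)
      + c 4 * (d 1 * e 2 - d 2 * e 1))
    - (a 0 * b 4 - a 4 * b 0) * (c 1 * (d 2 * e 3 - d 3 * e 2) - c 2 * (d 1 * e 3 - d 3 * e 1)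
      + c 3 * (d 1 * e 2 - d 2 * e 1))
    + (a 1 * b 2 - a 2 * b 1) * (c 0 * (d 3 * e 4 - d 4 * e 3) - c 3 * (d 0 * e 4 - d 4 * e 0)
      + c 4 * (d 0 * e 3 - d 3 * e 0))
    - (a 1 * b 3 - a 3 * b 1) * (c 0 * (d 2 * e 4 - d 4 * e 2) - c 2 * (d 0 * e 4 - d 4 * e 0)
      + c 4 * (d 0 * e 2 - d 2 * e 0))
    + (a 1 * b 4 - a 4 * b 1) * (c 0 * (d 2 * e 3 - d 3 * e 2) - c 2 * (d 0 * e 3 - d 3 * e 0)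
      + c 3 * (d 0 * e 2 - d 2 * e 0))
    + (a 2 * b 3 - a 3 * b 2) * (c 0 * (d 1 * e 4 - d 4 * e 1) - c 1 * (d 0 * e 4 - d 4 * e 0)
      + c 4 * (d 0 * e 1 - d 1 * e 0))
    - (a 2 * b 4 - a 4 * b 2) * (c 0 * (d 1 * e 3 - d 3 * e 1) - c 1 * (d 0 * e 3 - d 3 * e 0)
      + c 3 * (d 0 * e 1 - d 1 * e 0))
    + (a 3 * b 4 - a 4 * b 3) * (c 0 * (d 1 * e 2 - d 2 * e 1) - c 1 * (d 0 * e 2 - d 2 * e 0)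
      + c 2 * (d 0 * e 1 - d 1 * e 0)) := by
  have h4 : ∀ A : Matrix (Fin 4) (Fin 4) ℝ, A.det =
      A 0 0 * (A.submatrix ![1, 2, 3] ![1, 2, 3]).det
      - A 0 1 * (A.submatrix ![1, 2, 3] ![0, 2, 3]).det
      + A 0 2 * (A.submatrix ![1, 2, 3] ![0, 1, 3]).det
      - A 0 3 * (A.submatrix ![1, 2, 3] ![0, 1, 2]).det := by
    intro A
    rw [Matrix.det_succ_row_zero, Fin.sum_univ_four]
    have e0 : (Fin.succ : Fin 3 → Fin 4) = ![1, 2, 3] := by decide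
    have e1 : (Fin.succAbove (0 : Fin 4) : Fin 3 → Fin 4) = ![1, 2, 3] := by decide
    have e2 : (Fin.succAbove (1 : Fin 4) : Fin 3 → Fin 4) = ![0, 2, 3] := by decide
    have e3 : (Fin.succAbove (2 : Fin 4) : Fin 3 → Fin 4) = ![0, 1, 3] := by decide
    have e4 : (Fin.succAbove (3 : Fin 4) : Fin 3 → Fin 4) = ![0, 1, 2] := by decide
    rw [e1, e2, e3, e4, e0]
    norm_num [Fin.val_two]
    ring
  rw [dVol, Matrix.det_succ_row_zero, Fin.sum_univ_five]
  have e0 : (Fin.succ : Fin 4 → Fin 5) = ![1, 2, 3, 4] := by decide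
  have e1 : (Fin.succAbove (0 : Fin 5) : Fin 4 → Fin 5) = ![1, 2, 3, 4] := by decide
  have e2 : (Fin.succAbove (1 : Fin 5) : Fin 4 → Fin 5) = ![0, 2, 3, 4] := by decide
  have e3 : (Fin.succAbove (2 : Fin 5) : Fin 4 → Fin 5) = ![0, 1, 3, 4] := by decide
  have e4 : (Fin.succAbove (3 : Fin 5) : Fin 4 → Fin 5) = ![0, 1, 2, 4] := by decide
  have e5 : (Fin.succAbove (4 : Fin 5) : Fin 4 → Fin 5) = ![0, 1, 2, 3] := by decide
  rw [e1, e2, e3, e4, e5, e0]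
  simp only [h4, Matrix.det_fin_three, Matrix.submatrix_apply, Matrix.of_apply,
    Matrix.cons_val_zero, Matrix.cons_val_one, Matrix.cons_val]
  norm_num [Fin.val_two]
  ring

/-- The volume form against the fixed frame of `W` is an area form on the plane orthogonal
to `W`. -/
lemma dVol_timeFrame (a b : R23) :
    dVol a b (timeFrame 0) (timeFrame 1) (timeFrame 2)
      = (a 0 + a 2) * (b 1 + b 3) - (a 1 + a 3) * (b 0 + b 2) := by
  rw [dVol_eq]
  simp [timeFrame]
  ring

lemma dVol_map (A : R23 ≃ₗ[ℝ] R23) (a b c d e : R23) :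
    dVol (A a) (A b) (A c) (A d) (A e) = LinearMap.det (A : R23 →ₗ[ℝ] R23) * dVol a b c d e := by
  have h : Matrix.of ![A a, A b, A c, A d, A e]
      = Matrix.of ![a, b, c, d, e] * (LinearMap.toMatrix' (A : R23 →ₗ[ℝ] R23)).transpose := by
    have key : ∀ (x : R23) (j : Fin 5),
        A x j = ∑ l, x l * LinearMap.toMatrix' (A : R23 →ₗ[ℝ] R23) j l := by
      intro x j
      have := congrFun (LinearMap.toMatrix'_mulVec (A : R23 →ₗ[ℝ] R23) x) j
      rw [LinearEquiv.coe_coe] at this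
      rw [← this]
      simp only [Matrix.mulVec, dotProduct]
      exact Finset.sum_congr rfl fun _ _ => mul_comm _ _
    ext i j
    rw [Matrix.mul_apply]
    fin_cases i <;> simpa using key _ j
  rw [dVol, h, Matrix.det_mul, Matrix.det_transpose, LinearMap.det_toMatrix', dVol, mul_comm]

/-- The isotopy that shrinks the component of `x` in `W`: it is the identity at `s = 1` and the
orthogonal projection to the positive definite plane at `s = 0`. -/
def shrink (s : ℝ) (x : R23) : R23 :=
  ![(x 0 + x 2) / 2 + s * ((x 0 - x 2) / 2), (x 1 + x 3) / 2 + s * ((x 1 - x 3) / 2),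
    (x 0 + x 2) / 2 - s * ((x 0 - x 2) / 2), (x 1 + x 3) / 2 - s * ((x 1 - x 3) / 2), s * x 4]

lemma exists_of_dVol_eq_zero {a b c d e : R23} (h : dVol a b c d e = 0) :
    ∃ t : Fin 5 → ℝ, t ≠ 0 ∧ t 0 • a + t 1 • b + (t 2 • c + t 3 • d + t 4 • e) = 0 := by
  obtain ⟨t, ht, h⟩ := Matrix.exists_vecMul_eq_zero_iff.mpr h
  refine ⟨t, ht, ?_⟩
  rw [← h]
  ext i
  simp [Matrix.vecMul, dotProduct, Fin.sum_univ_succ]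
  ring

/-- A future-directed isotropic plane detects the orientation of every time-like frame: along the
isotopy `shrink` from the plane to the positive definite plane orthogonal to `W`, it stays positive
semidefinite, hence transverse to the span of the frame. -/
lemma dVol_pos_iff_isPositiveFrame {a b : R23} (haa : form a a = 0) (hab : form a b = 0)
    (hbb : form b b = 0)
    (hpos : 0 < dVol a b (timeFrame 0) (timeFrame 1) (timeFrame 2)) {u : Fin 3 → R23}
    (hu : IsTimelikeFrame u) : 0 < dVol a b (u 0) (u 1) (u 2) ↔ IsPositiveFrame u := by
  set D : ℝ → ℝ := fun s => dVol (shrink s a) (shrink s b) (u 0) (u 1) (u 2) with hD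
  rw [dVol_timeFrame] at hpos
  have hcont : Continuous D := by
    simp only [hD, dVol_eq, shrink]
    simp
    fun_prop
  -- a common vector of the shrunk plane and of the time-like span has both `0 ≤ form X X`
  -- and `form X X < 0` unless it vanishes
  have hne : ∀ s ∈ Set.Icc (0 : ℝ) 1, D s ≠ 0 := by
    intro s hs h0
    obtain ⟨t, ht, h⟩ := exists_of_dVol_eq_zero h0
    set X := t 0 • shrink s a + t 1 • shrink s b with hX
    have hXs : X = shrink s (t 0 • a + t 1 • b) := by
      ext i; fin_cases i <;> simp [hX, shrink] <;> ring
    set Z := t 0 • a + t 1 • b with hZ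
    have hZ0 : form Z Z = 0 := by
      simp only [hZ, form_add_left, form_add_right, form_smul_left, form_smul_right, haa, hab, hbb,
        form_comm b a]
      ring
    have hXX : 0 ≤ form X X := by
      have h1 : form X X = (1 - s ^ 2) * ((Z 0 + Z 2) ^ 2 + (Z 1 + Z 3) ^ 2) / 2
          + s ^ 2 * form Z Z := by
        rw [hXs]; simp [shrink, form]; ring
      rw [h1, hZ0]
      have : 0 ≤ 1 - s ^ 2 := by nlinarith [hs.1, hs.2]
      positivity
    have hsum : ∑ i, (![t 2, t 3, t 4] : Fin 3 → ℝ) i • u i = -X := by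
      rw [Fin.sum_univ_three]
      simp only [Matrix.cons_val_zero, Matrix.cons_val_one, Matrix.cons_val]
      exact eq_neg_of_add_eq_zero_right h
    have ht3 : (![t 2, t 3, t 4] : Fin 3 → ℝ) = 0 := by
      by_contra hc
      have := hu _ hc
      rw [hsum, form_neg_left, form_neg_right, neg_neg] at this
      linarith
    have hX0 : X = 0 := by
      rw [ht3] at hsum
      simpa using hsum.symm
    rw [hX0] at hXs
    have e0 := congrFun hXs 0
    have e1 := congrFun hXs 1
    have e2 := congrFun hXs 2
    have e3 := congrFun hXs 3
    simp [shrink, hZ] at e0 e1 e2 e3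
    have l1 : t 0 * (a 0 + a 2) + t 1 * (b 0 + b 2) = 0 := by linarith
    have l2 : t 0 * (a 1 + a 3) + t 1 * (b 1 + b 3) = 0 := by linarith
    have t0 : t 0 = 0 := by
      have : t 0 * ((a 0 + a 2) * (b 1 + b 3) - (a 1 + a 3) * (b 0 + b 2)) = 0 := by
        linear_combination (b 1 + b 3) * l1 - (b 0 + b 2) * l2
      exact (mul_eq_zero.mp this).resolve_right hpos.ne'
    have t1 : t 1 = 0 := by
      have : t 1 * ((a 0 + a 2) * (b 1 + b 3) - (a 1 + a 3) * (b 0 + b 2)) = 0 := by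
        linear_combination (a 0 + a 2) * l2 - (a 1 + a 3) * l1
      exact (mul_eq_zero.mp this).resolve_right hpos.ne'
    apply ht
    have h2 := congrFun ht3 0
    have h3 := congrFun ht3 1
    have h4 := congrFun ht3 2
    simp at h2 h3 h4
    ext i; fin_cases i <;> simp [t0, t1, h2, h3, h4]
  have h1 : D 1 = dVol a b (u 0) (u 1) (u 2) := by
    have : ∀ x, shrink 1 x = x := by
      intro x; ext i; fin_cases i <;> simp [shrink] <;> ring
    simp only [hD, this]
  have h0 : D 0 = ((a 0 + a 2) * (b 1 + b 3) - (a 1 + a 3) * (b 0 + b 2)) / 4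
      * dVol (spaceFrame 0) (spaceFrame 1) (u 0) (u 1) (u 2) := by
    simp only [hD, dVol_eq, shrink, spaceFrame]
    simp
    ring
  rw [← h1, IsPositiveFrame]
  have h0' : 0 < D 0 ↔ 0 < dVol (spaceFrame 0) (spaceFrame 1) (u 0) (u 1) (u 2) := by
    rw [h0]
    exact mul_pos_iff_of_pos_left (by linarith)
  rw [← h0']
  constructor
  · intro hp
    by_contra hn
    obtain ⟨s, hs, h⟩ := intermediate_value_Icc zero_le_one hcont.continuousOn
      (show (0 : ℝ) ∈ Set.Icc (D 0) (D 1) from ⟨not_lt.mp hn, hp.le⟩)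
    exact hne s hs h
  · intro hp
    by_contra hn
    obtain ⟨s, hs, h⟩ := intermediate_value_Icc' zero_le_one hcont.continuousOn
      (show (0 : ℝ) ∈ Set.Icc (D 1) (D 0) from ⟨not_lt.mp hn, hp.le⟩)
    exact hne s hs h

lemma isTimelikeFrame_timeFrame : IsTimelikeFrame timeFrame := by
  intro c hc
  have h : form (∑ i, c i • timeFrame i) (∑ i, c i • timeFrame i)
      = -(2 * c 0 ^ 2 + 2 * c 1 ^ 2 + c 2 ^ 2) := by
    simp [Fin.sum_univ_three, timeFrame, form]; ring
  rw [h, neg_lt_zero]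
  by_contra hn
  apply hc
  have h0 : c 0 ^ 2 = 0 := by nlinarith [sq_nonneg (c 0), sq_nonneg (c 1), sq_nonneg (c 2)]
  have h1 : c 1 ^ 2 = 0 := by nlinarith [sq_nonneg (c 0), sq_nonneg (c 1), sq_nonneg (c 2)]
  have h2 : c 2 ^ 2 = 0 := by nlinarith [sq_nonneg (c 0), sq_nonneg (c 1), sq_nonneg (c 2)]
  rw [sq_eq_zero_iff] at h0 h1 h2
  ext i; fin_cases i <;> simp [*]

lemma isPositiveFrame_timeFrame : IsPositiveFrame timeFrame := by
  rw [IsPositiveFrame, dVol_timeFrame]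
  simp [spaceFrame]

lemma IsTimelikeFrame.map {A : R23 ≃ₗ[ℝ] R23} (hA : ∀ x y, form (A x) (A y) = form x y)
    {u : Fin 3 → R23} (hu : IsTimelikeFrame u) : IsTimelikeFrame (fun i => A (u i)) := by
  intro c hc
  have h := hu c hc
  rw [← hA] at h
  simpa only [map_sum, map_smul] using h

/-- An element of `SO₀(2,3)` maps future-directed isotropic planes to future-directed ones. -/
lemma SO0.dVol_timeFrame_pos (A : SO0) {a b : R23} (haa : form a a = 0) (hab : form a b = 0)
    (hbb : form b b = 0) (hpos : 0 < dVol a b (timeFrame 0) (timeFrame 1) (timeFrame 2)) :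
    0 < dVol (A.1 a) (A.1 b) (timeFrame 0) (timeFrame 1) (timeFrame 2) := by
  obtain ⟨hA, hA', hA''⟩ := (A⁻¹).2
  have h1 := dVol_map (A⁻¹ : SO0).1 (A.1 a) (A.1 b) (timeFrame 0) (timeFrame 1) (timeFrame 2)
  have hinv : ∀ x, (A⁻¹ : SO0).1 (A.1 x) = x := fun x => A.1.symm_apply_apply x
  rw [hA', one_mul, hinv, hinv] at h1
  rw [← h1]
  exact (dVol_pos_iff_isPositiveFrame haa hab hbb hpos (isTimelikeFrame_timeFrame.map hA)).mpr
    ((hA'' _ isTimelikeFrame_timeFrame).mpr isPositiveFrame_timeFrame)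

/-- An isometry of determinant one that maps one future-directed isotropic plane to a
future-directed plane preserves the time-orientation. -/
lemma mem_SO0_of_dVol_pos {A : R23 ≃ₗ[ℝ] R23} (hA : ∀ x y, form (A x) (A y) = form x y)
    (hdet : LinearMap.det (A : R23 →ₗ[ℝ] R23) = 1) {a b : R23} (haa : form a a = 0)
    (hab : form a b = 0) (hbb : form b b = 0)
    (hpos : 0 < dVol a b (timeFrame 0) (timeFrame 1) (timeFrame 2))
    (hpos' : 0 < dVol (A a) (A b) (timeFrame 0) (timeFrame 1) (timeFrame 2)) : A ∈ SO0 := by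
  refine ⟨hA, hdet, fun u hu => ?_⟩
  rw [← dVol_pos_iff_isPositiveFrame haa hab hbb hpos hu,
    ← dVol_pos_iff_isPositiveFrame (by rw [hA, haa]) (by rw [hA, hab]) (by rw [hA, hbb]) hpos'
      (hu.map hA), dVol_map, hdet, one_mul]

end R23
end

noncomputable section
open R23 Ein

/-! ### Negative cycles -/

namespace Ein

lemma IsRep.ne_zero {x : R23} {p : Ein} (h : IsRep x p) : x ≠ 0 := h.1

lemma IsRep.smul_ne_zero {x : R23} {p : Ein} (h : IsRep x p) {c : ℝ} (hc : c ≠ 0) :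
    IsRep (c • x) p := by
  obtain ⟨hx, h⟩ := h
  exact ⟨by simp [hc, hx], h ▸ (Projectivization.mk_eq_mk_iff' ℝ _ _ _ _).mpr ⟨c, rfl⟩⟩

lemma IsRep.exists_smul {x y : R23} {p : Ein} (hx : IsRep x p) (hy : IsRep y p) :
    ∃ c : ℝ, c ≠ 0 ∧ x = c • y := by
  obtain ⟨hx0, hx⟩ := hx
  obtain ⟨hy0, hy⟩ := hy
  obtain ⟨c, hc⟩ := (Projectivization.mk_eq_mk_iff' ℝ _ _ hx0 hy0).mp (hx.trans hy.symm)
  refine ⟨c, ?_, hc.symm⟩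
  rintro rfl
  exact hx0 (by rw [← hc, zero_smul])

lemma isRep_mk (x : R23) (hx : x ≠ 0) (h : form x x = 0) : IsRep x (mk x hx h) := ⟨hx, rfl⟩

lemma segment_smul_smul {s t : ℝ} (hs : 0 < s) (ht : 0 < t) (u w : R23) :
    segment (s • u) (t • w) = segment u w := by
  ext p
  constructor
  · rintro ⟨a, b, ha, hb, h⟩
    exact ⟨a * s, b * t, by positivity, by positivity, by simpa only [mul_smul] using h⟩
  · rintro ⟨a, b, ha, hb, h⟩
    refine ⟨a / s, b / t, by positivity, by positivity, ?_⟩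
    rwa [smul_smul, smul_smul, div_mul_cancel₀ _ hs.ne', div_mul_cancel₀ _ ht.ne']

lemma segment_neg_neg (u w : R23) : segment (-u) (-w) = segment u w := by
  have key : ∀ u w : R23, segment (-u) (-w) ⊆ segment u w := by
    rintro u w p ⟨a, b, ha, hb, h⟩
    refine ⟨a, b, ha, hb, ?_⟩
    have := h.smul_ne_zero (c := -1) (by norm_num)
    convert this using 1
    module
  refine (key u w).antisymm ?_
  simpa using key (-u) (-w)

end Ein

/-- Small natural numbers do not vanish modulo `k`. -/
lemma ZMod.natCast_ne_zero_of_lt {k a : ℕ} (ha : 0 < a) (hak : a < k) : (a : ZMod k) ≠ 0 := by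
  rw [Ne, ZMod.natCast_eq_zero_iff]
  exact fun h => absurd (Nat.le_of_dvd ha h) (by omega)

namespace MarkedPolygon

variable {k : ℕ}

/-- A cyclic family of isotropic vectors in which consecutive vectors span future-directed
isotropic planes and all other products are negative. For `6 ≤ k` these are the families that
generate lifts of future-directed negative light-like polygons: embeddedness and the condition on
the fundamental group are automatic. -/
structure IsNegativeCycle (v : ZMod k → R23) : Prop where
  self : ∀ i, form (v i) (v i) = 0
  next : ∀ i, form (v i) (v (i + 1)) = 0
  neg : ∀ i j, j ≠ i → j ≠ i + 1 → i ≠ j + 1 → form (v i) (v j) < 0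
  future : IsFutureLift v

namespace IsNegativeCycle

variable {v : ZMod k → R23}

lemma form_nonpos (h : IsNegativeCycle v) (i j : ZMod k) : form (v i) (v j) ≤ 0 := by
  by_cases h1 : j = i
  · rw [h1, h.self]
  by_cases h2 : j = i + 1
  · rw [h2, h.next]
  by_cases h3 : i = j + 1
  · rw [h3, form_comm, h.next]
  exact (h.neg i j h1 h2 h3).le

lemma eq_of_form_eq_zero (h : IsNegativeCycle v) {i j : ZMod k} (h0 : form (v i) (v j) = 0) :
    j = i ∨ j = i + 1 ∨ i = j + 1 := by
  by_contra! hn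
  exact (h.neg i j hn.1 hn.2.1 hn.2.2).ne h0

lemma ne_zero (h : IsNegativeCycle v) (i : ZMod k) : v i ≠ 0 := by
  intro h0
  have := h.future i
  rw [dVol_timeFrame, h0] at this
  simp at this

lemma linearIndependent (h : IsNegativeCycle v) (i : ZMod k) :
    LinearIndependent ℝ ![v i, v (i + 1)] := by
  rw [LinearIndependent.pair_iff]
  intro s t hst
  have hf := h.future i
  rw [dVol_timeFrame] at hf
  have e0 := congrFun hst 0
  have e1 := congrFun hst 1
  have e2 := congrFun hst 2
  have e3 := congrFun hst 3
  simp at e0 e1 e2 e3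
  constructor
  · refine (mul_eq_zero.mp (?_ : s * _ = 0)).resolve_right hf.ne'
    linear_combination (v (i + 1) 1 + v (i + 1) 3) * (e0 + e2)
      - (v (i + 1) 0 + v (i + 1) 2) * (e1 + e3)
  · refine (mul_eq_zero.mp (?_ : t * _ = 0)).resolve_right hf.ne'
    linear_combination (v i 0 + v i 2) * (e1 + e3) - (v i 1 + v i 3) * (e0 + e2)

lemma neg_vec (h : IsNegativeCycle v) : IsNegativeCycle (-v) where
  self i := by simpa using h.self i
  next i := by simpa using h.next i
  neg i j h1 h2 h3 := by simpa using h.neg i j h1 h2 h3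
  future i := by
    have := h.future i
    rw [dVol_timeFrame] at this ⊢
    simp only [Pi.neg_apply]
    linarith

lemma smul_vec (h : IsNegativeCycle v) {c : ZMod k → ℝ} (hc : ∀ i, 0 < c i) :
    IsNegativeCycle (fun i => c i • v i) where
  self i := by simp [h.self i]
  next i := by simp [h.next i]
  neg i j h1 h2 h3 := by
    simp only [form_smul_left, form_smul_right]
    exact mul_neg_of_pos_of_neg (hc j) (mul_neg_of_pos_of_neg (hc i) (h.neg i j h1 h2 h3))
  future i := by
    have := mul_pos (mul_pos (hc i) (hc (i + 1))) (h.future i)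
    rw [dVol_timeFrame] at this ⊢
    simp only [Pi.smul_apply, smul_eq_mul]
    linarith

lemma map (h : IsNegativeCycle v) (A : SO0) : IsNegativeCycle (fun i => A.1 (v i)) where
  self i := by rw [A.2.1, h.self]
  next i := by rw [A.2.1, h.next]
  neg i j h1 h2 h3 := by rw [A.2.1]; exact h.neg i j h1 h2 h3
  future i := SO0.dVol_timeFrame_pos A (h.self _) (h.next _) (h.self _) (h.future i)

lemma shift (h : IsNegativeCycle v) (a : ZMod k) : IsNegativeCycle (fun i => v (i + a)) where
  self i := h.self _
  next i := by simpa only [add_right_comm i 1 a] using h.next (i + a)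
  neg i j h1 h2 h3 := by
    refine h.neg _ _ (fun e => h1 (add_right_cancel e)) (fun e => h2 ?_) (fun e => h3 ?_)
    · rw [add_right_comm] at e; exact add_right_cancel e
    · rw [add_right_comm] at e; exact add_right_cancel e
  future i := by simpa only [add_right_comm i 1 a] using h.future (i + a)

lemma form_comb_eq_zero (h : IsNegativeCycle v) (i : ZMod k) (a b c d : ℝ) :
    form (a • v i + b • v (i + 1)) (c • v i + d • v (i + 1)) = 0 := by
  simp [h.self, h.next, form_comm (v (i + 1)) (v i)]

/-- As no product is positive, a point of an edge is orthogonal to a vertex only if the endpoints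
that enter with non-zero coefficient are. -/
lemma form_comb_vertex (h : IsNegativeCycle v) (i l : ZMod k) {a b : ℝ} (ha : 0 ≤ a) (hb : 0 ≤ b)
    (h0 : form (a • v i + b • v (i + 1)) (v l) = 0) :
    (a = 0 ∨ form (v i) (v l) = 0) ∧ (b = 0 ∨ form (v (i + 1)) (v l) = 0) := by
  have h1 := mul_nonpos_of_nonneg_of_nonpos ha (h.form_nonpos i l)
  have h2 := mul_nonpos_of_nonneg_of_nonpos hb (h.form_nonpos (i + 1) l)
  simp only [form_add_left, form_smul_left] at h0
  exact ⟨mul_eq_zero.mp (by linarith), mul_eq_zero.mp (by linarith)⟩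

lemma form_comb_comb (h : IsNegativeCycle v) (i j : ZMod k) {a b c d : ℝ} (ha : 0 ≤ a)
    (hb : 0 ≤ b) (hc : 0 ≤ c) (hd : 0 ≤ d) :
    form (a • v i + b • v (i + 1)) (c • v j + d • v (j + 1)) ≤ 0 := by
  have h1 := mul_nonpos_of_nonneg_of_nonpos (mul_nonneg ha hc) (h.form_nonpos i j)
  have h2 := mul_nonpos_of_nonneg_of_nonpos (mul_nonneg ha hd) (h.form_nonpos i (j + 1))
  have h3 := mul_nonpos_of_nonneg_of_nonpos (mul_nonneg hb hc) (h.form_nonpos (i + 1) j)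
  have h4 := mul_nonpos_of_nonneg_of_nonpos (mul_nonneg hb hd) (h.form_nonpos (i + 1) (j + 1))
  simp only [form_add_left, form_add_right, form_smul_left, form_smul_right]
  linarith

/-- If an interior point of the edge `i` is orthogonal to a point of the edge `j`, then the
vertices that span the latter point are endpoints of the edge `i`. -/
lemma orthogonal_of_pos (hk : 6 ≤ k) (h : IsNegativeCycle v) {i j : ZMod k} {a b c d : ℝ}
    (ha : 0 < a) (hb : 0 < b) (hc : 0 ≤ c) (hd : 0 ≤ d)
    (h0 : form (a • v i + b • v (i + 1)) (c • v j + d • v (j + 1)) = 0) :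
    (c = 0 ∨ j = i ∨ j = i + 1) ∧ (d = 0 ∨ j + 1 = i ∨ j + 1 = i + 1) := by
  have n3 : (3 : ZMod k) ≠ 0 := by
    exact_mod_cast ZMod.natCast_ne_zero_of_lt (k := k) (a := 3) (by omega) (by omega)
  have key : ∀ l : ZMod k, form (v i) (v l) = 0 → form (v (i + 1)) (v l) = 0 →
      l = i ∨ l = i + 1 := by
    intro l h1 h2
    rcases h.eq_of_form_eq_zero h1 with e | e | e
    · exact .inl e
    · exact .inr e
    rcases h.eq_of_form_eq_zero h2 with e' | e' | e'
    · exact .inr e'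
    · exact (n3 (by linear_combination -e' - e)).elim
    · exact .inl (add_right_cancel e').symm
  have h1 := mul_nonpos_of_nonneg_of_nonpos hc
    (by simpa using h.form_comb_comb i j ha.le hb.le zero_le_one le_rfl :
      form (a • v i + b • v (i + 1)) (v j) ≤ 0)
  have h2 := mul_nonpos_of_nonneg_of_nonpos hd
    (by simpa using h.form_comb_comb i j ha.le hb.le le_rfl zero_le_one :
      form (a • v i + b • v (i + 1)) (v (j + 1)) ≤ 0)
  rw [form_add_right, form_smul_right, form_smul_right] at h0
  constructor
  · refine (mul_eq_zero.mp (by linarith : c * form (a • v i + b • v (i + 1)) (v j) = 0)).imp_right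
      fun e => ?_
    obtain ⟨e1, e2⟩ := h.form_comb_vertex i j ha.le hb.le e
    exact key j (e1.resolve_left ha.ne') (e2.resolve_left hb.ne')
  · refine (mul_eq_zero.mp (by linarith :
      d * form (a • v i + b • v (i + 1)) (v (j + 1)) = 0)).imp_right fun e => ?_
    obtain ⟨e1, e2⟩ := h.form_comb_vertex i (j + 1) ha.le hb.le e
    exact key _ (e1.resolve_left ha.ne') (e2.resolve_left hb.ne')

end IsNegativeCycle

end MarkedPolygon
end

noncomputable section
open R23 Ein

/-! ### The polygon of a negative cycle -/

namespace MarkedPolygon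

variable {k : ℕ}

/-- The vector `x` is a combination of `v l` and `v (l + 1)` with non-negative coefficients. -/
def OnEdge (v : ZMod k → R23) (l : ZMod k) (x : R23) : Prop :=
  ∃ a b : ℝ, 0 ≤ a ∧ 0 ≤ b ∧ x = a • v l + b • v (l + 1)

lemma OnEdge.add {v : ZMod k → R23} {l : ZMod k} {x y : R23} (hx : OnEdge v l x)
    (hy : OnEdge v l y) : OnEdge v l (x + y) := by
  obtain ⟨a, b, ha, hb, rfl⟩ := hx
  obtain ⟨c, d, hc, hd, rfl⟩ := hy
  exact ⟨a + c, b + d, by positivity, by positivity, by module⟩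

lemma onEdge_smul {v : ZMod k → R23} {l j : ZMod k} {c : ℝ} (hc : 0 ≤ c)
    (h : c = 0 ∨ j = l ∨ j = l + 1) : OnEdge v l (c • v j) := by
  rcases h with rfl | rfl | rfl
  · exact ⟨0, 0, le_rfl, le_rfl, by simp⟩
  · exact ⟨c, 0, hc, le_rfl, by simp⟩
  · exact ⟨0, c, le_rfl, hc, by simp⟩

lemma pos_and_pos_or_vertex {v : ZMod k → R23} {i : ZMod k} {a b : ℝ} (ha : 0 ≤ a) (hb : 0 ≤ b)
    (hne : a • v i + b • v (i + 1) ≠ 0) :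
    (0 < a ∧ 0 < b) ∨
      ∃ (l : ZMod k) (c : ℝ), (l = i ∨ l = i + 1) ∧ 0 < c ∧ a • v i + b • v (i + 1) = c • v l := by
  rcases ha.eq_or_lt with rfl | ha'
  · rcases hb.eq_or_lt with rfl | hb'
    · simp at hne
    · exact .inr ⟨i + 1, b, .inr rfl, hb', by simp⟩
  · rcases hb.eq_or_lt with rfl | hb'
    · exact .inr ⟨i, a, .inl rfl, ha', by simp⟩
    · exact .inl ⟨ha', hb'⟩

namespace IsNegativeCycle

variable {v : ZMod k → R23}

/-- Orthogonal points of the cone lie over a common edge. -/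
lemma exists_common_edge (hk : 6 ≤ k) (h : IsNegativeCycle v) {i j : ZMod k} {a b c d : ℝ}
    (ha : 0 ≤ a) (hb : 0 ≤ b) (hc : 0 ≤ c) (hd : 0 ≤ d)
    (hx : a • v i + b • v (i + 1) ≠ 0) (hy : c • v j + d • v (j + 1) ≠ 0)
    (h0 : form (a • v i + b • v (i + 1)) (c • v j + d • v (j + 1)) = 0) :
    ∃ l, OnEdge v l (a • v i + b • v (i + 1)) ∧ OnEdge v l (c • v j + d • v (j + 1)) := by
  rcases pos_and_pos_or_vertex ha hb hx with ⟨ha', hb'⟩ | ⟨l, s, -, hs, hxl⟩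
  · obtain ⟨h1, h2⟩ := h.orthogonal_of_pos hk ha' hb' hc hd h0
    exact ⟨i, ⟨a, b, ha, hb, rfl⟩, (onEdge_smul hc h1).add (onEdge_smul hd h2)⟩
  rcases pos_and_pos_or_vertex hc hd hy with ⟨hc', hd'⟩ | ⟨m, t, -, ht, hym⟩
  · rw [form_comm] at h0
    obtain ⟨h1, h2⟩ := h.orthogonal_of_pos hk hc' hd' ha hb h0
    exact ⟨j, (onEdge_smul ha h1).add (onEdge_smul hb h2), ⟨c, d, hc, hd, rfl⟩⟩
  rw [hxl, hym] at h0 ⊢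
  rw [form_smul_left, form_smul_right] at h0
  have h1 := (mul_eq_zero.mp ((mul_eq_zero.mp h0).resolve_left hs.ne')).resolve_left ht.ne'
  rcases h.eq_of_form_eq_zero h1 with e | e | e
  · exact ⟨l, onEdge_smul hs.le (.inr (.inl rfl)), onEdge_smul ht.le (.inr (.inl e))⟩
  · exact ⟨l, onEdge_smul hs.le (.inr (.inl rfl)), onEdge_smul ht.le (.inr (.inr e))⟩
  · exact ⟨m, onEdge_smul hs.le (.inr (.inr e)), onEdge_smul ht.le (.inr (.inl rfl))⟩

lemma eq_of_eq_smul (h : IsNegativeCycle v) {i j : ZMod k} {c : ℝ} (e : v i = c • v j) :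
    i = j := by
  have h0 : form (v i) (v j) = 0 := by rw [e, form_smul_left, h.self, mul_zero]
  rcases h.eq_of_form_eq_zero h0 with e' | e' | e'
  · exact e'.symm
  · have := (LinearIndependent.pair_iff.mp (h.linearIndependent i)) 1 (-c)
      (by rw [← e', e]; module)
    exact absurd this.1 one_ne_zero
  · have := (LinearIndependent.pair_iff.mp (h.linearIndependent j)) (-c) 1
      (by rw [← e', e]; module)
    exact absurd this.2 one_ne_zero

/-- An interior point of an edge does not lie on another edge. -/
lemma not_pos_of_eq_smul (hk : 6 ≤ k) (h : IsNegativeCycle v) {i j : ZMod k} (hij : i ≠ j)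
    {a b c d t : ℝ} (ha : 0 < a) (hb : 0 < b) (hc : 0 ≤ c) (hd : 0 ≤ d)
    (e : a • v i + b • v (i + 1) = t • (c • v j + d • v (j + 1))) : False := by
  have n2 : (2 : ZMod k) ≠ 0 := by
    exact_mod_cast ZMod.natCast_ne_zero_of_lt (k := k) (a := 2) (by omega) (by omega)
  have h0 : form (a • v i + b • v (i + 1)) (c • v j + d • v (j + 1)) = 0 := by
    rw [e, form_smul_left, h.form_comb_eq_zero, mul_zero]
  obtain ⟨h1, h2⟩ := h.orthogonal_of_pos hk ha hb hc hd h0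
  have hli := LinearIndependent.pair_iff.mp (h.linearIndependent i)
  by_cases hc0 : c = 0
  · by_cases hd0 : d = 0
    · exact ha.ne' (hli a b (by rw [e, hc0, hd0]; simp)).1
    · have hj : j + 1 = i := (h2.resolve_left hd0).resolve_right
        fun e => hij (add_right_cancel e).symm
      have := (hli (a - t * d) b (by
        rw [hj, hc0, zero_smul, zero_add] at e
        exact Eq.trans (by module) (sub_eq_zero.mpr e))).2
      exact hb.ne' this
  · have hj : j = i + 1 := (h1.resolve_left hc0).resolve_left hij.symm
    have hd0 : d = 0 := by
      by_contra hd0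
      rcases h2.resolve_left hd0 with e' | e'
      · exact n2 (by linear_combination e' - hj)
      · exact hij (add_right_cancel e').symm
    have := (hli a (b - t * c) (by
      rw [hd0, zero_smul, add_zero, hj] at e
      exact Eq.trans (by module) (sub_eq_zero.mpr e))).1
    exact ha.ne' this

/-- The light-like polygon whose vertices are generated by a negative cycle. -/
def polygon (hk : 6 ≤ k) (h : IsNegativeCycle v) : MarkedPolygon k where
  vertex i := Ein.mk (v i) (h.ne_zero i) (h.self i)
  edge i := segment (v i) (v (i + 1))
  edge_photon i := ⟨v i, v (i + 1), h.linearIndependent i, h.self i, h.next i, h.self _,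
    isRep_mk _ _ _, isRep_mk _ _ _, rfl⟩
  vertex_injective i j e := by
    have e' : Ein.mk (v i) (h.ne_zero i) (h.self i) = Ein.mk (v j) (h.ne_zero j) (h.self j) := e
    obtain ⟨c, -, hc⟩ := (isRep_mk (v i) (h.ne_zero i) (h.self i)).exists_smul
      (e' ▸ isRep_mk (v j) (h.ne_zero j) (h.self j))
    exact h.eq_of_eq_smul hc
  edge_inter := by
    rintro i j hij p ⟨a, b, ha, hb, hp⟩ ⟨c, d, hc, hd, hp'⟩
    obtain ⟨t, ht, e⟩ := hp.exists_smul hp'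
    rcases pos_and_pos_or_vertex ha hb hp.ne_zero with ⟨ha', hb'⟩ | ⟨l, s, hl, hs, hxl⟩
    · exact (h.not_pos_of_eq_smul hk hij ha' hb' hc hd e).elim
    rcases pos_and_pos_or_vertex hc hd hp'.ne_zero with ⟨hc', hd'⟩ | ⟨m, r, hm, hr, hym⟩
    · refine (h.not_pos_of_eq_smul hk hij.symm hc' hd' ha hb (t := t⁻¹) ?_).elim
      rw [e, smul_smul, inv_mul_cancel₀ ht, one_smul]
    rw [hxl, hym, smul_smul] at e
    have hlm : l = m := h.eq_of_eq_smul (c := s⁻¹ * (t * r)) (by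
      rw [mul_smul, ← e, smul_smul, inv_mul_cancel₀ hs.ne', one_smul])
    refine ⟨l, hl, hlm ▸ hm, ?_⟩
    rw [hxl] at hp
    exact hp.eq ((isRep_mk _ (h.ne_zero l) (h.self l)).smul_ne_zero hs.ne')

lemma isLift_polygon (hk : 6 ≤ k) (h : IsNegativeCycle v) : (h.polygon hk).IsLift v :=
  fun i => ⟨isRep_mk _ (h.ne_zero i) (h.self i), rfl⟩

lemma isNegativeLift (hk : 6 ≤ k) (h : IsNegativeCycle v) {P : MarkedPolygon k}
    (hP : P.IsLift v) : P.IsNegativeLift v := by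
  rintro x ⟨hx, i, a, b, ha, hb, rfl⟩ y ⟨hy, j, c, d, hc, hd, rfl⟩ -
  refine ⟨h.form_comb_comb i j ha hb hc hd, fun h0 => ?_, ?_⟩
  · obtain ⟨l, ⟨a', b', ha', hb', e⟩, ⟨c', d', hc', hd', e'⟩⟩ :=
      h.exists_common_edge hk ha hb hc hd hx hy h0
    rw [e] at hx ⊢
    rw [e'] at hy ⊢
    refine ⟨l, Ein.mk _ hx (h.form_comb_eq_zero l a' b' a' b'), ?_,
      Ein.mk _ hy (h.form_comb_eq_zero l c' d' c' d'), ?_, isRep_mk _ _ _, isRep_mk _ _ _⟩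
    · rw [(hP l).2]; exact ⟨a', b', ha', hb', isRep_mk _ _ _⟩
    · rw [(hP l).2]; exact ⟨c', d', hc', hd', isRep_mk _ _ _⟩
  · rintro ⟨l, p, hp, q, hq, hxp, hyq⟩
    rw [(hP l).2] at hp hq
    obtain ⟨a', b', -, -, hp⟩ := hp
    obtain ⟨c', d', -, -, hq⟩ := hq
    obtain ⟨s, -, e⟩ := hxp.exists_smul hp
    obtain ⟨t, -, e'⟩ := hyq.exists_smul hq
    rw [e, e', form_smul_left, form_smul_right, h.form_comb_eq_zero, mul_zero, mul_zero]

end IsNegativeCycle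

lemma vertex_mem_edge (P : MarkedPolygon k) (i : ZMod k) : P.vertex i ∈ P.edge i := by
  obtain ⟨u, w, -, -, -, -, h, -, e⟩ := P.edge_photon i
  rw [e]
  exact ⟨1, 0, zero_le_one, le_rfl, by simpa using h⟩

lemma eq_or_eq_of_vertex_mem_edge (P : MarkedPolygon k) {i l : ZMod k}
    (h : P.vertex i ∈ P.edge l) : i = l ∨ i = l + 1 := by
  by_cases hil : i = l
  · exact .inl hil
  obtain ⟨m, -, h2, h3⟩ := P.edge_inter i l hil _ (P.vertex_mem_edge i) h
  rwa [P.vertex_injective h3]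

/-- The generators of the lift of a negative future-directed polygon form a negative cycle. -/
lemma isNegativeCycle_of_isLift {P : MarkedPolygon k} {v : ZMod k → R23} (h1 : P.IsLift v)
    (h2 : P.IsNegativeLift v) (h3 : IsFutureLift v) : IsNegativeCycle v where
  self i := (h1 i).1.form_eq_zero
  next i := by
    obtain ⟨u, w, -, -, h, -, hu, hw, -⟩ := P.edge_photon i
    obtain ⟨a, -, ha⟩ := (h1 i).1.exists_smul hu
    obtain ⟨b, -, hb⟩ := (h1 (i + 1)).1.exists_smul hw
    rw [ha, hb, form_smul_left, form_smul_right, h, mul_zero, mul_zero]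
  neg i j h4 h5 h6 := by
    have hmem : ∀ l, v l ∈ cone v := fun l =>
      ⟨(h1 l).1.ne_zero, l, 1, 0, zero_le_one, le_rfl, by simp⟩
    have hli : LinearIndependent ℝ ![v i, v j] := by
      rw [LinearIndependent.pair_iff]
      intro s t hst
      by_cases hs : s = 0
      · rw [hs, zero_smul, zero_add] at hst
        exact ⟨hs, (smul_eq_zero.mp hst).resolve_right (h1 j).1.ne_zero⟩
      · have e : v i = (-(s⁻¹ * t)) • v j := by
          have : s⁻¹ • (s • v i + t • v j) = 0 := by rw [hst, smul_zero]
          rw [smul_add, smul_smul, inv_mul_cancel₀ hs, one_smul, smul_smul] at this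
          rw [neg_smul]
          exact eq_neg_of_add_eq_zero_left this
        have hne : -(s⁻¹ * t) ≠ 0 := by
          intro h0
          rw [h0, zero_smul] at e
          exact (h1 i).1.ne_zero e
        have := (h1 j).1.smul_ne_zero hne
        rw [← e] at this
        exact absurd (P.vertex_injective (this.eq (h1 i).1)) h4
    obtain ⟨h7, h8⟩ := h2 _ (hmem i) _ (hmem j) hli
    refine lt_of_le_of_ne h7 fun h0 => ?_
    obtain ⟨l, p, hp, q, hq, hip, hjq⟩ := h8.mp h0
    rw [hip.eq (h1 i).1] at hp
    rw [hjq.eq (h1 j).1] at hq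
    rcases P.eq_or_eq_of_vertex_mem_edge hp with rfl | rfl <;>
    rcases P.eq_or_eq_of_vertex_mem_edge hq with rfl | rfl <;> simp_all
  future := h3

end MarkedPolygon
end

noncomputable section
open R23 Ein

/-! ### The winding number of a negative cycle -/

lemma ZMod.sum_eq_sum_range {k : ℕ} [NeZero k] {M : Type*} [AddCommMonoid M] (f : ZMod k → M) :
    ∑ i, f i = ∑ n ∈ Finset.range k, f n :=
  Finset.sum_nbij' ZMod.val (fun n => (n : ZMod k))
    (fun i _ => Finset.mem_range.mpr i.val_lt) (fun _ _ => Finset.mem_univ _)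
    (fun i _ => ZMod.natCast_zmod_val i)
    (fun _ hn => ZMod.val_cast_of_lt (Finset.mem_range.mp hn))
    (fun i _ => by rw [ZMod.natCast_zmod_val i])

namespace R23

/-- Two isotropic vectors with the same space-like part have non-negative product, and they agree
if the product vanishes. -/
lemma eq_of_spacePart_eq {x y : R23} (hx : form x x = 0) (hy : form y y = 0)
    (hxy : MarkedPolygon.spacePart x = MarkedPolygon.spacePart y) (h : form x y ≤ 0) : x = y := by
  have e0 : (x 0 + x 2) / 2 = (y 0 + y 2) / 2 := congrArg Complex.re hxy
  have e1 : (x 1 + x 3) / 2 = (y 1 + y 3) / 2 := congrArg Complex.im hxy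
  have h2 : x 2 - y 2 = -(x 0 - y 0) := by linarith
  have h3 : x 3 - y 3 = -(x 1 - y 1) := by linarith
  have key : 2 * form x y = 2 * (x 0 - y 0) ^ 2 + 2 * (x 1 - y 1) ^ 2 + (x 4 - y 4) ^ 2 := by
    have : 2 * form x y = form x x + form y y - form (x - y) (x - y) := by
      simp only [form, Pi.sub_apply]; ring
    rw [this, hx, hy]
    simp only [form, Pi.sub_apply, h2, h3]
    ring
  have s0 : x 0 - y 0 = 0 := by
    rw [← sq_eq_zero_iff]
    nlinarith [sq_nonneg (x 0 - y 0), sq_nonneg (x 1 - y 1), sq_nonneg (x 4 - y 4)]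
  have s1 : x 1 - y 1 = 0 := by
    rw [← sq_eq_zero_iff]
    nlinarith [sq_nonneg (x 0 - y 0), sq_nonneg (x 1 - y 1), sq_nonneg (x 4 - y 4)]
  have s4 : x 4 - y 4 = 0 := by
    rw [← sq_eq_zero_iff]
    nlinarith [sq_nonneg (x 0 - y 0), sq_nonneg (x 1 - y 1), sq_nonneg (x 4 - y 4)]
  ext i
  fin_cases i <;> simp <;> linarith

end R23

namespace MarkedPolygon

variable {k : ℕ}

lemma spacePart_add (x y : R23) : spacePart (x + y) = spacePart x + spacePart y := by
  apply Complex.ext <;> simp [spacePart] <;> ring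

lemma spacePart_smul (a : ℝ) (x : R23) : spacePart (a • x) = a * spacePart x := by
  apply Complex.ext <;> simp [spacePart] <;> ring

namespace IsNegativeCycle

variable {v : ZMod k → R23}

lemma spacePart_ne_zero (h : IsNegativeCycle v) (i : ZMod k) : spacePart (v i) ≠ 0 := by
  intro h0
  have := h.future i
  have e0 : (v i 0 + v i 2) / 2 = 0 := congrArg Complex.re h0
  have e1 : (v i 1 + v i 3) / 2 = 0 := congrArg Complex.im h0
  rw [dVol_timeFrame, show v i 0 + v i 2 = 0 by linarith,
    show v i 1 + v i 3 = 0 by linarith] at this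
  simp at this

/-- The angle by which the space-like part turns along an edge. -/
def edgeAngle (v : ZMod k → R23) (n : ℕ) : ℝ :=
  Complex.arg (spacePart (v ((n : ZMod k) + 1)) / spacePart (v n))

lemma edgeAngle_mem (h : IsNegativeCycle v) (n : ℕ) : edgeAngle v n ∈ Set.Ioo 0 Real.pi := by
  have him : 0 < (spacePart (v ((n : ZMod k) + 1)) / spacePart (v n)).im := by
    rw [Complex.div_im, div_sub_div_same]
    refine div_pos ?_ (Complex.normSq_pos.mpr (h.spacePart_ne_zero _))
    have := h.future n
    rw [dVol_timeFrame] at this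
    simp only [spacePart]
    linarith
  refine ⟨lt_of_le_of_ne (Complex.arg_nonneg_iff.mpr him.le) fun h0 => ?_,
    Complex.arg_lt_pi_iff.mpr (.inr him.ne')⟩
  exact him.ne' (Complex.arg_eq_zero_iff.mp h0.symm).2

/-- The sum of the angles of the first `n` edges. -/
def partialAngle (v : ZMod k → R23) (n : ℕ) : ℝ := ∑ i ∈ Finset.range n, edgeAngle v i

lemma exists_spacePart_eq (h : IsNegativeCycle v) (n : ℕ) : ∃ r : ℝ, 0 < r ∧
    spacePart (v n) = r * Complex.exp (partialAngle v n * Complex.I) * spacePart (v 0) := by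
  induction n with
  | zero => exact ⟨1, one_pos, by simp [partialAngle]⟩
  | succ n ih =>
    obtain ⟨r, hr, e⟩ := ih
    have hn := h.spacePart_ne_zero n
    have hn1 := h.spacePart_ne_zero ((n : ZMod k) + 1)
    refine ⟨‖spacePart (v ((n : ZMod k) + 1)) / spacePart (v n)‖ * r,
      mul_pos (norm_pos_iff.mpr (div_ne_zero hn1 hn)) hr, ?_⟩
    have e1 := Complex.norm_mul_exp_arg_mul_I (spacePart (v ((n : ZMod k) + 1)) / spacePart (v n))
    rw [partialAngle, Finset.sum_range_succ, Nat.cast_succ, ← partialAngle, Complex.ofReal_add,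
      add_mul, Complex.exp_add, Complex.ofReal_mul]
    change _ = _ * _ * (_ * Complex.exp (Complex.arg _ * Complex.I)) * _
    calc spacePart (v ((n : ZMod k) + 1))
        = spacePart (v ((n : ZMod k) + 1)) / spacePart (v n) * spacePart (v n) := by
          rw [div_mul_cancel₀ _ hn]
      _ = _ := by
        nth_rewrite 1 [← e1]
        rw [e]
        ring

/-- The space-like part of a negative cycle turns exactly once: if it turned further, an edge would
contain a point with the same space-like part as `v 0`, and by negativity this point would be `v 0`
itself, contrary to embeddedness. -/
lemma isGeneratingLift (hk : 6 ≤ k) (h : IsNegativeCycle v) : IsGeneratingLift v := by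
  have : NeZero k := ⟨by omega⟩
  have htot : turningAngle v = partialAngle v k := by
    rw [turningAngle, finsum_eq_sum_of_fintype, ZMod.sum_eq_sum_range]
    rfl
  have hpos : 0 < partialAngle v k :=
    Finset.sum_pos (fun i _ => (h.edgeAngle_mem i).1) ⟨0, Finset.mem_range.mpr (by omega)⟩
  obtain ⟨m, hm⟩ : ∃ m : ℤ, partialAngle v k = m * (2 * Real.pi) := by
    obtain ⟨r, hr, e⟩ := h.exists_spacePart_eq k
    have h1 : (r : ℂ) * Complex.exp (partialAngle v k * Complex.I) = 1 := by
      rw [ZMod.natCast_self] at e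
      exact mul_right_cancel₀ (h.spacePart_ne_zero 0) (by rw [← e, one_mul])
    have h2 : r = 1 := by
      have := congrArg norm h1
      rwa [norm_mul, Complex.norm_exp_ofReal_mul_I, mul_one, norm_one, Complex.norm_real,
        Real.norm_of_nonneg hr.le] at this
    rw [h2, Complex.ofReal_one, one_mul, Complex.exp_eq_one_iff] at h1
    obtain ⟨m, hm⟩ := h1
    refine ⟨m, ?_⟩
    have h3 : (partialAngle v k : ℂ) = m * (2 * Real.pi) := by
      apply mul_right_cancel₀ Complex.I_ne_zero
      rw [hm]; ring
    exact_mod_cast h3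
  rw [IsGeneratingLift, htot, abs_of_pos hpos]
  have hm1 : 0 < m := by
    by_contra hn
    have : (m : ℝ) ≤ 0 := by exact_mod_cast not_lt.mp hn
    have := mul_nonpos_of_nonpos_of_nonneg this Real.two_pi_pos.le
    linarith
  by_contra hne
  have hlt : 2 * Real.pi < partialAngle v k := by
    have hm2 : 2 ≤ m := by
      by_contra hn
      have : m = 1 := by omega
      exact hne (by rw [hm, this]; simp)
    have : (2 : ℝ) ≤ m := by exact_mod_cast hm2
    rw [hm]
    nlinarith [Real.pi_pos]
  -- the edge on which the angle exceeds `2π` for the first time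
  obtain ⟨n, hnk, hn1, hn2⟩ : ∃ n < k, partialAngle v n ≤ 2 * Real.pi ∧
      2 * Real.pi < partialAngle v (n + 1) := by
    have hex : ∃ n, 2 * Real.pi < partialAngle v n := ⟨k, hlt⟩
    classical
    have hf := Nat.find_spec hex
    have hle : Nat.find hex ≤ k := Nat.find_min' hex hlt
    obtain ⟨n, hn⟩ : ∃ n, Nat.find hex = n + 1 := by
      refine Nat.exists_eq_succ_of_ne_zero fun h0 => ?_
      rw [h0] at hf
      simp only [partialAngle, Finset.range_zero, Finset.sum_empty] at hf
      linarith [Real.pi_pos]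
    exact ⟨n, by omega, not_lt.mp (Nat.find_min hex (by omega)), hn ▸ hf⟩
  have hstep : partialAngle v (n + 1) = partialAngle v n + edgeAngle v n :=
    Finset.sum_range_succ _ _
  obtain ⟨hθ0, hθ1⟩ := h.edgeAngle_mem n
  have hn0 : (n : ZMod k) ≠ 0 := by
    refine ZMod.natCast_ne_zero_of_lt (Nat.pos_of_ne_zero ?_) hnk
    rintro rfl
    simp only [partialAngle, Finset.range_zero, Finset.sum_empty] at hstep
    simp only [partialAngle] at hn2
    linarith [Real.pi_pos]
  set α := 2 * Real.pi - partialAngle v n with hα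
  set β := partialAngle v (n + 1) - 2 * Real.pi with hβ
  have hα0 : 0 ≤ α := by linarith
  have hβ0 : 0 < β := by linarith
  have hαβ : α + β < Real.pi := by linarith
  obtain ⟨r, hr, e⟩ := h.exists_spacePart_eq n
  obtain ⟨s, hs, e'⟩ := h.exists_spacePart_eq (n + 1)
  have hexp : Complex.exp (partialAngle v n * Complex.I)
      = Complex.cos α - Complex.sin α * Complex.I := by
    have : (partialAngle v n : ℂ) * Complex.I = (-α : ℂ) * Complex.I + 2 * Real.pi * Complex.I := by
      rw [hα]; push_cast; ring
    rw [this, Complex.exp_add, Complex.exp_two_pi_mul_I, mul_one, Complex.exp_mul_I,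
      Complex.cos_neg, Complex.sin_neg]
    ring
  have hexp' : Complex.exp (partialAngle v (n + 1) * Complex.I)
      = Complex.cos β + Complex.sin β * Complex.I := by
    have : (partialAngle v (n + 1) : ℂ) * Complex.I
        = (β : ℂ) * Complex.I + 2 * Real.pi * Complex.I := by
      rw [hβ]; push_cast; ring
    rw [this, Complex.exp_add, Complex.exp_two_pi_mul_I, mul_one, Complex.exp_mul_I]
  have hsα : 0 ≤ Real.sin α := Real.sin_nonneg_of_nonneg_of_le_pi hα0 (by linarith)
  have hsβ : 0 < Real.sin β := Real.sin_pos_of_pos_of_lt_pi hβ0 (by linarith)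
  have hsαβ : 0 < Real.sin (α + β) := Real.sin_pos_of_pos_of_lt_pi (by linarith) hαβ
  -- the point of this edge whose space-like part is that of `v 0`, by the law of sines
  set a := Real.sin β / (r * Real.sin (α + β)) with ha
  set b := Real.sin α / (s * Real.sin (α + β)) with hb
  have ha0 : 0 < a := by positivity
  have hb0 : 0 ≤ b := by positivity
  have hx : spacePart (a • v n + b • v ((n : ZMod k) + 1)) = spacePart (v 0) := by
    rw [Nat.cast_succ] at e'
    rw [spacePart_add, spacePart_smul, spacePart_smul, e, e', hexp, hexp', ha, hb]
    have hc : (Real.sin (α + β) : ℂ) ≠ 0 := by exact_mod_cast hsαβ.ne'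
    have hr' : (r : ℂ) ≠ 0 := by exact_mod_cast hr.ne'
    have hs' : (s : ℂ) ≠ 0 := by exact_mod_cast hs.ne'
    have hadd : (Real.sin (α + β) : ℂ)
        = Complex.sin α * Complex.cos β + Complex.cos α * Complex.sin β := by
      push_cast
      exact Complex.sin_add _ _
    push_cast at hc hadd ⊢
    field_simp
    rw [hadd]
    ring
  have hv0 := eq_of_spacePart_eq (h.form_comb_eq_zero n a b a b) (h.self 0) hx
    (by simpa using h.form_comb_comb n 0 ha0.le hb0 zero_le_one le_rfl)
  rcases hb0.eq_or_lt with hb0 | hb0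
  · rw [← hb0, zero_smul, add_zero] at hv0
    exact hn0 (h.eq_of_eq_smul hv0.symm).symm
  · exact h.not_pos_of_eq_smul hk hn0 ha0 hb0 zero_le_one le_rfl (t := 1) (by simpa using hv0)

end IsNegativeCycle

/-- Families that generate lifts of future-directed negative polygons are exactly the negative
cycles. -/
lemma exists_isFutureNegativeLift_iff (hk : 6 ≤ k) {v : ZMod k → R23} :
    (∃ P : MarkedPolygon k, P.IsFutureNegativeLift v) ↔ IsNegativeCycle v := by
  constructor
  · rintro ⟨P, h1, h2, h3, -⟩
    exact isNegativeCycle_of_isLift h1 h2 h3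
  · intro h
    exact ⟨h.polygon hk, h.isLift_polygon hk, h.isNegativeLift hk (h.isLift_polygon hk), h.future,
      h.isGeneratingLift hk⟩

end MarkedPolygon
end

noncomputable section
open R23 Ein

/-! ### Transitivity of `SO₀(2,3)` -/

namespace R23

/-- The Gram determinant of five vectors. -/
lemma neg_sq_dVol (b : Fin 5 → R23) :
    -dVol (b 0) (b 1) (b 2) (b 3) (b 4) ^ 2 = (Matrix.of fun i j => form (b i) (b j)).det := by
  set J : Matrix (Fin 5) (Fin 5) ℝ := Matrix.of ![![0, 0, 1, 0, 0], ![0, 0, 0, 1, 0],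
    ![1, 0, 0, 0, 0], ![0, 1, 0, 0, 0], ![0, 0, 0, 0, -1]] with hJ
  have hdet : J.det = -1 := by
    change dVol _ _ _ _ _ = _
    rw [dVol_eq]
    simp
  have hM : dVol (b 0) (b 1) (b 2) (b 3) (b 4) = (Matrix.of b).det := by
    rw [dVol]
    congr 1
    ext i j
    fin_cases i <;> rfl
  have : (Matrix.of fun i j => form (b i) (b j))
      = Matrix.of b * J * (Matrix.of b).transpose := by
    ext i j
    simp only [Matrix.mul_apply, Fin.sum_univ_five, hJ, Matrix.of_apply, Matrix.transpose_apply,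
      form]
    simp
    ring
  rw [this, Matrix.det_mul, Matrix.det_mul, Matrix.det_transpose, hdet, hM]
  ring

/-- A pair of hyperbolic planes is completed to a basis of determinant one by a time-like unit
vector: the sign of its square is that of the Gram determinant. -/
lemma exists_normal {b₀ b₁ b₂ b₃ : R23} (h00 : form b₀ b₀ = 0) (h01 : form b₀ b₁ = 0)
    (h02 : form b₀ b₂ = 1) (h03 : form b₀ b₃ = 0) (h11 : form b₁ b₁ = 0) (h12 : form b₁ b₂ = 0)
    (h13 : form b₁ b₃ = 1) (h22 : form b₂ b₂ = 0) (h23 : form b₂ b₃ = 0) (h33 : form b₃ b₃ = 0) :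
    ∃ m : R23, dVol b₀ b₁ b₂ b₃ m = 1 ∧ form m m = -1 ∧
      (form b₀ m = 0 ∧ form b₁ m = 0 ∧ form b₂ m = 0 ∧ form b₃ m = 0) := by
  have hgram : ∀ n, form b₀ n = 0 → form b₁ n = 0 → form b₂ n = 0 → form b₃ n = 0 →
      -dVol b₀ b₁ b₂ b₃ n ^ 2 = form n n := by
    intro n h0 h1 h2 h3
    have := neg_sq_dVol ![b₀, b₁, b₂, b₃, n]
    have e : (Matrix.of fun i j => form ((![b₀, b₁, b₂, b₃, n] : Fin 5 → R23) i)
        ((![b₀, b₁, b₂, b₃, n] : Fin 5 → R23) j)) = Matrix.of ![![0, 0, 1, 0, 0],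
        ![0, 0, 0, 1, 0], ![1, 0, 0, 0, 0], ![0, 1, 0, 0, 0], ![0, 0, 0, 0, form n n]] := by
      ext i j
      fin_cases i <;> fin_cases j <;>
        simp [h00, h01, h02, h03, h11, h12, h13, h22, h23, h33, h0, h1, h2, h3, form_comm b₁ b₀,
          form_comm b₂ b₀, form_comm b₃ b₀, form_comm b₂ b₁, form_comm b₃ b₁, form_comm b₃ b₂,
          form_comm n b₀, form_comm n b₁, form_comm n b₂, form_comm n b₃]
    rw [e] at this
    refine Eq.trans this ?_
    change dVol _ _ _ _ _ = _
    rw [dVol_eq]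
    simp
  obtain ⟨n, hn0, hn⟩ : ∃ n : R23, n ≠ 0 ∧
      (form b₀ n = 0 ∧ form b₁ n = 0 ∧ form b₂ n = 0 ∧ form b₃ n = 0) := by
    let F : R23 →ₗ[ℝ] (Fin 4 → ℝ) :=
      { toFun := fun x => ![form b₀ x, form b₁ x, form b₂ x, form b₃ x]
        map_add' := fun x y => by ext i; fin_cases i <;> simp
        map_smul' := fun a x => by ext i; fin_cases i <;> simp }
    have hker : LinearMap.ker F ≠ ⊥ := LinearMap.ker_ne_bot_of_finrank_lt (by simp)
    obtain ⟨n, hn, hn0⟩ := (Submodule.ne_bot_iff _).mp hker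
    exact ⟨n, hn0, congrFun hn 0, congrFun hn 1, congrFun hn 2, congrFun hn 3⟩
  obtain ⟨h0, h1, h2, h3⟩ := hn
  have hd : dVol b₀ b₁ b₂ b₃ n ≠ 0 := by
    intro hd
    obtain ⟨t, ht, e⟩ := exists_of_dVol_eq_zero hd
    have key : ∀ b, form b (t 0 • b₀ + t 1 • b₁ + (t 2 • b₂ + t 3 • b₃ + t 4 • n)) = 0 := by
      intro b; rw [e, form_zero_right]
    have e0 := key b₂
    have e1 := key b₃
    have e2 := key b₀
    have e3 := key b₁
    simp [h00, h01, h02, h03, h11, h12, h13, h22, h23, h33, h0, h1, h2, h3, form_comm b₁ b₀,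
          form_comm b₂ b₀, form_comm b₃ b₀, form_comm b₂ b₁, form_comm b₃ b₁, form_comm b₃ b₂]
      at e0 e1 e2 e3
    simp [e0, e1, e2, e3, hn0] at e
    apply ht
    ext i; fin_cases i <;> simp [e0, e1, e2, e3, e]
  set d := dVol b₀ b₁ b₂ b₃ n with hddef
  have g0 : form b₀ (d⁻¹ • n) = 0 := by rw [form_smul_right, h0, mul_zero]
  have g1 : form b₁ (d⁻¹ • n) = 0 := by rw [form_smul_right, h1, mul_zero]
  have g2 : form b₂ (d⁻¹ • n) = 0 := by rw [form_smul_right, h2, mul_zero]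
  have g3 : form b₃ (d⁻¹ • n) = 0 := by rw [form_smul_right, h3, mul_zero]
  have hdm : dVol b₀ b₁ b₂ b₃ (d⁻¹ • n) = 1 := by
    have : dVol b₀ b₁ b₂ b₃ (d⁻¹ • n) = d⁻¹ * d := by
      rw [hddef, dVol_eq b₀ b₁ b₂ b₃ n, dVol_eq]
      simp only [Pi.smul_apply, smul_eq_mul]
      ring
    rw [this, inv_mul_cancel₀ hd]
  refine ⟨d⁻¹ • n, hdm, ?_, g0, g1, g2, g3⟩
  rw [← hgram _ g0 g1 g2 g3, hdm]
  norm_num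

/-- `SO₀(2,3)` acts transitively on pairs of dual bases of future-directed isotropic planes. -/
lemma exists_SO0_of_gram {b₀ b₁ b₂ b₃ : R23} (h00 : form b₀ b₀ = 0) (h01 : form b₀ b₁ = 0)
    (h02 : form b₀ b₂ = 1) (h03 : form b₀ b₃ = 0) (h11 : form b₁ b₁ = 0) (h12 : form b₁ b₂ = 0)
    (h13 : form b₁ b₃ = 1) (h22 : form b₂ b₂ = 0) (h23 : form b₂ b₃ = 0) (h33 : form b₃ b₃ = 0)
    (hfut : 0 < dVol b₀ b₁ (timeFrame 0) (timeFrame 1) (timeFrame 2)) :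
    ∃ A : SO0, A.1 (Pi.single 0 1) = b₀ ∧ A.1 (Pi.single 1 1) = b₁ ∧
      A.1 (Pi.single 2 1) = b₂ ∧ A.1 (Pi.single 3 1) = b₃ := by
  obtain ⟨m, hm1, hmm, hm⟩ :=
    exists_normal h00 h01 h02 h03 h11 h12 h13 h22 h23 h33
  obtain ⟨h0, h1, h2, h3⟩ := hm
  let F : R23 →ₗ[ℝ] R23 :=
    { toFun := fun x => x 0 • b₀ + x 1 • b₁ + x 2 • b₂ + x 3 • b₃ + x 4 • m
      map_add' := fun x y => by simp only [Pi.add_apply]; module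
      map_smul' := fun a x => by simp only [Pi.smul_apply, smul_eq_mul, RingHom.id_apply]; module }
  have hF : ∀ x y, form (F x) (F y) = form x y := by
    intro x y
    change form (x 0 • b₀ + x 1 • b₁ + x 2 • b₂ + x 3 • b₃ + x 4 • m)
      (y 0 • b₀ + y 1 • b₁ + y 2 • b₂ + y 3 • b₃ + y 4 • m) = _
    simp only [form_add_left, form_add_right, form_smul_left, form_smul_right,
      h00, h01, h02, h03, h11, h12, h13, h22, h23, h33, h0, h1, h2, h3, form_comm b₁ b₀,
      form_comm b₂ b₀, form_comm b₃ b₀, form_comm b₂ b₁, form_comm b₃ b₁, form_comm b₃ b₂,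
      form_comm m b₀, form_comm m b₁, form_comm m b₂, form_comm m b₃, hmm]
    rw [form]
    ring
  have hinj : Function.Injective F := by
    rw [injective_iff_map_eq_zero]
    intro x hx
    have key : ∀ y, form x y = 0 := fun y => by rw [← hF, hx, form_zero_left]
    have e0 := key (Pi.single 2 1)
    have e1 := key (Pi.single 3 1)
    have e2 := key (Pi.single 0 1)
    have e3 := key (Pi.single 1 1)
    have e4 := key (Pi.single 4 1)
    simp [form] at e0 e1 e2 e3 e4
    ext i; fin_cases i <;> simpa
  let A : R23 ≃ₗ[ℝ] R23 := LinearEquiv.ofInjectiveEndo F hinj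
  have hA : ∀ x, A x = F x := fun x => rfl
  have a0 : A (Pi.single 0 1) = b₀ := by simp [hA, F]
  have a1 : A (Pi.single 1 1) = b₁ := by simp [hA, F]
  have a2 : A (Pi.single 2 1) = b₂ := by simp [hA, F]
  have a3 : A (Pi.single 3 1) = b₃ := by simp [hA, F]
  have a4 : A (Pi.single 4 1) = m := by simp [hA, F]
  have hdet : LinearMap.det (A : R23 →ₗ[ℝ] R23) = 1 := by
    have := dVol_map A (Pi.single 0 1) (Pi.single 1 1) (Pi.single 2 1) (Pi.single 3 1)
      (Pi.single 4 1)
    rw [a0, a1, a2, a3, a4, hm1] at this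
    have h1 : dVol (Pi.single 0 1) (Pi.single 1 1) (Pi.single 2 1) (Pi.single 3 1)
      (Pi.single 4 1) = 1 := by rw [dVol_eq]; simp
    rw [h1, mul_one] at this
    exact this.symm
  refine ⟨⟨A, mem_SO0_of_dVol_pos (fun x y => by rw [hA, hA, hF]) hdet
    (a := Pi.single 0 1) (b := Pi.single 1 1) (by simp [form]) (by simp [form]) (by simp [form])
    ?_ ?_⟩, a0, a1, a2, a3⟩
  · rw [dVol_timeFrame]; simp
  · rwa [a0, a1]

end R23
end

noncomputable section
open R23 Ein

/-! ### Polygons from light-like paths in Minkowski space -/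

/-- The area form of the plane. -/
def wedge (p q : ℝ × ℝ) : ℝ := p.1 * q.2 - p.2 * q.1

/-- The future light cone of the Minkowski space `{x₁ = x₃ = 0}` of signature (1,2), parametrized
two-to-one by vectors of the plane. -/
def nullVec (p : ℝ × ℝ) : R23 := ![0, p.1 ^ 2, 0, 2 * p.2 ^ 2, 2 * p.1 * p.2]

/-- The conformal embedding of Minkowski space in the light cone of `ℝ^{2,3}`. Its values have
product `-1` with the point at infinity `-e₃`. -/
def affVec (x : R23) : R23 := ![1, x 1, -(form x x / 2), x 3, x 4]

/-- The derivative of `affVec` at `x` in the direction `y`: for isotropic `y` it generates the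
limit at infinity of the light ray that starts at `x` in the direction `y`. -/
def horizonVec (x y : R23) : R23 := ![0, y 1, -form x y, y 3, y 4]

/-- The path in Minkowski space that starts at the origin and has the steps `nullVec (p 1)`,
`nullVec (p 2)`, …. -/
def lightPath (p : ℕ → ℝ × ℝ) (j : ℕ) : R23 := ∑ i ∈ Finset.range j, nullVec (p (i + 1))

/-- The vertices, enumerated by natural numbers, of the polygon that consists of the light-like
path `lightPath p` and of three vertices at infinity, on the light rays through the endpoints of
the path in the directions `p 0` and `p (k - 3)`. The vertex `0` is the point at infinity. -/
def polygonVec (k : ℕ) (p : ℕ → ℝ × ℝ) (n : ℕ) : R23 :=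
  if n = 0 then -Pi.single 2 1
  else if n = 1 then -nullVec (p 0)
  else if n = k - 1 then horizonVec (lightPath p (k - 4)) (nullVec (p (k - 3)))
  else affVec (lightPath p (n - 2))

@[simp] lemma nullVec_zero (p : ℝ × ℝ) : nullVec p 0 = 0 := rfl
@[simp] lemma nullVec_one (p : ℝ × ℝ) : nullVec p 1 = p.1 ^ 2 := rfl
@[simp] lemma nullVec_two (p : ℝ × ℝ) : nullVec p 2 = 0 := rfl
@[simp] lemma nullVec_three (p : ℝ × ℝ) : nullVec p 3 = 2 * p.2 ^ 2 := rfl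
@[simp] lemma nullVec_four (p : ℝ × ℝ) : nullVec p 4 = 2 * p.1 * p.2 := rfl

lemma form_nullVec (p q : ℝ × ℝ) : form (nullVec p) (nullVec q) = 2 * wedge p q ^ 2 := by
  simp only [form, nullVec_zero, nullVec_one, nullVec_two, nullVec_three, nullVec_four, wedge]
  ring

lemma wedge_self (p : ℝ × ℝ) : wedge p p = 0 := by simp only [wedge]; ring

lemma wedge_comm (p q : ℝ × ℝ) : wedge q p = -wedge p q := by simp only [wedge]; ring

@[simp] lemma lightPath_apply_zero (p : ℕ → ℝ × ℝ) (j : ℕ) : lightPath p j 0 = 0 := by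
  simp [lightPath, Finset.sum_apply]

@[simp] lemma lightPath_apply_two (p : ℕ → ℝ × ℝ) (j : ℕ) : lightPath p j 2 = 0 := by
  simp [lightPath, Finset.sum_apply]

lemma lightPath_zero (p : ℕ → ℝ × ℝ) : lightPath p 0 = 0 := by simp [lightPath]

lemma lightPath_succ (p : ℕ → ℝ × ℝ) (j : ℕ) :
    lightPath p (j + 1) = lightPath p j + nullVec (p (j + 1)) := Finset.sum_range_succ _ _

/-- The difference of the points of a light-like path. -/
lemma lightPath_sub_step (p : ℕ → ℝ × ℝ) (i j : ℕ) :
    lightPath p (i + (j + 1)) - lightPath p i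
      = (lightPath p (i + j) - lightPath p i) + nullVec (p (i + j + 1)) := by
  rw [← add_assoc, lightPath_succ]; abel

/-- Chords of a light-like path are causal and future-directed, and such vectors have non-negative
products in Minkowski space. -/
lemma form_sub_nullVec_nonneg (p : ℕ → ℝ × ℝ) (i j : ℕ) (q : ℝ × ℝ) :
    0 ≤ form (lightPath p (i + j) - lightPath p i) (nullVec q) := by
  induction j with
  | zero => simp
  | succ j ih =>
    rw [lightPath_sub_step, form_add_left, form_nullVec]
    positivity

lemma form_sub_nullVec_pos (p : ℕ → ℝ × ℝ) (i j : ℕ) {q : ℝ × ℝ}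
    (hq : wedge (p (i + j + 1)) q ≠ 0) :
    0 < form (lightPath p (i + (j + 1)) - lightPath p i) (nullVec q) := by
  rw [lightPath_sub_step, form_add_left, form_nullVec]
  have := form_sub_nullVec_nonneg p i j q
  positivity

lemma form_sub_sub_nonneg (p : ℕ → ℝ × ℝ) (i j : ℕ) :
    0 ≤ form (lightPath p (i + j) - lightPath p i) (lightPath p (i + j) - lightPath p i) := by
  induction j with
  | zero => simp
  | succ j ih =>
    have := form_sub_nullVec_nonneg p i j (p (i + j + 1))
    rw [lightPath_sub_step, form_add_left, form_add_right, form_add_right, form_nullVec,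
      form_comm (nullVec _)]
    positivity

/-- A chord over at least two steps is time-like if its last two steps are not parallel. -/
lemma form_sub_sub_pos (p : ℕ → ℝ × ℝ) (i j : ℕ)
    (hp : wedge (p (i + j + 1)) (p (i + j + 2)) ≠ 0) :
    0 < form (lightPath p (i + (j + 2)) - lightPath p i)
      (lightPath p (i + (j + 2)) - lightPath p i) := by
  have h1 := form_sub_nullVec_pos p i j hp
  have h2 := form_sub_sub_nonneg p i (j + 1)
  rw [lightPath_sub_step p i (j + 1), form_add_left, form_add_right, form_add_right, form_nullVec,
    form_comm (nullVec _)]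
  have e : i + (j + 1) + 1 = i + j + 2 := by omega
  rw [e]
  positivity

lemma form_affVec {x y : R23} (hx : x 0 = 0) (hx' : x 2 = 0) (hy : y 0 = 0) (hy' : y 2 = 0) :
    form (affVec x) (affVec y) = -(form (y - x) (y - x) / 2) := by
  simp [form, affVec, hx, hx', hy, hy']
  ring

lemma form_affVec_horizonVec {x x' y : R23} (hx : x 0 = 0) (hx' : x 2 = 0) :
    form (affVec x) (horizonVec x' y) = -form (x' - x) y := by
  simp [form, affVec, horizonVec, hx, hx']
  ring

/-- Light rays in the direction of the future cone are future-directed. -/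
lemma dVol_affVec_affVec (x : R23) (hx : x 0 = 0) (hx' : x 2 = 0) {p : ℝ × ℝ} (hp : p ≠ 0) :
    0 < dVol (affVec x) (affVec (x + nullVec p)) (timeFrame 0) (timeFrame 1) (timeFrame 2) := by
  have : dVol (affVec x) (affVec (x + nullVec p)) (timeFrame 0) (timeFrame 1) (timeFrame 2)
      = p.1 ^ 2 + 2 * p.2 ^ 2 + 2 * (p.2 * x 1 - p.1 * x 4 / 2) ^ 2
        + (p.1 * x 3 - p.2 * x 4) ^ 2 := by
    rw [dVol_timeFrame]
    simp [affVec, form, hx, hx']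
    ring
  rw [this]
  have hp' : 0 < p.1 ^ 2 + 2 * p.2 ^ 2 := by
    by_cases h : p.1 = 0
    · have : p.2 ≠ 0 := fun h2 => hp (Prod.ext h h2)
      positivity
    · positivity
  positivity

lemma dVol_affVec_horizonVec (x : R23) (hx : x 0 = 0) (hx' : x 2 = 0) {p : ℝ × ℝ} (hp : p ≠ 0) :
    0 < dVol (affVec x) (horizonVec x (nullVec p)) (timeFrame 0) (timeFrame 1) (timeFrame 2) := by
  have h := dVol_affVec_affVec x hx hx' hp
  have : affVec (x + nullVec p) = affVec x + horizonVec x (nullVec p) := by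
    ext i; fin_cases i <;> simp [affVec, horizonVec, form, hx, hx']
    ring
  rw [this] at h
  rw [dVol_timeFrame] at h ⊢
  simp only [Pi.add_apply] at h
  linarith

namespace MarkedPolygon

/-- The conditions of a negative cycle in terms of representatives of the indices. -/
lemma isNegativeCycle_of_nat {k : ℕ} (hk : 6 ≤ k) {v : ZMod k → R23} (W : ℕ → R23)
    (hv : ∀ i, v i = W i.val) (self : ∀ n < k, form (W n) (W n) = 0)
    (next : ∀ n, n + 1 < k → form (W n) (W (n + 1)) = 0) (last : form (W (k - 1)) (W 0) = 0)
    (neg : ∀ a b, a + 2 ≤ b → b < k → ¬(a = 0 ∧ b = k - 1) → form (W a) (W b) < 0)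
    (fut : ∀ n, n + 1 < k →
      0 < dVol (W n) (W (n + 1)) (timeFrame 0) (timeFrame 1) (timeFrame 2))
    (futLast : 0 < dVol (W (k - 1)) (W 0) (timeFrame 0) (timeFrame 1) (timeFrame 2)) :
    IsNegativeCycle v := by
  have : NeZero k := ⟨by omega⟩
  have : Fact (1 < k) := ⟨by omega⟩
  have hsucc : ∀ i : ZMod k, (i.val + 1 < k ∧ (i + 1).val = i.val + 1) ∨
      (i.val = k - 1 ∧ (i + 1).val = 0) := by
    intro i
    have hi := i.val_lt
    rw [ZMod.val_add, ZMod.val_one]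
    rcases Nat.lt_or_ge (i.val + 1) k with h | h
    · exact .inl ⟨h, Nat.mod_eq_of_lt h⟩
    · have : i.val + 1 = k := by omega
      exact .inr ⟨by omega, by rw [this, Nat.mod_self]⟩
  refine ⟨fun i => ?_, fun i => ?_, ?_, fun i => ?_⟩
  · rw [hv]; exact self _ i.val_lt
  · rw [hv, hv]
    rcases hsucc i with ⟨h, e⟩ | ⟨h, e⟩
    · rw [e]; exact next _ h
    · rw [e, h]; exact last
  · have key : ∀ i j : ZMod k, i.val < j.val → j ≠ i + 1 → i ≠ j + 1 →
        form (v i) (v j) < 0 := by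
      intro i j hij h1 h2
      rw [hv, hv]
      have hj := j.val_lt
      refine neg _ _ ?_ j.val_lt ?_
      · rcases hsucc i with ⟨h, e⟩ | ⟨h, e⟩
        · have : j.val ≠ i.val + 1 := fun h3 => h1 (ZMod.val_injective k (h3.trans e.symm))
          omega
        · omega
      · rintro ⟨h3, h4⟩
        rcases hsucc j with ⟨h, e⟩ | ⟨h, e⟩
        · omega
        · exact h2 (ZMod.val_injective k (h3.trans e.symm))
    intro i j h1 h2 h3
    rcases lt_trichotomy i.val j.val with h | h | h
    · exact key i j h h2 h3
    · exact absurd (ZMod.val_injective k h).symm h1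
    · rw [form_comm]
      exact key j i h h3 h2
  · rw [hv, hv]
    rcases hsucc i with ⟨h, e⟩ | ⟨h, e⟩
    · rw [e]; exact fut _ h
    · rw [e, h]; exact futLast

end MarkedPolygon

section polygonVec

variable {k : ℕ} {p : ℕ → ℝ × ℝ}

lemma polygonVec_zero : polygonVec k p 0 = -Pi.single 2 1 := by simp [polygonVec]

lemma polygonVec_one : polygonVec k p 1 = -nullVec (p 0) := by simp [polygonVec]

lemma polygonVec_last (hk : 6 ≤ k) :
    polygonVec k p (k - 1) = horizonVec (lightPath p (k - 4)) (nullVec (p (k - 3))) := by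
  rw [polygonVec, if_neg (by omega), if_neg (by omega), if_pos rfl]

lemma polygonVec_add_two {n : ℕ} (hn : n + 4 ≤ k) :
    polygonVec k p (n + 2) = affVec (lightPath p n) := by
  rw [polygonVec, if_neg (by omega), if_neg (by omega), if_neg (by omega), Nat.add_sub_cancel]

/-- The polygon of a light-like path is negative and future-directed as soon as the directions of
consecutive steps differ, cyclically. -/
lemma isNegativeCycle_polygonVec (hk : 6 ≤ k) (hp : ∀ j, j + 4 ≤ k → wedge (p j) (p (j + 1)) ≠ 0)
    (hlast : wedge (p (k - 3)) (p 0) ≠ 0) :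
    MarkedPolygon.IsNegativeCycle (fun i : ZMod k => polygonVec k p i.val) := by
  have hp0 : ∀ j, j + 3 ≤ k → p j ≠ 0 := by
    intro j hj h0
    rcases Nat.lt_or_ge (j + 3) k with h | h
    · exact hp j (by omega) (by rw [h0]; simp [wedge])
    · exact hlast (by rw [show k - 3 = j by omega, h0]; simp [wedge])
  -- the vertices are the point at infinity, the ends of the two rays, and the points of the path
  have hcases : ∀ n < k, n = 0 ∨ n = 1 ∨ n = k - 1 ∨ ∃ j, n = j + 2 ∧ j + 4 ≤ k := by
    intro n hn
    rcases n with _ | _ | n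
    · simp
    · simp
    · by_cases h : n + 2 = k - 1
      · simp [h]
      · exact .inr (.inr (.inr ⟨n, rfl, by omega⟩))
  refine MarkedPolygon.isNegativeCycle_of_nat hk (polygonVec k p) (fun _ => rfl) ?_ ?_ ?_ ?_ ?_ ?_
  · intro n hn
    rcases hcases n hn with rfl | rfl | rfl | ⟨j, rfl, hj⟩
    · rw [polygonVec_zero]; simp [form]
    · rw [polygonVec_one, form_neg_left, form_neg_right, form_nullVec, wedge_self]; simp
    · rw [polygonVec_last hk]; simp [form, horizonVec]; ring
    · rw [polygonVec_add_two hj, form_affVec (by simp) (by simp) (by simp) (by simp)]; simp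
  · intro n hn
    rcases hcases n (by omega) with rfl | rfl | rfl | ⟨j, rfl, hj⟩
    · rw [polygonVec_zero, polygonVec_one]; simp [form]
    · rw [polygonVec_one, polygonVec_add_two (n := 0) (by omega), lightPath_zero]
      simp [form, affVec]
    · omega
    · rw [polygonVec_add_two hj]
      by_cases h : j + 4 = k
      · rw [show j + 2 + 1 = k - 1 by omega, polygonVec_last hk, show k - 4 = j by omega,
          form_affVec_horizonVec (by simp) (by simp)]
        simp
      · rw [show j + 2 + 1 = (j + 1) + 2 by omega, polygonVec_add_two (by omega),
          form_affVec (by simp) (by simp) (by simp) (by simp), lightPath_succ]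
        simp [form_nullVec, wedge_self]
  · rw [polygonVec_last hk, polygonVec_zero]; simp [form, horizonVec]
  · intro a b hab hb h
    rcases hcases b hb with rfl | rfl | rfl | ⟨j, rfl, hj⟩
    · omega
    · omega
    · rw [polygonVec_last hk]
      rcases hcases a (by omega) with rfl | rfl | rfl | ⟨i, rfl, hi⟩
      · simp at h
      · have : form (-nullVec (p 0)) (horizonVec (lightPath p (k - 4)) (nullVec (p (k - 3))))
            = -form (nullVec (p 0)) (nullVec (p (k - 3))) := by
          simp [form, horizonVec]; ring
        rw [polygonVec_one, this, form_nullVec, wedge_comm, neg_sq, neg_lt_zero]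
        positivity
      · omega
      · rw [polygonVec_add_two hi, form_affVec_horizonVec (by simp) (by simp), neg_lt_zero]
        have := form_sub_nullVec_pos p i (k - 5 - i) (q := p (k - 3))
          (by rw [show i + (k - 5 - i) + 1 = k - 4 by omega, show k - 3 = k - 4 + 1 by omega]
              exact hp _ (by omega))
        rwa [show i + (k - 5 - i + 1) = k - 4 by omega] at this
    · rw [polygonVec_add_two hj]
      rcases hcases a (by omega) with rfl | rfl | rfl | ⟨i, rfl, hi⟩
      · rw [polygonVec_zero]; simp [form, affVec]
      · have : form (-nullVec (p 0)) (affVec (lightPath p j))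
            = -form (lightPath p j) (nullVec (p 0)) := by
          simp [form, affVec]; ring
        rw [polygonVec_one, this, neg_lt_zero]
        have h1 := form_sub_nullVec_pos p 0 0 (q := p 0)
          (by rw [wedge_comm]; simpa using hp 0 (by omega))
        have h2 := form_sub_nullVec_nonneg p 1 (j - 1) (p 0)
        rw [show 1 + (j - 1) = j by omega] at h2
        have : lightPath p j = (lightPath p j - lightPath p 1)
            + (lightPath p (0 + (0 + 1)) - lightPath p 0) := by
          rw [lightPath_zero]; abel
        rw [this, form_add_left]
        linarith
      · omega
      · rw [polygonVec_add_two hi, form_affVec (by simp) (by simp) (by simp) (by simp),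
          neg_lt_zero]
        have := form_sub_sub_pos p i (j - i - 2) (hp _ (by omega))
        rw [show i + (j - i - 2 + 2) = j by omega] at this
        linarith
  · intro n hn
    rcases hcases n (by omega) with rfl | rfl | rfl | ⟨j, rfl, hj⟩
    · rw [polygonVec_zero, polygonVec_one, dVol_timeFrame]
      have : p 0 ≠ 0 := hp0 0 (by omega)
      simp
      by_cases h : (p 0).1 = 0
      · have : (p 0).2 ≠ 0 := fun h2 => hp0 0 (by omega) (Prod.ext h h2)
        positivity
      · positivity
    · rw [polygonVec_one, polygonVec_add_two (n := 0) (by omega), lightPath_zero, dVol_timeFrame]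
      simp [affVec]
      by_cases h : (p 0).1 = 0
      · have : (p 0).2 ≠ 0 := fun h2 => hp0 0 (by omega) (Prod.ext h h2)
        positivity
      · positivity
    · omega
    · rw [polygonVec_add_two hj]
      by_cases h : j + 4 = k
      · rw [show j + 2 + 1 = k - 1 by omega, polygonVec_last hk, show k - 4 = j by omega]
        exact dVol_affVec_horizonVec _ (by simp) (by simp) (hp0 _ (by omega))
      · rw [show j + 2 + 1 = (j + 1) + 2 by omega, polygonVec_add_two (by omega), lightPath_succ]
        exact dVol_affVec_affVec _ (by simp) (by simp) (hp0 _ (by omega))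
  · rw [polygonVec_last hk, polygonVec_zero, dVol_timeFrame]
    simp [horizonVec]
    by_cases h : (p (k - 3)).1 = 0
    · have : (p (k - 3)).2 ≠ 0 := fun h2 => hp0 (k - 3) (by omega) (Prod.ext h h2)
      positivity
    · positivity

end polygonVec
end

noncomputable section
open R23 Ein

/-! ### Normal forms and their coordinates -/

/-- The sequence in the plane with `wedge (p n) (p (n + 1)) = σ n` and
`wedge (p n) (p (n + 2)) = τ n`, normalised for `σ 0 = 1` by `p 1 = (1, 0)` and
`p 0 = (τ 0, -1)`. -/
def steps (σ τ : ℕ → ℝ) : ℕ → ℝ × ℝ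
  | 0 => (τ 0, -1)
  | 1 => (1, 0)
  | n + 2 => (σ n)⁻¹ • (τ n • steps σ τ (n + 1) - σ (n + 1) • steps σ τ n)

lemma steps_add_two (σ τ : ℕ → ℝ) (n : ℕ) : steps σ τ (n + 2)
    = (σ n)⁻¹ • (τ n • steps σ τ (n + 1) - σ (n + 1) • steps σ τ n) := by rw [steps]

lemma wedge_steps_succ {σ τ : ℕ → ℝ} (h0 : σ 0 = 1) (hσ : ∀ n, σ n ≠ 0) (n : ℕ) :
    wedge (steps σ τ n) (steps σ τ (n + 1)) = σ n := by
  induction n with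
  | zero => simp [steps, wedge, h0]
  | succ n ih =>
    have : wedge (steps σ τ (n + 1)) (steps σ τ (n + 1 + 1))
        = (σ n)⁻¹ * σ (n + 1) * wedge (steps σ τ n) (steps σ τ (n + 1)) := by
      rw [steps_add_two]
      simp only [wedge, Prod.smul_fst, Prod.smul_snd, Prod.fst_sub, Prod.snd_sub, smul_eq_mul]
      ring
    rw [this, ih]
    have := hσ n
    field_simp

lemma wedge_steps_add_two {σ τ : ℕ → ℝ} (h0 : σ 0 = 1) (hσ : ∀ n, σ n ≠ 0) (n : ℕ) :
    wedge (steps σ τ n) (steps σ τ (n + 2)) = τ n := by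
  have : wedge (steps σ τ n) (steps σ τ (n + 2))
      = (σ n)⁻¹ * τ n * wedge (steps σ τ n) (steps σ τ (n + 1)) := by
    rw [steps_add_two]
    simp only [wedge, Prod.smul_fst, Prod.smul_snd, Prod.fst_sub, Prod.snd_sub, smul_eq_mul]
    ring
  rw [this, wedge_steps_succ h0 hσ]
  have := hσ n
  field_simp

/-- The recursion that defines `steps` is the Plücker relation between three vectors of the
plane. -/
lemma eq_steps {σ τ : ℕ → ℝ} {p : ℕ → ℝ × ℝ} {N : ℕ} (hp0 : p 0 = (τ 0, -1)) (hp1 : p 1 = (1, 0))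
    (hσ : ∀ n ≤ N + 1, σ n ≠ 0) (h1 : ∀ n ≤ N + 1, wedge (p n) (p (n + 1)) = σ n)
    (h2 : ∀ n ≤ N, wedge (p n) (p (n + 2)) = τ n) : ∀ n ≤ N + 2, steps σ τ n = p n := by
  intro n
  induction n using Nat.strong_induction_on with
  | _ n ih =>
    intro hn
    match n with
    | 0 => rw [steps, hp0]
    | 1 => rw [steps, hp1]
    | n + 2 =>
      rw [steps_add_two, ih (n + 1) (by omega) (by omega), ih n (by omega) (by omega),
        inv_smul_eq_iff₀ (hσ n (by omega)), ← h1 n (by omega), ← h1 (n + 1) (by omega),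
        ← h2 n (by omega)]
      ext <;> simp only [wedge, Prod.smul_fst, Prod.smul_snd, Prod.fst_sub, Prod.snd_sub,
        smul_eq_mul] <;> ring

/-- The model space of the moduli spaces. The coordinates with index `j < k - 4` are the numbers
`wedge (p j) (p (j + 2))`, and the one with index `k - 6 + n` is `wedge (p n) (p (n + 1))`, for
`2 ≤ n ≤ k - 5`. -/
abbrev Model (k : ℕ) : Type := EuclideanSpace ℝ (Fin (2 * (k - 5)))

/-- The coordinates, extended by zero. -/
def Model.coord {k : ℕ} (u : Model k) (i : ℕ) : ℝ := if h : i < 2 * (k - 5) then u ⟨i, h⟩ else 0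

/-- The numbers `wedge (p n) (p (n + 1))`. They are normalised to be one for `n = 0, 1, k - 4`; the
value for `n > k - 4` is irrelevant. -/
def Model.sigma {k : ℕ} (u : Model k) (n : ℕ) : ℝ :=
  if 2 ≤ n ∧ n + 5 ≤ k then u.coord (k - 6 + n) else 1

/-- The directions of the light-like path with given coordinates. The terms of index up to `k - 3`,
which alone matter, involve `u.coord n` only for `n < k - 4`. -/
def Model.path {k : ℕ} (u : Model k) : ℕ → ℝ × ℝ := steps u.sigma u.coord

/-- The coordinates of the lifted marked polygons: the consecutive areas are positive, and the two
light rays at infinity are not parallel. -/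
def chartDomain (k : ℕ) : Set (Model k) :=
  {u | (∀ n, 0 < u.sigma n) ∧ wedge (u.path (k - 3)) (u.path 0) ≠ 0}

/-- The normalised polygon with given coordinates. -/
def Model.cycle {k : ℕ} (u : Model k) (i : ZMod k) : R23 := polygonVec k u.path i.val

lemma Model.sigma_zero {k : ℕ} (u : Model k) : u.sigma 0 = 1 := by simp [Model.sigma]

lemma Model.sigma_one {k : ℕ} (u : Model k) : u.sigma 1 = 1 := by simp [Model.sigma]

lemma Model.sigma_last {k : ℕ} (u : Model k) {n : ℕ} (hn : k < n + 5) : u.sigma n = 1 := by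
  rw [Model.sigma, if_neg (by omega)]

lemma Model.path_zero {k : ℕ} (u : Model k) : u.path 0 = (u.coord 0, -1) := by
  rw [Model.path, steps]

lemma Model.path_one {k : ℕ} (u : Model k) : u.path 1 = (1, 0) := by rw [Model.path, steps]

lemma Model.path_two {k : ℕ} (u : Model k) : u.path 2 = (0, 1) := by
  rw [Model.path, steps_add_two, steps, steps, u.sigma_zero, u.sigma_one]
  simp

namespace chartDomain

variable {k : ℕ} {u : Model k}

lemma wedge_succ (hu : u ∈ chartDomain k) (n : ℕ) :
    wedge (u.path n) (u.path (n + 1)) = u.sigma n :=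
  wedge_steps_succ u.sigma_zero (fun n => (hu.1 n).ne') n

lemma wedge_add_two (hu : u ∈ chartDomain k) (n : ℕ) :
    wedge (u.path n) (u.path (n + 2)) = u.coord n :=
  wedge_steps_add_two u.sigma_zero (fun n => (hu.1 n).ne') n

lemma isNegativeCycle (hk : 6 ≤ k) (hu : u ∈ chartDomain k) :
    MarkedPolygon.IsNegativeCycle u.cycle :=
  isNegativeCycle_polygonVec hk (fun j _ => by rw [wedge_succ hu]; exact (hu.1 j).ne') hu.2

end chartDomain

/-! ### Invariants of a polygon -/

/-- The scaling factor of the vertex at infinity in the normal form. -/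
def scaleZero (V : ℕ → R23) : ℝ :=
  √(-form (V 2) (V 4) / (2 * form (V 0) (V 2) * form (V 0) (V 4)))

/-- The scaling factor of the vertices in Minkowski space in the normal form: it makes the
product with the vertex at infinity equal to `-1`. -/
def scaleAff (V : ℕ → R23) (n : ℕ) : ℝ := -1 / (scaleZero V * form (V 0) (V n))

/-- The scaling factors of the normal form, that of the polygon of a light-like path with
`wedge (p j) (p (j + 1)) = 1` for `j = 0, 1, k - 4`. -/
def scale (k : ℕ) (V : ℕ → R23) (n : ℕ) : ℝ :=
  if n = 0 then scaleZero V
  else if n = 1 then -2 / (scaleAff V 3 * form (V 1) (V 3))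
  else if n = k - 1 then -2 / (scaleAff V (k - 3) * form (V (k - 3)) (V (k - 1)))
  else scaleAff V n

/-- The normalised family on the same half-lines: positive rescalings of `V` do not change it. -/
def rescale (k : ℕ) (V : ℕ → R23) (n : ℕ) : R23 := scale k V n • V n

/-- The invariant of a normalised family that corresponds to `wedge (p j) (p (j + 1))`. -/
def sigmaInv (W : ℕ → R23) (j : ℕ) : ℝ := √(-form (W (j + 1)) (W (j + 3)) / 2)

/-- The invariant of a normalised family that corresponds to `wedge (p j) (p (j + 2))`. Unlike
`sigmaInv` it is odd in `W`, since it is computed from a volume. -/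
def tauInv (W : ℕ → R23) (j : ℕ) : ℝ :=
  dVol (W 0) (W (j + 1)) (W (j + 2)) (W (j + 3)) (W (j + 4))
    / (4 * sigmaInv W j * sigmaInv W (j + 1))

/-- The coordinates of a normalised family. -/
def normalizedCoord (k : ℕ) (W : ℕ → R23) : Model k :=
  WithLp.toLp 2 fun i => if (i : ℕ) < k - 4 then tauInv W i else sigmaInv W (i - (k - 6))

/-- The coordinates of a family of vectors: they are invariant under `SO₀(2,3)` and under positive
rescalings. -/
def coordMap (k : ℕ) (v : ZMod k → R23) : Model k :=
  normalizedCoord k (rescale k fun n => v n)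

section homogeneity

variable {k : ℕ}

lemma scaleZero_smul {V : ℕ → R23} {c : ℕ → ℝ} (hc : ∀ n, 0 < c n) :
    scaleZero (fun n => c n • V n) = scaleZero V / c 0 := by
  have h0 := hc 0
  have h2 := hc 2
  have h4 := hc 4
  have : -form (c 2 • V 2) (c 4 • V 4) / (2 * form (c 0 • V 0) (c 2 • V 2)
      * form (c 0 • V 0) (c 4 • V 4))
      = -form (V 2) (V 4) / (2 * form (V 0) (V 2) * form (V 0) (V 4)) / c 0 ^ 2 := by
    simp only [form_smul_left, form_smul_right]
    rw [div_div, show -(c 4 * (c 2 * form (V 2) (V 4))) = (c 2 * c 4) * -form (V 2) (V 4) by ring,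
      show 2 * (c 2 * (c 0 * form (V 0) (V 2))) * (c 4 * (c 0 * form (V 0) (V 4)))
        = (c 2 * c 4) * (2 * form (V 0) (V 2) * form (V 0) (V 4) * c 0 ^ 2) by ring,
      mul_div_mul_left _ _ (by positivity)]
  rw [scaleZero, scaleZero, this, Real.sqrt_div' _ (by positivity), Real.sqrt_sq h0.le]

lemma scaleAff_smul {V : ℕ → R23} {c : ℕ → ℝ} (hc : ∀ n, 0 < c n) (n : ℕ) :
    scaleAff (fun n => c n • V n) n = scaleAff V n / c n := by
  have h0 := (hc 0).ne'
  rw [scaleAff, scaleAff, scaleZero_smul hc, form_smul_left, form_smul_right, div_div]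
  congr 1
  field_simp

lemma scale_smul {V : ℕ → R23} {c : ℕ → ℝ} (hc : ∀ n, 0 < c n) (n : ℕ) :
    scale k (fun n => c n • V n) n = scale k V n / c n := by
  have h3 := (hc 3).ne'
  have hk3 := (hc (k - 3)).ne'
  simp only [scale, scaleZero_smul hc, scaleAff_smul hc, form_smul_left, form_smul_right]
  split_ifs with e0 e1 ek
  · rw [e0]
  · rw [e1, div_div]
    congr 1
    field_simp
  · rw [ek, div_div]
    congr 1
    field_simp
  · rfl

lemma rescale_smul {V : ℕ → R23} {c : ℕ → ℝ} (hc : ∀ n, 0 < c n) :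
    rescale k (fun n => c n • V n) = rescale k V := by
  funext n
  rw [rescale, rescale, scale_smul hc, smul_smul, div_mul_cancel₀ _ (hc n).ne']

lemma scale_map (V : ℕ → R23) (A : SO0) : scale k (fun n => A.1 (V n)) = scale k V := by
  funext n
  simp only [scale, scaleZero, scaleAff, A.2.1]

lemma rescale_map (V : ℕ → R23) (A : SO0) :
    rescale k (fun n => A.1 (V n)) = fun n => A.1 (rescale k V n) := by
  funext n
  rw [rescale, scale_map, rescale, map_smul]

lemma normalizedCoord_map (W : ℕ → R23) (A : SO0) :
    normalizedCoord k (fun n => A.1 (W n)) = normalizedCoord k W := by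
  simp only [normalizedCoord, tauInv, sigmaInv, A.2.1, dVol_map, A.2.2.1, one_mul]

lemma coordMap_smul_map (v : ZMod k → R23) {c : ZMod k → ℝ} (hc : ∀ i, 0 < c i) (A : SO0) :
    coordMap k (fun i => c i • A.1 (v i)) = coordMap k v := by
  rw [coordMap, rescale_smul (V := fun n : ℕ => A.1 (v n)) (c := fun n : ℕ => c n)
    (fun n => hc n), rescale_map (fun n : ℕ => v n), normalizedCoord_map, coordMap]

end homogeneity

section normalForm

variable {k : ℕ} {p : ℕ → ℝ × ℝ}

lemma form_polygonVec_add_two (hk : 6 ≤ k) {j : ℕ} (hj : j + 4 ≤ k) :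
    form (polygonVec k p (j + 1)) (polygonVec k p (j + 3)) = -(2 * wedge (p j) (p (j + 1)) ^ 2) := by
  rcases j with _ | j
  · rw [polygonVec_one, polygonVec_add_two (n := 1) (by omega), ← form_nullVec, lightPath_succ,
      lightPath_zero]
    simp [form, affVec]; ring
  · rw [show j + 1 + 1 = j + 2 by rfl, polygonVec_add_two (by omega)]
    by_cases h : j + 5 = k
    · rw [show j + 1 + 3 = k - 1 by omega, polygonVec_last hk, show k - 4 = j + 1 by omega,
        show k - 3 = j + 2 by omega, form_affVec_horizonVec (by simp) (by simp), lightPath_succ,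
        add_sub_cancel_left, form_nullVec]
    · rw [show j + 1 + 3 = (j + 2) + 2 by omega, polygonVec_add_two (by omega),
        form_affVec (by simp) (by simp) (by simp) (by simp), lightPath_succ, lightPath_succ,
        show lightPath p j + nullVec (p (j + 1)) + nullVec (p (j + 1 + 1)) - lightPath p j
          = nullVec (p (j + 1)) + nullVec (p (j + 1 + 1)) by abel]
      simp only [form_add_left, form_add_right, form_nullVec, wedge_self,
        wedge_comm (p (j + 1)) (p (j + 1 + 1))]
      ring

lemma dVol_polygonVec (hk : 6 ≤ k) {j : ℕ} (hj : j + 5 ≤ k) :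
    dVol (polygonVec k p 0) (polygonVec k p (j + 1)) (polygonVec k p (j + 2))
      (polygonVec k p (j + 3)) (polygonVec k p (j + 4))
      = 4 * wedge (p j) (p (j + 1)) * wedge (p (j + 1)) (p (j + 2)) * wedge (p j) (p (j + 2)) := by
  rw [polygonVec_zero, dVol_eq]
  rcases j with _ | j
  · rw [polygonVec_one, polygonVec_add_two (n := 0) (by omega),
      polygonVec_add_two (n := 1) (by omega), polygonVec_add_two (n := 2) (by omega),
      lightPath_succ p 1, lightPath_succ p 0, lightPath_zero]
    simp [affVec, wedge]
    ring
  · rw [show j + 1 + 1 = j + 2 by rfl, polygonVec_add_two (by omega),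
      show j + 1 + 2 = (j + 1) + 2 by rfl, polygonVec_add_two (n := j + 1) (by omega),
      show j + 1 + 3 = (j + 2) + 2 by rfl, polygonVec_add_two (n := j + 2) (by omega)]
    by_cases h : j + 6 = k
    · rw [show j + 1 + 4 = k - 1 by omega, polygonVec_last hk, show k - 4 = j + 2 by omega,
        show k - 3 = j + 3 by omega, lightPath_succ p (j + 1), lightPath_succ p j]
      simp [affVec, horizonVec, wedge]
      ring
    · rw [show j + 1 + 4 = (j + 3) + 2 by omega, polygonVec_add_two (by omega),
        lightPath_succ p (j + 2), lightPath_succ p (j + 1), lightPath_succ p j]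
      simp [affVec, wedge]
      ring

lemma form_polygonVec_zero {n : ℕ} (hn : n + 4 ≤ k) :
    form (polygonVec k p 0) (polygonVec k p (n + 2)) = -1 := by
  rw [polygonVec_zero, polygonVec_add_two hn]; simp [form, affVec]

/-- The polygon of a light-like path is in normal form. -/
lemma scale_polygonVec (hk : 6 ≤ k) (h0 : wedge (p 0) (p 1) = 1) (h1 : wedge (p 1) (p 2) = 1)
    (hlast : wedge (p (k - 4)) (p (k - 3)) = 1) {V : ℕ → R23}
    (hV : ∀ n < k, V n = polygonVec k p n) {n : ℕ} (hn : n < k) : scale k V n = 1 := by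
  have hz : scaleZero V = 1 := by
    rw [scaleZero, hV 0 (by omega), hV 2 (by omega), hV 4 (by omega),
      form_polygonVec_zero (n := 0) (by omega), form_polygonVec_zero (n := 2) (by omega),
      form_polygonVec_add_two hk (j := 1) (by omega), h1]
    norm_num
  have ha : ∀ n, n + 4 ≤ k → scaleAff V (n + 2) = 1 := by
    intro n hn
    rw [scaleAff, hz, hV 0 (by omega), hV (n + 2) (by omega), form_polygonVec_zero hn]
    norm_num
  rw [scale]
  split_ifs with e0 e1 ek
  · exact hz
  · rw [ha 1 (by omega), hV 1 (by omega), hV 3 (by omega),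
      form_polygonVec_add_two hk (j := 0) (by omega), h0]
    norm_num
  · have e : k - 3 = (k - 5) + 2 := by omega
    rw [e, ha (k - 5) (by omega), hV _ (by omega), hV _ (by omega),
      show k - 5 + 2 = k - 4 + 1 by omega, show k - 1 = k - 4 + 3 by omega,
      form_polygonVec_add_two hk (by omega), show k - 4 + 1 = k - 3 by omega, hlast]
    norm_num
  · have := ha (n - 2) (by omega)
    rwa [show n - 2 + 2 = n by omega] at this

lemma coordMap_cycle (hk : 6 ≤ k) {u : Model k} (hu : u ∈ chartDomain k) :
    coordMap k u.cycle = u := by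
  have : NeZero k := ⟨by omega⟩
  have hV : ∀ n < k, u.cycle (n : ZMod k) = polygonVec k u.path n := fun n hn => by
    rw [Model.cycle, ZMod.val_cast_of_lt hn]
  have hW : ∀ n < k, rescale k (fun n => u.cycle n) n = polygonVec k u.path n := fun n hn => by
    rw [rescale, scale_polygonVec hk (p := u.path) _ _ _ hV hn, one_smul, hV n hn]
    · rw [chartDomain.wedge_succ hu, u.sigma_zero]
    · rw [chartDomain.wedge_succ hu, u.sigma_one]
    · rw [show k - 3 = k - 4 + 1 by omega, chartDomain.wedge_succ hu, u.sigma_last (by omega)]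
  have hs : ∀ j, j + 4 ≤ k → sigmaInv (rescale k fun n => u.cycle n) j = u.sigma j := by
    intro j hj
    rw [sigmaInv, hW (j + 1) (by omega), hW (j + 3) (by omega), form_polygonVec_add_two hk hj,
      chartDomain.wedge_succ hu, neg_neg, mul_div_cancel_left₀ _ two_ne_zero,
      Real.sqrt_sq (hu.1 j).le]
  ext i
  have hi := i.2
  rw [coordMap, normalizedCoord]
  change (if (i : ℕ) < k - 4 then _ else _) = _
  split_ifs with h
  · rw [tauInv, hs i (by omega), hs (i + 1) (by omega), hW 0 (by omega), hW (i + 1) (by omega),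
      hW (i + 2) (by omega), hW (i + 3) (by omega), hW (i + 4) (by omega), dVol_polygonVec hk (by omega),
      chartDomain.wedge_succ hu, show (i : ℕ) + 2 = (i : ℕ) + 1 + 1 by rfl,
      chartDomain.wedge_succ hu, chartDomain.wedge_add_two hu, Model.coord, dif_pos hi]
    have h1 := (hu.1 i).ne'
    have h2 := (hu.1 (i + 1)).ne'
    field_simp
  · rw [hs (i - (k - 6)) (by omega), Model.sigma, if_pos (by omega), Model.coord, dif_pos (by omega)]
    exact congrArg (fun j => u j) (Fin.ext (by simp only; omega))

end normalForm
end

noncomputable section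
open R23 Ein

/-! ### Every negative cycle has a normal form -/

namespace MarkedPolygon.IsNegativeCycle

variable {k : ℕ} {v : ZMod k → R23}

lemma form_natCast_succ (h : IsNegativeCycle v) (n : ℕ) :
    form (v n) (v ((n + 1 : ℕ) : ZMod k)) = 0 := by
  rw [Nat.cast_succ]; exact h.next n

lemma form_natCast_neg (h : IsNegativeCycle v) {a b : ℕ} (hab : a + 2 ≤ b) (hb : b < k)
    (hn : ¬(a = 0 ∧ b = k - 1)) : form (v a) (v b) < 0 := by
  have key : ∀ {c d : ℕ}, c < k → d < k → c ≠ d → (c : ZMod k) ≠ d := by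
    intro c d hc hd hcd e
    rw [ZMod.natCast_eq_natCast_iff', Nat.mod_eq_of_lt hc, Nat.mod_eq_of_lt hd] at e
    exact hcd e
  refine h.neg _ _ (key hb (by omega) (by omega)) ?_ ?_
  · rw [← Nat.cast_succ]
    exact key hb (by omega) (by omega)
  · rw [← Nat.cast_add_one]
    by_cases e : b + 1 = k
    · rw [e, ZMod.natCast_self, ← Nat.cast_zero]
      exact key (by omega) (by omega) (by omega)
    · exact key (by omega) (by omega) (by omega)

end MarkedPolygon.IsNegativeCycle

open MarkedPolygon

section scaling

variable {k : ℕ} {v : ZMod k → R23}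

lemma radicand_pos (hk : 6 ≤ k) (h : IsNegativeCycle v) :
    0 < -form (v (2 : ℕ)) (v (4 : ℕ))
      / (2 * form (v (0 : ℕ)) (v (2 : ℕ)) * form (v (0 : ℕ)) (v (4 : ℕ))) := by
  have h24 := h.form_natCast_neg (a := 2) (b := 4) (by omega) (by omega) (by omega)
  have h02 := h.form_natCast_neg (a := 0) (b := 2) (by omega) (by omega) (by omega)
  have h04 := h.form_natCast_neg (a := 0) (b := 4) (by omega) (by omega) (by omega)
  have := mul_pos_of_neg_of_neg h02 h04
  refine div_pos (by linarith) (by linarith)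

lemma scaleZero_pos (hk : 6 ≤ k) (h : IsNegativeCycle v) : 0 < scaleZero fun n => v n :=
  Real.sqrt_pos.mpr (radicand_pos hk h)

lemma scaleAff_pos (hk : 6 ≤ k) (h : IsNegativeCycle v) {n : ℕ} (hn : n + 4 ≤ k) :
    0 < scaleAff (fun n => v n) (n + 2) :=
  div_pos_of_neg_of_neg (by norm_num) (mul_neg_of_pos_of_neg (scaleZero_pos hk h)
    (h.form_natCast_neg (by omega) (by omega) (by omega)))

lemma scale_zero (V : ℕ → R23) : scale k V 0 = scaleZero V := if_pos rfl

lemma scale_one (V : ℕ → R23) :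
    scale k V 1 = -2 / (scaleAff V 3 * form (V 1) (V 3)) := by
  rw [scale, if_neg one_ne_zero, if_pos rfl]

lemma scale_last (hk : 6 ≤ k) (V : ℕ → R23) :
    scale k V (k - 1) = -2 / (scaleAff V (k - 3) * form (V (k - 3)) (V (k - 1))) := by
  rw [scale, if_neg (by omega), if_neg (by omega), if_pos rfl]

lemma scale_add_two (V : ℕ → R23) {n : ℕ} (hn : n + 4 ≤ k) :
    scale k V (n + 2) = scaleAff V (n + 2) := by
  rw [scale, if_neg (by omega), if_neg (by omega), if_neg (by omega)]

lemma scale_pos (hk : 6 ≤ k) (h : IsNegativeCycle v) {n : ℕ} (hn : n < k) :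
    0 < scale k (fun n => v n) n := by
  rcases n with _ | _ | n
  · rw [scale_zero]; exact scaleZero_pos hk h
  · rw [zero_add, scale_one]
    exact div_pos_of_neg_of_neg (by norm_num) (mul_neg_of_pos_of_neg
      (scaleAff_pos hk h (n := 1) (by omega))
      (h.form_natCast_neg (by omega) (by omega) (by omega)))
  · by_cases e : n + 1 + 1 = k - 1
    · rw [e, scale_last hk]
      refine div_pos_of_neg_of_neg (by norm_num) (mul_neg_of_pos_of_neg ?_
        (h.form_natCast_neg (by omega) (by omega) (by omega)))
      rw [show k - 3 = (k - 5) + 2 by omega]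
      exact scaleAff_pos hk h (by omega)
    · rw [scale_add_two _ (by omega)]
      exact scaleAff_pos hk h (by omega)

lemma form_rescale_zero (hk : 6 ≤ k) (h : IsNegativeCycle v) {n : ℕ} (hn : n + 4 ≤ k) :
    form (rescale k (fun n => v n) 0) (rescale k (fun n => v n) (n + 2)) = -1 := by
  have h1 := (scaleZero_pos hk h).ne'
  have h2 := (h.form_natCast_neg (a := 0) (b := n + 2) (by omega) (by omega) (by omega)).ne
  rw [rescale, rescale, form_smul_left, form_smul_right, scale_zero, scale_add_two _ hn, scaleAff]
  field_simp

lemma form_rescale_one (hk : 6 ≤ k) (h : IsNegativeCycle v) :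
    form (rescale k (fun n => v n) 1) (rescale k (fun n => v n) 3) = -2 := by
  have h1 := (scaleAff_pos hk h (n := 1) (by omega)).ne'
  have h2 := (h.form_natCast_neg (a := 1) (b := 3) (by omega) (by omega) (by omega)).ne
  rw [rescale, rescale, form_smul_left, form_smul_right, scale_one,
    scale_add_two (n := 1) _ (by omega)]
  field_simp

lemma form_rescale_last (hk : 6 ≤ k) (h : IsNegativeCycle v) :
    form (rescale k (fun n => v n) (k - 3)) (rescale k (fun n => v n) (k - 1)) = -2 := by
  have h1 := (scaleAff_pos hk h (n := k - 5) (by omega)).ne'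
  have h2 := (h.form_natCast_neg (a := k - 3) (b := k - 1) (by omega) (by omega) (by omega)).ne
  have h3 := scale_add_two (k := k) (n := k - 5) (fun n => v n) (by omega)
  rw [show k - 5 + 2 = k - 3 by omega] at h1 h3
  rw [rescale, rescale, form_smul_left, form_smul_right, scale_last hk, h3]
  field_simp

lemma form_rescale_two (hk : 6 ≤ k) (h : IsNegativeCycle v) :
    form (rescale k (fun n => v n) 2) (rescale k (fun n => v n) 4) = -2 := by
  have h24 := (h.form_natCast_neg (a := 2) (b := 4) (by omega) (by omega) (by omega)).ne
  have h02 := (h.form_natCast_neg (a := 0) (b := 2) (by omega) (by omega) (by omega)).ne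
  have h04 := (h.form_natCast_neg (a := 0) (b := 4) (by omega) (by omega) (by omega)).ne
  have hs := Real.sq_sqrt (radicand_pos hk h).le
  change (scaleZero fun n => v n) ^ 2 = _ at hs
  have h1 := (scaleZero_pos hk h).ne'
  rw [rescale, rescale, form_smul_left, form_smul_right, scale_add_two (n := 0) _ (by omega),
    scale_add_two (n := 2) _ (by omega), scaleAff, scaleAff]
  rw [eq_div_iff (mul_ne_zero (mul_ne_zero two_ne_zero h02) h04)] at hs
  simp only [zero_add, show 2 + 2 = 4 from rfl]
  field_simp
  linear_combination hs

end scaling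

section standardPosition

/-- The vector of the plane that parametrizes the null vector `y` and has positive area with
`q`. -/
def nextStep (q : ℝ × ℝ) (y : R23) : ℝ × ℝ :=
  ((q.1 * y 4 / 2 - q.2 * y 1) / √(form (nullVec q) y / 2),
    (q.1 * y 3 / 2 - q.2 * y 4 / 2) / √(form (nullVec q) y / 2))

lemma nullVec_nextStep {q : ℝ × ℝ} {y : R23} (h0 : y 0 = 0) (h2 : y 2 = 0) (hy : form y y = 0)
    (hq : 0 < form (nullVec q) y) : nullVec (nextStep q y) = y := by
  have hs : √(form (nullVec q) y / 2) ^ 2 = form (nullVec q) y / 2 := Real.sq_sqrt (by positivity)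
  have hf : form (nullVec q) y = q.1 ^ 2 * y 3 + 2 * q.2 ^ 2 * y 1 - 2 * q.1 * q.2 * y 4 := by
    simp [form, h0, h2]
  have hy' : y 4 ^ 2 = 2 * y 1 * y 3 := by
    simp only [form, h0, h2] at hy; linarith
  have h1 : nullVec (nextStep q y) 1 = y 1 := by
    rw [nullVec_one, nextStep]
    simp only
    rw [div_pow, hs, div_eq_iff (by positivity), hf]
    linear_combination (q.1 ^ 2 / 4) * hy'
  have h3 : nullVec (nextStep q y) 3 = y 3 := by
    rw [nullVec_three, nextStep]
    simp only
    rw [div_pow, hs, ← mul_div_assoc, div_eq_iff (by positivity), hf]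
    linear_combination (q.2 ^ 2 / 2) * hy'
  have h4 : nullVec (nextStep q y) 4 = y 4 := by
    rw [nullVec_four, nextStep]
    simp only
    rw [mul_assoc, div_mul_div_comm, ← sq, hs, ← mul_div_assoc, div_eq_iff (by positivity), hf]
    linear_combination (q.1 * q.2 / 2) * hy'
  ext i
  fin_cases i
  · exact h0.symm
  · exact h1
  · exact h2.symm
  · exact h3
  · exact h4

lemma wedge_nextStep {q : ℝ × ℝ} {y : R23} (h0 : y 0 = 0) (h2 : y 2 = 0)
    (hq : 0 < form (nullVec q) y) : wedge q (nextStep q y) = √(form (nullVec q) y / 2) := by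
  have hs : √(form (nullVec q) y / 2) ^ 2 = form (nullVec q) y / 2 := Real.sq_sqrt (by positivity)
  have hpos : 0 < √(form (nullVec q) y / 2) := Real.sqrt_pos.mpr (by positivity)
  have hf : form (nullVec q) y = q.1 ^ 2 * y 3 + 2 * q.2 ^ 2 * y 1 - 2 * q.1 * q.2 * y 4 := by
    simp [form, h0, h2]
  have : wedge q (nextStep q y) = (form (nullVec q) y / 2) / √(form (nullVec q) y / 2) := by
    rw [wedge, nextStep]
    simp only
    rw [mul_div_assoc', mul_div_assoc', ← sub_div]
    congr 1
    rw [hf]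
    ring
  rw [this, div_eq_iff hpos.ne', ← sq, hs]

/-- A sequence of null vectors with positive products, that starts with a standard one, is
parametrized by a sequence in the plane. -/
lemma exists_nullVec_eq {Y : ℕ → R23} {N : ℕ} (h0 : ∀ j ≤ N, Y j 0 = 0) (h2 : ∀ j ≤ N, Y j 2 = 0)
    (hY : ∀ j ≤ N, form (Y j) (Y j) = 0) (hpos : ∀ j < N, 0 < form (Y j) (Y (j + 1)))
    (h3 : Y 0 3 = 2) :
    ∃ p : ℕ → ℝ × ℝ, p 0 = (-(Y 0 4 / 2), -1) ∧ (∀ j ≤ N, nullVec (p j) = Y j) ∧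
      (∀ j, p (j + 1) = nextStep (p j) (Y (j + 1))) ∧
      ∀ j < N, wedge (p j) (p (j + 1)) = √(form (Y j) (Y (j + 1)) / 2) := by
  let p : ℕ → ℝ × ℝ := fun n => Nat.rec (-(Y 0 4 / 2), -1) (fun j q => nextStep q (Y (j + 1))) n
  have hs : ∀ j, p (j + 1) = nextStep (p j) (Y (j + 1)) := fun j => rfl
  have hn : ∀ j ≤ N, nullVec (p j) = Y j := by
    intro j
    induction j with
    | zero =>
      intro hj
      have h := hY 0 hj
      simp only [form, h0 0 hj, h2 0 hj, h3] at h
      ext i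
      fin_cases i
      · exact (h0 0 hj).symm
      · change (-(Y 0 4 / 2)) ^ 2 = Y 0 1
        nlinarith
      · exact (h2 0 hj).symm
      · change 2 * (-1 : ℝ) ^ 2 = Y 0 3
        rw [h3]; norm_num
      · change 2 * (-(Y 0 4 / 2)) * (-1 : ℝ) = Y 0 4
        ring
    | succ j ih =>
      intro hj
      rw [hs]
      refine nullVec_nextStep (h0 _ hj) (h2 _ hj) (hY _ hj) ?_
      rw [ih (by omega)]
      exact hpos j (by omega)
  refine ⟨p, rfl, hn, hs, fun j hj => ?_⟩
  have h := hpos j hj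
  rw [← hn j hj.le] at h ⊢
  rw [hs, wedge_nextStep (h0 _ hj) (h2 _ hj) h]

variable {k : ℕ} {z : ZMod k → R23}

/-- A normalised negative cycle whose vertices `0, 2, 3, 4` are in standard position is the polygon
of a light-like path. -/
lemma exists_eq_cycle (hk : 6 ≤ k) (h : IsNegativeCycle z)
    (hz : ∀ n, n + 4 ≤ k → form (z (0 : ℕ)) (z (n + 2 : ℕ)) = -1)
    (hz1 : form (z (1 : ℕ)) (z (3 : ℕ)) = -2)
    (hzk : form (z (k - 3 : ℕ)) (z (k - 1 : ℕ)) = -2)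
    (e0 : z (0 : ℕ) = -Pi.single 2 1) (e2 : z (2 : ℕ) = Pi.single 0 1)
    (e3 : z (3 : ℕ) = Pi.single 0 1 + Pi.single 1 1)
    (e4 : z (4 : ℕ) = Pi.single 0 1 + Pi.single 1 1 + (2 : ℝ) • Pi.single 3 1
      - (2 : ℝ) • Pi.single 2 1) :
    ∃ u ∈ chartDomain k, z = u.cycle := by
  have : NeZero k := ⟨by omega⟩
  -- the points of Minkowski space
  let X : ℕ → R23 := fun j => ![0, z (j + 2 : ℕ) 1, 0, z (j + 2 : ℕ) 3, z (j + 2 : ℕ) 4]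
  have hX0 : ∀ j, X j 0 = 0 := fun j => rfl
  have hX2 : ∀ j, X j 2 = 0 := fun j => rfl
  have hzX : ∀ j, j + 4 ≤ k → z (j + 2 : ℕ) = affVec (X j) := by
    intro j hj
    have h1 : z (j + 2 : ℕ) 0 = 1 := by
      have := hz j hj
      rw [e0] at this
      simp [form] at this
      simpa using this
    have h2 := h.self (j + 2 : ℕ)
    simp only [form, h1] at h2
    ext i
    fin_cases i
    · exact h1
    · rfl
    · simp only [affVec, form, X]; simp; push_cast at h2 ⊢; linarith
    · rfl
    · rfl
  have hformX : ∀ i j, i + 4 ≤ k → j + 4 ≤ k →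
      form (X j - X i) (X j - X i) = -2 * form (z (i + 2 : ℕ)) (z (j + 2 : ℕ)) := by
    intro i j hi hj
    rw [hzX i hi, hzX j hj, form_affVec (hX0 i) (hX2 i) (hX0 j) (hX2 j)]
    ring
  -- the direction of the last light ray
  let L : R23 := ![0, z (k - 1 : ℕ) 1, 0, z (k - 1 : ℕ) 3, z (k - 1 : ℕ) 4]
  have hk10 : z (k - 1 : ℕ) 0 = 0 := by
    have := h.next (k - 1 : ℕ)
    rw [← Nat.cast_succ, show (k - 1).succ = k by omega, ZMod.natCast_self,
      ← Nat.cast_zero (R := ZMod k), e0] at this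
    simpa [form] using this
  have hLL : form L L = 0 := by
    have := h.self (k - 1 : ℕ)
    simp only [form, hk10] at this
    simp [form, L]
    linarith
  have hzL : z (k - 1 : ℕ) = horizonVec (X (k - 4)) L := by
    have := h.form_natCast_succ (k - 2)
    rw [show k - 2 + 1 = k - 1 by omega, show k - 2 = k - 4 + 2 by omega, hzX _ (by omega)] at this
    simp only [affVec, form, hk10] at this
    simp at this
    ext i
    fin_cases i
    · exact hk10
    · rfl
    · simp [horizonVec, form, L, hX0, hX2]; linarith
    · rfl
    · rfl
  -- the direction of the first light ray
  have h11 : z (1 : ℕ) 0 = 0 := by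
    have := h.form_natCast_succ 0
    rw [e0] at this
    simpa [form] using this
  have h12 : z (1 : ℕ) 2 = 0 := by
    have := h.form_natCast_succ 1
    rw [show 1 + 1 = 2 from rfl, e2] at this
    simpa [form] using this
  have h13 : z (1 : ℕ) 3 = -2 := by
    rw [e3] at hz1
    simpa [form, h12, -Nat.cast_one] using hz1
  -- the steps
  let Y : ℕ → R23 := fun j => if j = 0 then -z (1 : ℕ) else if j + 3 = k then L
    else X j - X (j - 1)
  have hY0 : Y 0 = -z (1 : ℕ) := if_pos rfl
  have hYL : Y (k - 3) = L := by
    simp only [Y]; rw [if_neg (by omega), if_pos (by omega)]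
  have hYX : ∀ j, j + 5 ≤ k → Y (j + 1) = X (j + 1) - X j := by
    intro j hj
    simp only [Y]; rw [if_neg (by omega), if_neg (by omega), Nat.add_sub_cancel]
  have hcases : ∀ j ≤ k - 3, j = 0 ∨ j = k - 3 ∨ ∃ i, j = i + 1 ∧ i + 5 ≤ k := by
    intro j hj
    rcases j with _ | j
    · simp
    · by_cases e : j + 1 = k - 3
      · simp [e]
      · exact .inr (.inr ⟨j, rfl, by omega⟩)
  have hX_zero : X 0 = 0 := by
    ext i; fin_cases i <;> simp only [X, zero_add, e2] <;> simp
  have hX_one : X 1 = Pi.single 1 1 := by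
    ext i; fin_cases i <;> simp only [X, Nat.reduceAdd, e3] <;> simp
  have hX_two : X 2 = Pi.single 1 1 + (2 : ℝ) • Pi.single 3 1 := by
    ext i; fin_cases i <;> simp only [X, Nat.reduceAdd, e4] <;> simp
  have hYnull : ∀ j ≤ k - 3, Y j 0 = 0 ∧ Y j 2 = 0 ∧ form (Y j) (Y j) = 0 := by
    intro j hj
    rcases hcases j hj with rfl | rfl | ⟨i, rfl, hi⟩
    · rw [hY0, form_neg_left, form_neg_right, h.self]
      simp only [Pi.neg_apply, h11, h12]
      simp
    · rw [hYL]; exact ⟨rfl, rfl, hLL⟩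
    · rw [hYX i hi]
      refine ⟨by simp [hX0], by simp [hX2], ?_⟩
      have := h.form_natCast_succ (i + 2)
      rw [hformX i (i + 1) (by omega) (by omega), show i + 1 + 2 = i + 2 + 1 by rfl, this, mul_zero]
  have hY01 : form (Y 0) (Y 1) = 2 := by
    rw [hY0, hYX 0 (by omega), zero_add, hX_zero, hX_one]
    simp [form, h13, -Nat.cast_one]
  have hYlast : form (Y (k - 4)) (Y (k - 3)) = 2 := by
    have e : k - 4 = k - 5 + 1 := by omega
    have h1 := hzk
    have h2 : form (Y (k - 4)) (Y (k - 3)) = form (X (k - 4) - X (k - 5)) L := by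
      rw [hYL, e, hYX _ (by omega)]
    rw [h2]
    rw [hzL, show k - 3 = k - 5 + 2 by omega, hzX _ (by omega),
      form_affVec_horizonVec (hX0 _) (hX2 _)] at h1
    linarith
  have hYpos : ∀ j < k - 3, 0 < form (Y j) (Y (j + 1)) := by
    intro j hj
    rcases hcases j (by omega) with rfl | rfl | ⟨i, rfl, hi⟩
    · rw [hY01]; norm_num
    · omega
    · by_cases e : i + 5 = k
      · rw [show i + 1 = k - 4 by omega, show k - 4 + 1 = k - 3 by omega, hYlast]; norm_num
      · have h1 := hformX i (i + 2) (by omega) (by omega)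
        have h2 := h.form_natCast_neg (a := i + 2) (b := i + 2 + 2) (by omega) (by omega) (by omega)
        have h3 : X (i + 2) - X i = Y (i + 1) + Y (i + 1 + 1) := by
          rw [hYX i hi, hYX (i + 1) (by omega)]; abel
        rw [h3, form_add_left, form_add_right, form_add_right, (hYnull (i + 1) (by omega)).2.2,
          (hYnull (i + 1 + 1) (by omega)).2.2, form_comm (Y (i + 1 + 1))] at h1
        linarith
  obtain ⟨p, hp0, hp, hps, hpw⟩ := exists_nullVec_eq (N := k - 3) (fun j hj => (hYnull j hj).1)
    (fun j hj => (hYnull j hj).2.1) (fun j hj => (hYnull j hj).2.2) hYpos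
    (by rw [hY0]; simp [h13, -Nat.cast_one])
  have hw0 : wedge (p 0) (p 1) = 1 := by
    rw [hpw 0 (by omega), hY01]; norm_num
  have hp1 : p 1 = (1, 0) := by
    have hY1 : Y 1 = Pi.single 1 1 := by rw [hYX 0 (by omega), zero_add, hX_one, hX_zero, sub_zero]
    rw [hps 0, nextStep, hp 0 (by omega), zero_add, hY01, hY1, hp0]
    simp
  have hp2 : p 2 = (0, 1) := by
    have hY1 : Y 1 = Pi.single 1 1 := by rw [hYX 0 (by omega), zero_add, hX_one, hX_zero, sub_zero]
    have hY2 : Y 2 = (2 : ℝ) • Pi.single 3 1 := by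
      rw [hYX 1 (by omega), hX_one, hX_two]; abel
    rw [hps 1, nextStep, hp 1 (by omega), show 1 + 1 = 2 from rfl, hY1, hY2, hp1]
    simp [form]
  have hw1 : wedge (p 1) (p 2) = 1 := by rw [hp1, hp2]; simp [wedge]
  have hwl : wedge (p (k - 4)) (p (k - 3)) = 1 := by
    rw [show k - 3 = k - 4 + 1 by omega, hpw _ (by omega), show k - 4 + 1 = k - 3 by omega, hYlast]
    norm_num
  have hwpos : ∀ j, j + 4 ≤ k → 0 < wedge (p j) (p (j + 1)) := by
    intro j hj
    rw [hpw j (by omega)]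
    exact Real.sqrt_pos.mpr (half_pos (hYpos j (by omega)))
  -- the coordinates
  let u : Model k := WithLp.toLp 2 fun i => if (i : ℕ) < k - 4 then wedge (p i) (p (i + 2))
    else wedge (p (i - (k - 6))) (p (i - (k - 6) + 1))
  have hcoord : ∀ j, j + 5 ≤ k → u.coord j = wedge (p j) (p (j + 2)) := by
    intro j hj
    rw [Model.coord, dif_pos (by omega)]
    exact if_pos (by simp only; omega)
  have hsigma : ∀ j, j + 4 ≤ k → u.sigma j = wedge (p j) (p (j + 1)) := by
    intro j hj
    rw [Model.sigma]
    split_ifs with hc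
    · rw [Model.coord, dif_pos (by omega)]
      change (if k - 6 + j < k - 4 then _ else _) = _
      rw [if_neg (by omega), Nat.add_sub_cancel_left]
    · have : j = 0 ∨ j = 1 ∨ j = k - 4 := by omega
      rcases this with rfl | rfl | rfl
      · exact hw0.symm
      · exact hw1.symm
      · rw [show k - 4 + 1 = k - 3 by omega, hwl]
  have hpath : ∀ n ≤ k - 3, u.path n = p n := by
    have := eq_steps (σ := u.sigma) (τ := u.coord) (p := p) (N := k - 5) ?_ hp1 ?_ ?_ ?_
    · intro n hn
      exact this n (by omega)
    · rw [hcoord 0 (by omega), zero_add, hp2, hp0]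
      simp [wedge]
    · intro n hn
      rw [hsigma n (by omega)]
      exact (hwpos n (by omega)).ne'
    · intro n hn
      rw [hsigma n (by omega)]
    · intro n hn
      rw [hcoord n (by omega)]
  have hu : u ∈ chartDomain k := by
    refine ⟨fun n => ?_, ?_⟩
    · by_cases hn : n + 4 ≤ k
      · rw [hsigma n hn]; exact hwpos n hn
      · rw [u.sigma_last (by omega)]; exact one_pos
    · rw [hpath _ le_rfl, hpath 0 (by omega)]
      intro h0
      have h1 : form (Y 0) (Y (k - 3)) = 0 := by
        rw [← hp 0 (by omega), ← hp (k - 3) le_rfl, form_nullVec, wedge_comm, h0]; simp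
      have h2 := h.form_natCast_neg (a := 1) (b := k - 1) (by omega) (by omega) (by omega)
      have h3 : form (Y 0) (Y (k - 3)) = -form (z (1 : ℕ)) (z (k - 1 : ℕ)) := by
        rw [hY0, hYL, hzL, form_neg_left]
        simp [form, horizonVec, h11, h12, L, -Nat.cast_one]
      linarith
  have hXpath : ∀ j, j + 4 ≤ k → lightPath u.path j = X j := by
    intro j
    induction j with
    | zero => intro _; rw [lightPath_zero, hX_zero]
    | succ j ih =>
      intro hj
      rw [lightPath_succ, ih (by omega), hpath _ (by omega), hp _ (by omega), hYX j (by omega)]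
      abel
  refine ⟨u, hu, ?_⟩
  funext i
  obtain ⟨n, hn, rfl⟩ : ∃ n < k, (n : ZMod k) = i := ⟨i.val, i.val_lt, ZMod.natCast_zmod_val i⟩
  rw [Model.cycle, ZMod.val_cast_of_lt hn]
  rcases n with _ | _ | n
  · rw [polygonVec_zero, e0]
  · rw [zero_add, polygonVec_one, hpath 0 (by omega), hp 0 (by omega), hY0, neg_neg]
  · by_cases e : n + 1 + 1 = k - 1
    · rw [e, polygonVec_last hk, hzL, hXpath _ (by omega), hpath _ le_rfl, hp _ le_rfl, hYL]
    · rw [polygonVec_add_two (by omega), hXpath _ (by omega), hzX _ (by omega)]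

/-- Every lifted polygon is equivalent to a normalised one. -/
lemma exists_eq_smul_map_cycle {v : ZMod k → R23} (hk : 6 ≤ k) (h : IsNegativeCycle v) :
    ∃ u ∈ chartDomain k, ∃ (A : SO0) (c : ZMod k → ℝ), (∀ i, 0 < c i) ∧
      ∀ i, v i = c i • A.1 (u.cycle i) := by
  have : NeZero k := ⟨by omega⟩
  let c : ZMod k → ℝ := fun i => scale k (fun n : ℕ => v n) i.val
  have hc : ∀ i, 0 < c i := fun i => scale_pos hk h i.val_lt
  let w : ZMod k → R23 := fun i => c i • v i
  have hw : IsNegativeCycle w := h.smul_vec hc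
  have hwn : ∀ n < k, w n = rescale k (fun n : ℕ => v n) n := by
    intro n hn
    simp only [w, c]
    rw [ZMod.val_cast_of_lt hn, rescale]
  have hz : ∀ n, n + 4 ≤ k → form (w (0 : ℕ)) (w (n + 2 : ℕ)) = -1 := by
    intro n hn
    rw [hwn 0 (by omega), hwn (n + 2) (by omega), form_rescale_zero hk h hn]
  have hz1 : form (w (1 : ℕ)) (w (3 : ℕ)) = -2 := by
    rw [hwn 1 (by omega), hwn 3 (by omega), form_rescale_one hk h]
  have hz2 : form (w (2 : ℕ)) (w (4 : ℕ)) = -2 := by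
    rw [hwn 2 (by omega), hwn 4 (by omega), form_rescale_two hk h]
  have hzk : form (w (k - 3 : ℕ)) (w (k - 1 : ℕ)) = -2 := by
    rw [hwn (k - 3) (by omega), hwn (k - 1) (by omega), form_rescale_last hk h]
  have f02 := hz 0 (by omega)
  have f03 := hz 1 (by omega)
  have f04 := hz 2 (by omega)
  have f23 := hw.form_natCast_succ 2
  have f34 := hw.form_natCast_succ 3
  have f0 := hw.self (0 : ℕ)
  have f2 := hw.self (2 : ℕ)
  have f3 := hw.self (3 : ℕ)
  have f4 := hw.self (4 : ℕ)
  have fut := hw.future (2 : ℕ)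
  rw [← Nat.cast_succ] at fut
  simp only [zero_add, Nat.reduceAdd, Nat.succ_eq_add_one] at f02 f03 f04 f23 f34 fut
  generalize hw0 : w (0 : ℕ) = w0 at *
  generalize hw2 : w (2 : ℕ) = w2 at *
  generalize hw3 : w (3 : ℕ) = w3 at *
  generalize hw4 : w (4 : ℕ) = w4 at *
  have hsub : ∀ x y : R23, x - y = x + (-1 : ℝ) • y := fun x y => by module
  obtain ⟨A, a0, a1, a2, a3⟩ := exists_SO0_of_gram (b₀ := w2) (b₁ := w3 + (-1 : ℝ) • w2)
    (b₂ := (-1 : ℝ) • w0) (b₃ := (1 / 2 : ℝ) • w4 + (-1 / 2 : ℝ) • w3 + (-1 : ℝ) • w0)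
    (by simp [f2]) (by simp [f2, f23]) (by simp [form_comm w2 w0, f02])
    (by simp [form_comm w2 w0, f02, f23, hz2])
    (by simp [f2, f3, f23, form_comm w3 w2]) (by simp [form_comm w3 w0, form_comm w2 w0, f03, f02])
    (by simp [form_comm w3 w0, form_comm w2 w0, f03, f02, f23, f34, f3, hz2])
    (by simp [f0]) (by simp [f04, f03, f0]; norm_num)
    (by simp [f04, f03, f0, f4, f3, f34, form_comm w4 w3, form_comm w4 w0, form_comm w3 w0];
        norm_num)
    (by rw [dVol_timeFrame] at fut ⊢
        simp only [Pi.add_apply, Pi.smul_apply, smul_eq_mul]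
        linarith)
  have hinv : ∀ x, (A⁻¹ : SO0).1 (A.1 x) = x := fun x => A.1.symm_apply_apply x
  have hinv' : ∀ x, A.1 ((A⁻¹ : SO0).1 x) = x := fun x => A.1.apply_symm_apply x
  let z : ZMod k → R23 := fun i => (A⁻¹ : SO0).1 (w i)
  have hzz : ∀ i j, form (z i) (z j) = form (w i) (w j) := fun i j => (A⁻¹).2.1 _ _
  obtain ⟨u, hu, e⟩ := exists_eq_cycle hk (hw.map A⁻¹) (z := z)
    (fun n hn => by rw [hzz, hw0, hz n hn]) (by rw [hzz, hw3, hz1]) (by rw [hzz, hzk])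
    (by simp only [z]
        rw [hw0, ← hinv (-Pi.single 2 1)]
        congr 1
        rw [map_neg, a2]; module)
    (by simp only [z]; rw [hw2, ← hinv (Pi.single 0 1), a0])
    (by simp only [z]
        rw [hw3, ← hinv (Pi.single 0 1 + Pi.single 1 1)]
        congr 1
        rw [map_add, a0, a1]; module)
    (by simp only [z]
        rw [hw4, ← hinv (_ - _)]
        congr 1
        rw [map_sub, map_add, map_add, map_smul, map_smul, a0, a1, a2, a3]; module)
  refine ⟨u, hu, A, fun i => (c i)⁻¹, fun i => inv_pos.mpr (hc i), fun i => ?_⟩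
  rw [← congrFun e i, hinv', smul_smul, inv_mul_cancel₀ (hc i).ne', one_smul]

end standardPosition
end

noncomputable section
open R23 Ein MarkedPolygon

/-! ### The chart of the moduli space of lifted polygons -/

section smooth

variable {F : Type*} [NormedAddCommGroup F] [NormedSpace ℝ F] {x : F}

lemma ContDiffAt.r23_apply {f : F → R23} (hf : ContDiffAt ℝ ∞ f x) (i : Fin 5) :
    ContDiffAt ℝ ∞ (fun y => f y i) x := contDiffAt_pi.mp hf i

lemma ContDiffAt.r23_form {f g : F → R23} (hf : ContDiffAt ℝ ∞ f x) (hg : ContDiffAt ℝ ∞ g x) :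
    ContDiffAt ℝ ∞ (fun y => form (f y) (g y)) x := by
  have h1 := hf.r23_apply
  have h2 := hg.r23_apply
  simp only [form]
  exact (((((h1 0).mul (h2 2)).add ((h1 1).mul (h2 3))).add ((h1 2).mul (h2 0))).add
    ((h1 3).mul (h2 1))).sub ((h1 4).mul (h2 4))

lemma ContDiffAt.r23_dVol {f₀ f₁ f₂ f₃ f₄ : F → R23} (h₀ : ContDiffAt ℝ ∞ f₀ x)
    (h₁ : ContDiffAt ℝ ∞ f₁ x) (h₂ : ContDiffAt ℝ ∞ f₂ x) (h₃ : ContDiffAt ℝ ∞ f₃ x)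
    (h₄ : ContDiffAt ℝ ∞ f₄ x) :
    ContDiffAt ℝ ∞ (fun y => dVol (f₀ y) (f₁ y) (f₂ y) (f₃ y) (f₄ y)) x := by
  simp only [dVol, Matrix.det_apply]
  refine ContDiffAt.sum fun σ _ => ContDiffAt.const_smul _ (contDiffAt_prod fun i _ => ?_)
  generalize σ i = j
  fin_cases j
  · exact h₀.r23_apply _
  · exact h₁.r23_apply _
  · exact h₂.r23_apply _
  · exact h₃.r23_apply _
  · exact h₄.r23_apply _

lemma ContDiffAt.nullVec {f : F → ℝ × ℝ} (hf : ContDiffAt ℝ ∞ f x) :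
    ContDiffAt ℝ ∞ (fun y => nullVec (f y)) x := by
  have h1 := hf.fst
  have h2 := hf.snd
  refine contDiffAt_pi.mpr fun i => ?_
  fin_cases i
  · exact contDiffAt_const
  · exact h1.pow 2
  · exact contDiffAt_const
  · exact contDiffAt_const.mul (h2.pow 2)
  · exact (contDiffAt_const.mul h1).mul h2

lemma ContDiffAt.wedge {f g : F → ℝ × ℝ} (hf : ContDiffAt ℝ ∞ f x) (hg : ContDiffAt ℝ ∞ g x) :
    ContDiffAt ℝ ∞ (fun y => wedge (f y) (g y)) x :=
  (hf.fst.mul hg.snd).sub (hf.snd.mul hg.fst)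

lemma ContDiffAt.affVec {f : F → R23} (hf : ContDiffAt ℝ ∞ f x) :
    ContDiffAt ℝ ∞ (fun y => affVec (f y)) x := by
  refine contDiffAt_pi.mpr fun i => ?_
  fin_cases i
  · exact contDiffAt_const
  · exact hf.r23_apply 1
  · exact ((hf.r23_form hf).div_const 2).neg
  · exact hf.r23_apply 3
  · exact hf.r23_apply 4

lemma ContDiffAt.horizonVec {f g : F → R23} (hf : ContDiffAt ℝ ∞ f x)
    (hg : ContDiffAt ℝ ∞ g x) : ContDiffAt ℝ ∞ (fun y => horizonVec (f y) (g y)) x := by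
  refine contDiffAt_pi.mpr fun i => ?_
  fin_cases i
  · exact contDiffAt_const
  · exact hg.r23_apply 1
  · exact (hf.r23_form hg).neg
  · exact hg.r23_apply 3
  · exact hg.r23_apply 4

end smooth

namespace Model

variable {k : ℕ}

lemma contDiff_coord (i : ℕ) : ContDiff ℝ ∞ fun u : Model k => u.coord i := by
  unfold Model.coord
  by_cases h : i < 2 * (k - 5)
  · simp only [dif_pos h]; fun_prop
  · simp only [dif_neg h]; exact contDiff_const

lemma contDiff_sigma (i : ℕ) : ContDiff ℝ ∞ fun u : Model k => u.sigma i := by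
  unfold Model.sigma
  by_cases h : 2 ≤ i ∧ i + 5 ≤ k
  · simp only [if_pos h]; exact contDiff_coord _
  · simp only [if_neg h]; exact contDiff_const

lemma contDiffAt_path {u : Model k} (hu : ∀ n, 0 < u.sigma n) (n : ℕ) :
    ContDiffAt ℝ ∞ (fun u : Model k => u.path n) u := by
  induction n using Nat.strong_induction_on with
  | _ n ih =>
    match n with
    | 0 =>
      simp only [path_zero]
      exact (contDiff_coord 0).contDiffAt.prodMk contDiffAt_const
    | 1 =>
      simp only [path_one]
      exact contDiffAt_const
    | n + 2 =>
      simp only [path, steps_add_two]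
      exact ((contDiff_sigma n).contDiffAt.inv (hu n).ne').smul
        (((contDiff_coord n).contDiffAt.smul (ih (n + 1) (by omega))).sub
          ((contDiff_sigma (n + 1)).contDiffAt.smul (ih n (by omega))))

lemma contDiffAt_lightPath {u : Model k} (hu : ∀ n, 0 < u.sigma n) (n : ℕ) :
    ContDiffAt ℝ ∞ (fun u : Model k => lightPath u.path n) u := by
  simp only [lightPath]
  exact ContDiffAt.sum fun i _ => (contDiffAt_path hu (i + 1)).nullVec

lemma contDiffAt_cycle [NeZero k] {u : Model k} (hu : ∀ n, 0 < u.sigma n) :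
    ContDiffAt ℝ ∞ (fun u : Model k => u.cycle) u := by
  refine contDiffAt_pi.mpr fun i => ?_
  simp only [cycle, polygonVec]
  split_ifs
  · exact contDiffAt_const
  · exact (contDiffAt_path hu 0).nullVec.neg
  · exact (contDiffAt_lightPath hu _).horizonVec (contDiffAt_path hu _).nullVec
  · exact (contDiffAt_lightPath hu _).affVec

end Model

lemma isOpen_chartDomain (k : ℕ) : IsOpen (chartDomain k) := by
  have h1 : IsOpen {u : Model k | ∀ n, 0 < u.sigma n} := by
    have : {u : Model k | ∀ n, 0 < u.sigma n}
        = ⋂ n ∈ Finset.range k, {u : Model k | 0 < u.sigma n} := by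
      ext u
      simp only [Set.mem_ofPred_eq, Set.mem_iInter, Finset.mem_range]
      refine ⟨fun h n _ => h n, fun h n => ?_⟩
      by_cases hn : n < k
      · exact h n hn
      · rw [u.sigma_last (by omega)]; exact one_pos
    rw [this]
    exact isOpen_biInter_finset fun n _ =>
      isOpen_lt continuous_const (Model.contDiff_sigma n).continuous
  have h2 : ContinuousOn (fun u : Model k => wedge (u.path (k - 3)) (u.path 0))
      {u : Model k | ∀ n, 0 < u.sigma n} := fun u hu =>
    ((Model.contDiffAt_path hu _).wedge
      (Model.contDiffAt_path hu _)).continuousAt.continuousWithinAt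
  exact h2.isOpen_inter_preimage h1 isOpen_compl_singleton

section coordMap

variable {k : ℕ} {v : ZMod k → R23}

lemma rescale_neg_form (hk : 6 ≤ k) (h : IsNegativeCycle v) {a b : ℕ} (hab : a + 2 ≤ b)
    (hb : b < k) (hn : ¬(a = 0 ∧ b = k - 1)) :
    form (rescale k (fun n => v n) a) (rescale k (fun n => v n) b) < 0 := by
  rw [rescale, rescale, form_smul_left, form_smul_right]
  exact mul_neg_of_pos_of_neg (scale_pos hk h (by omega)) (mul_neg_of_pos_of_neg
    (scale_pos hk h (by omega)) (h.form_natCast_neg hab hb hn))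

lemma contDiffAt_rescale [NeZero k] (hk : 6 ≤ k) (h : IsNegativeCycle v) {n : ℕ} (hn : n < k) :
    ContDiffAt ℝ ∞ (fun v : ZMod k → R23 => rescale k (fun n => v n) n) v := by
  have hv : ∀ n : ℕ, ContDiffAt ℝ ∞ (fun v : ZMod k → R23 => v n) v := fun n =>
    (contDiff_apply ℝ R23 (n : ZMod k)).contDiffAt
  have hneg := fun a b => h.form_natCast_neg (a := a) (b := b)
  have h0 : ContDiffAt ℝ ∞ (fun v : ZMod k → R23 => scaleZero fun n => v n) v := by
    refine ContDiffAt.sqrt (ContDiffAt.div ((hv 2).r23_form (hv 4)).neg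
      ((contDiffAt_const.mul ((hv 0).r23_form (hv 2))).mul ((hv 0).r23_form (hv 4))) ?_)
      (radicand_pos hk h).ne'
    exact mul_ne_zero (mul_ne_zero two_ne_zero
      (hneg 0 2 (by omega) (by omega) (by omega)).ne) (hneg 0 4 (by omega) (by omega) (by omega)).ne
  have ha : ∀ n, n + 4 ≤ k →
      ContDiffAt ℝ ∞ (fun v : ZMod k → R23 => scaleAff (fun n => v n) (n + 2)) v := fun n hn =>
    contDiffAt_const.div (h0.mul ((hv 0).r23_form (hv (n + 2)))) (mul_ne_zero
      (scaleZero_pos hk h).ne' (hneg 0 (n + 2) (by omega) (by omega) (by omega)).ne)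
  suffices hsc : ContDiffAt ℝ ∞ (fun v : ZMod k → R23 => scale k (fun n => v n) n) v from
    hsc.smul (hv n)
  rcases n with _ | _ | n
  · simp only [scale_zero]; exact h0
  · simp only [zero_add, scale_one]
    exact contDiffAt_const.div ((ha 1 (by omega)).mul ((hv 1).r23_form (hv 3))) (mul_ne_zero
      (scaleAff_pos hk h (n := 1) (by omega)).ne' (hneg 1 3 (by omega) (by omega) (by omega)).ne)
  · by_cases e : n + 1 + 1 = k - 1
    · have h1 := ha (k - 5) (by omega)
      have h2 := (scaleAff_pos hk h (n := k - 5) (by omega)).ne'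
      rw [show k - 5 + 2 = k - 3 by omega] at h1 h2
      simp only [e, scale_last hk]
      exact contDiffAt_const.div (h1.mul ((hv (k - 3)).r23_form (hv (k - 1)))) (mul_ne_zero h2
        (hneg (k - 3) (k - 1) (by omega) (by omega) (by omega)).ne)
    · have : ∀ V : ℕ → R23, scale k V (n + 1 + 1) = scaleAff V (n + 2) := fun V =>
        scale_add_two V (by omega)
      simp only [this]
      exact ha n (by omega)

lemma contDiffAt_coordMap [NeZero k] (hk : 6 ≤ k) (h : IsNegativeCycle v) :
    ContDiffAt ℝ ∞ (coordMap k) v := by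
  have hr := fun n hn => contDiffAt_rescale hk h (n := n) hn
  have hpos : ∀ j, j + 4 ≤ k → 0 < -form (rescale k (fun n => v n) (j + 1))
      (rescale k (fun n => v n) (j + 3)) / 2 := fun j hj =>
    half_pos (neg_pos.mpr (rescale_neg_form hk h (by omega) (by omega) (by omega)))
  have hs : ∀ j, j + 4 ≤ k →
      ContDiffAt ℝ ∞ (fun v : ZMod k → R23 => sigmaInv (rescale k fun n => v n) j) v := fun j hj =>
    ContDiffAt.sqrt ((((hr (j + 1) (by omega)).r23_form (hr (j + 3) (by omega))).neg).div_const 2)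
      (hpos j hj).ne'
  have hs0 : ∀ j, j + 4 ≤ k → sigmaInv (rescale k fun n => v n) j ≠ 0 := fun j hj =>
    (Real.sqrt_pos.mpr (hpos j hj)).ne'
  refine contDiffAt_piLp (p := 2) |>.mpr fun i => ?_
  have hi := i.2
  change ContDiffAt ℝ ∞ (fun v : ZMod k → R23 => if (i : ℕ) < k - 4
    then tauInv (rescale k fun n => v n) i else sigmaInv (rescale k fun n => v n) (i - (k - 6))) v
  split_ifs with hlt
  · exact ContDiffAt.div (ContDiffAt.r23_dVol (hr 0 (by omega)) (hr (i + 1) (by omega))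
      (hr (i + 2) (by omega)) (hr (i + 3) (by omega)) (hr (i + 4) (by omega)))
      ((contDiffAt_const.mul (hs i (by omega))).mul (hs (i + 1) (by omega)))
      (mul_ne_zero (mul_ne_zero four_ne_zero (hs0 i (by omega))) (hs0 (i + 1) (by omega)))
  · exact hs (i - (k - 6)) (by omega)

lemma coordMap_mem (hk : 6 ≤ k) (h : IsNegativeCycle v) : coordMap k v ∈ chartDomain k := by
  obtain ⟨u, hu, A, c, hc, e⟩ := exists_eq_smul_map_cycle hk h
  have : v = fun i => c i • A.1 (u.cycle i) := funext e
  rw [this, coordMap_smul_map _ hc, coordMap_cycle hk hu]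
  exact hu

end coordMap

section homeomorph

variable {k : ℕ}

lemma LiftedLP.isNegativeCycle (hk : 6 ≤ k) (v : LiftedLP k) : IsNegativeCycle v.1 :=
  (exists_isFutureNegativeLift_iff hk).mp v.2

/-- A negative cycle as a point of the space of lifted polygons. -/
def LiftedLP.ofCycle (hk : 6 ≤ k) (v : ZMod k → R23) (h : IsNegativeCycle v) : LiftedLP k :=
  ⟨v, (exists_isFutureNegativeLift_iff hk).mpr h⟩

lemma LiftedLP.continuous_coe : Continuous fun v : LiftedLP k => v.1 := continuous_induced_dom

lemma LTLP.continuous_mk : Continuous (LTLP.mk : LiftedLP k → LTLP k) := continuous_quotient_mk'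

lemma coordMap_eq_of_equiv {v w : LiftedLP k} (h : v ≈ w) : coordMap k v.1 = coordMap k w.1 := by
  obtain ⟨A, c, hc, e⟩ := h
  rw [show w.1 = fun i => c i • A.1 (v.1 i) from funext e, coordMap_smul_map _ hc]

/-- The moduli space of lifted marked polygons is homeomorphic to an open subset of the model
space. -/
def LTLP.chart (hk : 6 ≤ k) : LTLP k ≃ₜ chartDomain k where
  toFun := Quotient.lift
    (fun v : LiftedLP k => (⟨coordMap k v.1, coordMap_mem hk (v.isNegativeCycle hk)⟩ :
      chartDomain k))
    (fun _ _ h => Subtype.ext (coordMap_eq_of_equiv h))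
  invFun u := LTLP.mk (LiftedLP.ofCycle hk u.1.cycle (chartDomain.isNegativeCycle hk u.2))
  left_inv := by
    rintro ⟨v⟩
    obtain ⟨u, hu, A, c, hc, e⟩ := exists_eq_smul_map_cycle hk (v.isNegativeCycle hk)
    have h : coordMap k v.1 = u := by
      rw [show v.1 = fun i => c i • A.1 (u.cycle i) from funext e, coordMap_smul_map _ hc,
        coordMap_cycle hk hu]
    refine Quotient.sound ⟨A, c, hc, fun i => ?_⟩
    rw [e i]
    change _ = c i • A.1 ((coordMap k v.1).cycle i)
    rw [h]
  right_inv u := Subtype.ext (coordMap_cycle hk u.2)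
  continuous_toFun := by
    have : NeZero k := ⟨by omega⟩
    refine Continuous.quotient_lift (Continuous.subtype_mk ?_ _) _
    refine continuous_iff_continuousAt.mpr fun v => ?_
    exact (contDiffAt_coordMap hk (v.isNegativeCycle hk)).continuousAt.comp
      (f := fun v : LiftedLP k => v.1) LiftedLP.continuous_coe.continuousAt
  continuous_invFun := by
    have : NeZero k := ⟨by omega⟩
    refine LTLP.continuous_mk.comp (continuous_induced_rng.mpr ?_)
    refine continuous_iff_continuousAt.mpr fun u => ?_
    exact (Model.contDiffAt_cycle u.2.1).continuousAt.comp
      (f := fun u : chartDomain k => u.1) continuous_subtype_val.continuousAt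

end homeomorph
end

noncomputable section
open R23 Ein MarkedPolygon Topology

/-! ### Forgetting the lift and the marking -/

section lifts

variable {k : ℕ}

/-- Real numbers indexed by the vertices of a cycle, such that the product of any two at
non-adjacent vertices is positive, have the same sign. -/
lemma pos_or_neg_of_mul_pos (hk : 6 ≤ k) {c : ZMod k → ℝ}
    (h : ∀ i j, j ≠ i → j ≠ i + 1 → i ≠ j + 1 → 0 < c i * c j) :
    (∀ i, 0 < c i) ∨ ∀ i, c i < 0 := by
  have : NeZero k := ⟨by omega⟩
  have n1 : ∀ {a : ℕ}, 0 < a → a < 6 → (a : ZMod k) ≠ 0 := fun ha hb =>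
    ZMod.natCast_ne_zero_of_lt ha (by omega)
  have n2 := n1 (a := 2) (by omega) (by omega)
  have n3 := n1 (a := 3) (by omega) (by omega)
  have n4 := n1 (a := 4) (by omega) (by omega)
  have n1' := n1 (a := 1) (by omega) (by omega)
  push_cast at n1' n2 n3 n4
  have h2 : ∀ i, 0 < c i * c (i + 2) := fun i => h _ _
    (fun e => n2 (by linear_combination e)) (fun e => n1' (by linear_combination e))
    (fun e => n3 (by linear_combination -e))
  have h3 : ∀ i, 0 < c i * c (i + 3) := fun i => h _ _
    (fun e => n3 (by linear_combination e)) (fun e => n2 (by linear_combination e))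
    (fun e => n4 (by linear_combination -e))
  -- the vertices `i` and `i + 1` are both non-adjacent to `i + 3`
  have h1 : ∀ i, 0 < c i * c (i + 1) := by
    intro i
    have e := h2 (i + 1)
    rw [show i + 1 + 2 = i + 3 by ring] at e
    have h4 : 0 < c i * c (i + 1) * c (i + 3) ^ 2 := by
      have := mul_pos (h3 i) e
      linarith
    exact pos_of_mul_pos_left h4 (sq_nonneg _)
  have h0 : ∀ n : ℕ, 0 < c 0 * c n := by
    intro n
    induction n with
    | zero =>
      have h5 := h1 0
      have : c 0 ≠ 0 := fun e => by rw [e, zero_mul] at h5; exact lt_irrefl _ h5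
      rw [Nat.cast_zero, ← sq]
      positivity
    | succ n ih =>
      rw [Nat.cast_succ]
      have h4 : 0 < c 0 * c (n + 1) * c n ^ 2 := by
        have := mul_pos ih (h1 n)
        linarith
      exact pos_of_mul_pos_left h4 (sq_nonneg _)
  have h0' : ∀ i : ZMod k, 0 < c 0 * c i := fun i => by
    rw [← ZMod.natCast_zmod_val i]; exact h0 _
  rcases lt_trichotomy (c 0) 0 with hc | hc | hc
  · exact .inr fun i => neg_of_mul_pos_right (h0' i) hc.le
  · have := h0' 0
    rw [hc, zero_mul] at this
    exact absurd this (lt_irrefl _)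
  · exact .inl fun i => pos_of_mul_pos_right (h0' i) hc.le

lemma MarkedPolygon.IsLift.smul_map {P : MarkedPolygon k} {v : ZMod k → R23} (h : P.IsLift v)
    (A : SO0) {c : ZMod k → ℝ} (hc : ∀ i, 0 < c i) :
    (A • P).IsLift (fun i => c i • A.1 (v i)) := by
  intro i
  refine ⟨((h i).1.smul A).smul_ne_zero (hc i).ne', ?_⟩
  rw [segment_smul_smul (hc _) (hc _), ← smul_segment, ← (h i).2]
  rfl

lemma MarkedPolygon.IsLift.smul_vec {P : MarkedPolygon k} {v : ZMod k → R23} (h : P.IsLift v)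
    {c : ZMod k → ℝ} (hc : ∀ i, 0 < c i) : P.IsLift (fun i => c i • v i) := fun i =>
  ⟨(h i).1.smul_ne_zero (hc i).ne', by rw [segment_smul_smul (hc _) (hc _), (h i).2]⟩

lemma MarkedPolygon.IsLift.neg_vec {P : MarkedPolygon k} {v : ZMod k → R23} (h : P.IsLift v) :
    P.IsLift (-v) := fun i =>
  ⟨by simpa using (h i).1.smul_ne_zero (c := -1) (by norm_num), by
    simp only [Pi.neg_apply, segment_neg_neg, (h i).2]⟩

/-- A lift determines the polygon. -/
lemma MarkedPolygon.IsLift.eq {P Q : MarkedPolygon k} {v : ZMod k → R23} (hP : P.IsLift v)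
    (hQ : Q.IsLift v) : P = Q :=
  MarkedPolygon.ext (funext fun i => (hP i).1.eq (hQ i).1)
    (funext fun i => (hP i).2.trans (hQ i).2.symm)

/-- Generators of the vertices of a negative polygon whose products at non-adjacent vertices are
negative differ from a given lift by positive factors and a common sign. -/
lemma eq_smul_or_eq_neg_smul (hk : 6 ≤ k) {P : MarkedPolygon k} {w x : ZMod k → R23}
    (hw : IsNegativeCycle w) (hP : P.IsLift w) (hx : ∀ i, IsRep (x i) (P.vertex i))
    (hneg : ∀ i j, j ≠ i → j ≠ i + 1 → i ≠ j + 1 → form (x i) (x j) < 0) :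
    ∃ c : ZMod k → ℝ, (∀ i, 0 < c i) ∧
      ((x = fun i => c i • w i) ∨ x = -fun i => c i • w i) := by
  choose c hc0 hc using fun i => (hx i).exists_smul (hP i).1
  have := pos_or_neg_of_mul_pos hk (c := c) fun i j h1 h2 h3 => by
    have h4 := hneg i j h1 h2 h3
    rw [hc i, hc j, form_smul_left, form_smul_right, ← mul_assoc] at h4
    exact pos_of_mul_neg_left h4 (hw.form_nonpos i j)
  rcases this with h | h
  · exact ⟨c, h, .inl (funext hc)⟩
  · refine ⟨fun i => -c i, fun i => neg_pos.mpr (h i), .inr (funext fun i => ?_)⟩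
    simp [hc i]

/-- The marked polygon of a lifted polygon. -/
def LiftedLP.toMarked (hk : 6 ≤ k) (v : LiftedLP k) : MarkedLP k :=
  ⟨(v.isNegativeCycle hk).polygon hk, v.1, (v.isNegativeCycle hk).isLift_polygon hk,
    (v.isNegativeCycle hk).isNegativeLift hk ((v.isNegativeCycle hk).isLift_polygon hk),
    (v.isNegativeCycle hk).future, (v.isNegativeCycle hk).isGeneratingLift hk⟩

lemma LiftedLP.isLift_toMarked (hk : 6 ≤ k) (v : LiftedLP k) : (v.toMarked hk).1.IsLift v.1 :=
  (v.isNegativeCycle hk).isLift_polygon hk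

lemma LiftedLP.toMarked_eq (hk : 6 ≤ k) {v : LiftedLP k} {P : MarkedLP k} (h : P.1.IsLift v.1) :
    v.toMarked hk = P :=
  Subtype.ext ((v.isLift_toMarked hk).eq h)

lemma LiftedLP.toMarked_surjective (hk : 6 ≤ k) :
    Function.Surjective (LiftedLP.toMarked hk : LiftedLP k → MarkedLP k) := by
  rintro ⟨P, v, hv⟩
  exact ⟨⟨v, P, hv⟩, LiftedLP.toMarked_eq hk hv.1⟩

/-- The projection from non-zero vectors to the projective space is open. -/
lemma isOpen_image_mk' {B : Set R23} (hB : IsOpen B) :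
    @IsOpen (ℙ ℝ R23) (TopologicalSpace.coinduced (Projectivization.mk' ℝ (V := R23)) inferInstance)
      {p | ∃ x ∈ B, ∃ hx : x ≠ 0, Projectivization.mk ℝ x hx = p} := by
  let _ : TopologicalSpace (ℙ ℝ R23) :=
    TopologicalSpace.coinduced (Projectivization.mk' ℝ (V := R23)) inferInstance
  refine isOpen_coinduced.mpr ?_
  have : Projectivization.mk' ℝ (V := R23) ⁻¹'
      {p | ∃ x ∈ B, ∃ hx : x ≠ 0, Projectivization.mk ℝ x hx = p}
      = ⋃ a : ℝˣ, (fun y : {y : R23 // y ≠ 0} => (a : ℝ) • y.1) ⁻¹' B := by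
    ext y
    simp only [Set.mem_preimage, Set.mem_ofPred_eq, Set.mem_iUnion]
    constructor
    · rintro ⟨x, hx, hx0, e⟩
      obtain ⟨a, ha⟩ := (Projectivization.mk_eq_mk_iff ℝ x y.1 hx0 y.2).mp e
      exact ⟨a, by rw [← Units.smul_def, ha]; exact hx⟩
    · rintro ⟨a, ha⟩
      exact ⟨_, ha, by simpa using y.2,
        (Projectivization.mk_eq_mk_iff ℝ _ y.1 _ y.2).mpr ⟨a, rfl⟩⟩
  rw [this]
  exact isOpen_iUnion fun a => hB.preimage (by fun_prop)

lemma Ein.isOpen_setOf_isRep {B : Set R23} (hB : IsOpen B) :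
    IsOpen {p : Ein | ∃ x ∈ B, IsRep x p} := by
  let _ : TopologicalSpace (ℙ ℝ R23) :=
    TopologicalSpace.coinduced (Projectivization.mk' ℝ (V := R23)) inferInstance
  exact isOpen_induced_iff.mpr ⟨_, isOpen_image_mk' hB, rfl⟩

lemma LiftedLP.continuous_toMarked (hk : 6 ≤ k) :
    Continuous (LiftedLP.toMarked hk : LiftedLP k → MarkedLP k) := by
  let _ : TopologicalSpace (ℙ ℝ R23) :=
    TopologicalSpace.coinduced (Projectivization.mk' ℝ (V := R23)) inferInstance
  refine continuous_induced_rng.mpr (continuous_pi fun i => continuous_induced_rng.mpr ?_)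
  have h1 : Continuous fun v : LiftedLP k =>
      (⟨v.1 i, (v.isNegativeCycle hk).ne_zero i⟩ : {x : R23 // x ≠ 0}) :=
    ((continuous_apply i).comp LiftedLP.continuous_coe).subtype_mk _
  exact (continuous_coinduced_rng (f := Projectivization.mk' ℝ (V := R23))).comp h1

/-- Lifts of polygons can be chosen near a given lift: generators of the vertices that are close to
the given ones have negative products where they should, which determines their signs. -/
lemma LiftedLP.isOpenMap_toMarked (hk : 6 ≤ k) :
    IsOpenMap (LiftedLP.toMarked hk : LiftedLP k → MarkedLP k) := by
  have : NeZero k := ⟨by omega⟩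
  intro O hO
  obtain ⟨O', hO', rfl⟩ := isOpen_induced_iff.mp hO
  rw [isOpen_iff_forall_mem_open]
  rintro _ ⟨v, hv, rfl⟩
  have hvc := v.isNegativeCycle hk
  have hN : IsOpen {x : ZMod k → R23 | ∀ i j, form (v.1 i) (v.1 j) < 0 →
      form (x i) (x j) < 0} := by
    simp only [Set.ofPred_forall]
    refine isOpen_iInter_of_finite fun i => isOpen_iInter_of_finite fun j =>
      isOpen_iInter_of_finite fun _ => isOpen_lt ?_ continuous_const
    simp only [form]
    fun_prop
  obtain ⟨B, hB, hBO⟩ := isOpen_pi_iff'.mp (hO'.inter hN) v.1 ⟨hv, fun _ _ h => h⟩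
  refine ⟨(fun P : MarkedLP k => P.1.vertex) ⁻¹'
    Set.univ.pi (fun i => {p : Ein | ∃ x ∈ B i, IsRep x p}), ?_, ?_, ?_⟩
  · rintro P hP
    choose x hxB hx using fun i => hP i (Set.mem_univ i)
    obtain ⟨hxO, hxN⟩ := hBO (fun i _ => hxB i : x ∈ Set.univ.pi B)
    obtain ⟨w, hw⟩ := P.2
    have hwc := (exists_isFutureNegativeLift_iff hk).mp ⟨P.1, hw⟩
    obtain ⟨c, hc, e⟩ := eq_smul_or_eq_neg_smul hk hwc hw.1 hx
      fun i j h1 h2 h3 => hxN i j (hvc.neg i j h1 h2 h3)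
    have hx2 : IsNegativeCycle x ∧ P.1.IsLift x := by
      rcases e with e | e
      · rw [e]; exact ⟨hwc.smul_vec hc, hw.1.smul_vec hc⟩
      · rw [e]; exact ⟨(hwc.smul_vec hc).neg_vec, (hw.1.smul_vec hc).neg_vec⟩
    exact ⟨LiftedLP.ofCycle hk x hx2.1, hxO, LiftedLP.toMarked_eq hk hx2.2⟩
  · exact (isOpen_set_pi Set.finite_univ fun i _ =>
      Ein.isOpen_setOf_isRep (hB i).1).preimage continuous_induced_dom
  · exact fun i _ => ⟨v.1 i, (hB i).2, (v.isLift_toMarked hk i).1⟩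

lemma LiftedLP.isQuotientMap_toMarked (hk : 6 ≤ k) :
    IsQuotientMap (LiftedLP.toMarked hk : LiftedLP k → MarkedLP k) :=
  (LiftedLP.isOpenMap_toMarked hk).isQuotientMap (LiftedLP.continuous_toMarked hk)
    (LiftedLP.toMarked_surjective hk)

lemma TLP.isQuotientMap_mk : IsQuotientMap (TLP.mk : MarkedLP k → TLP k) := isQuotientMap_quot_mk

lemma LTLP.isQuotientMap_mk : IsQuotientMap (LTLP.mk : LiftedLP k → LTLP k) :=
  isQuotientMap_quot_mk

lemma LP.isQuotientMap_mk : IsQuotientMap (LP.mk : MarkedLP k → LP k) := isQuotientMap_quot_mk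

lemma MLP.isQuotientMap_mk : IsQuotientMap (MLP.mk : LP k → MLP k) := isQuotientMap_quot_mk

lemma TLP.mk_eq_mk {P Q : MarkedLP k} : TLP.mk P = TLP.mk Q ↔ ∃ A : SO0, A • P.1 = Q.1 :=
  Quotient.eq

lemma LTLP.mk_eq_mk {v w : LiftedLP k} : LTLP.mk v = LTLP.mk w ↔
    ∃ (A : SO0) (c : ZMod k → ℝ), (∀ i, 0 < c i) ∧ ∀ i, w.1 i = c i • A.1 (v.1 i) :=
  Quotient.eq

/-- Two lifted polygons have equivalent marked polygons if and only if they are equivalent up to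
a common sign. -/
lemma LiftedLP.mk_toMarked_eq_iff (hk : 6 ≤ k) {v v' w : LiftedLP k} (hv' : v'.1 = -v.1) :
    TLP.mk (w.toMarked hk) = TLP.mk (v.toMarked hk) ↔
      LTLP.mk w = LTLP.mk v ∨ LTLP.mk w = LTLP.mk v' := by
  have hmk : v'.toMarked hk = v.toMarked hk := by
    apply LiftedLP.toMarked_eq
    rw [hv']
    exact (v.isLift_toMarked hk).neg_vec
  constructor
  · intro h
    obtain ⟨A, hA⟩ := TLP.mk_eq_mk.mp h
    have hl := (w.isLift_toMarked hk).smul_map A (c := 1) (fun _ => one_pos)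
    rw [hA] at hl
    simp only [Pi.one_apply, one_smul] at hl
    obtain ⟨c, hc, e | e⟩ := eq_smul_or_eq_neg_smul hk ((w.isNegativeCycle hk).map A) hl
      (fun i => (v.isLift_toMarked hk i).1) (v.isNegativeCycle hk).neg
    · exact .inl (LTLP.mk_eq_mk.mpr ⟨A, c, hc, fun i => congrFun e i⟩)
    · refine .inr (LTLP.mk_eq_mk.mpr ⟨A, c, hc, fun i => ?_⟩)
      rw [hv', e, neg_neg]
  · have key : ∀ u : LiftedLP k, LTLP.mk w = LTLP.mk u →
        TLP.mk (w.toMarked hk) = TLP.mk (u.toMarked hk) := by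
      intro u h
      obtain ⟨A, c, hc, e⟩ := LTLP.mk_eq_mk.mp h
      refine TLP.mk_eq_mk.mpr ⟨A, ?_⟩
      have h1 := (w.isLift_toMarked hk).smul_map A hc
      rw [← funext e] at h1
      exact h1.eq (u.isLift_toMarked hk)
    rintro (h | h)
    · exact key v h
    · rw [key v' h, hmk]

/-- The lift with the opposite sign. -/
def LiftedLP.opposite (hk : 6 ≤ k) (v : LiftedLP k) : LiftedLP k :=
  LiftedLP.ofCycle hk (-v.1) (v.isNegativeCycle hk).neg_vec

/-- The map that forgets the lift. -/
def LTLP.forget (hk : 6 ≤ k) : LTLP k → TLP k :=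
  Quotient.lift (fun v => TLP.mk (v.toMarked hk)) fun _ w h =>
    (LiftedLP.mk_toMarked_eq_iff hk (v' := w.opposite hk) rfl).mpr (.inl (Quotient.sound h))

lemma LTLP.forget_mk (hk : 6 ≤ k) (v : LiftedLP k) :
    LTLP.forget hk (LTLP.mk v) = TLP.mk (v.toMarked hk) := rfl

lemma LTLP.isQuotientMap_forget (hk : 6 ≤ k) : IsQuotientMap (LTLP.forget (k := k) hk) := by
  have h : IsQuotientMap (LTLP.forget hk ∘ LTLP.mk : LiftedLP k → TLP k) :=
    TLP.isQuotientMap_mk.comp (LiftedLP.isQuotientMap_toMarked hk)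
  refine IsQuotientMap.of_comp LTLP.continuous_mk ?_ h
  exact LTLP.isQuotientMap_mk.continuous_iff.mpr h.continuous

end lifts

section forgetMarking

variable {k : ℕ}

/-- Two quotient maps with the same fibres have homeomorphic targets. -/
lemma exists_homeomorph_of_isQuotientMap {X Y Z : Type*} [TopologicalSpace X] [TopologicalSpace Y]
    [TopologicalSpace Z] {f : X → Y} {g : X → Z} (hf : IsQuotientMap f) (hg : IsQuotientMap g)
    (h : ∀ a b, f a = f b ↔ g a = g b) : ∃ e : Y ≃ₜ Z, ∀ x, e (f x) = g x := by
  have hf' : ∀ y, f (Function.surjInv hf.surjective y) = y := Function.surjInv_eq hf.surjective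
  have hg' : ∀ z, g (Function.surjInv hg.surjective z) = z := Function.surjInv_eq hg.surjective
  have e1 : ∀ x, g (Function.surjInv hf.surjective (f x)) = g x := fun x =>
    (h _ _).mp (hf' (f x))
  have e2 : ∀ x, f (Function.surjInv hg.surjective (g x)) = f x := fun x =>
    (h _ _).mpr (hg' (g x))
  refine ⟨{ toFun := fun y => g (Function.surjInv hf.surjective y)
            invFun := fun z => f (Function.surjInv hg.surjective z)
            left_inv := fun y => by
              obtain ⟨x, rfl⟩ := hf.surjective y
              simp only [e1, e2]
            right_inv := fun z => by
              obtain ⟨x, rfl⟩ := hg.surjective z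
              simp only [e1, e2]
            continuous_toFun := hf.continuous_iff.mpr ?_
            continuous_invFun := hg.continuous_iff.mpr ?_ }, e1⟩
  · exact hg.continuous.congr fun x => (e1 x).symm
  · exact hf.continuous.congr fun x => (e2 x).symm

lemma MLP.mk_eq_mk_iff {P Q : MarkedLP k} : MLP.mk (LP.mk P) = MLP.mk (LP.mk Q) ↔
    ∃ (a : ZMod k) (A : SO0), A • (a +ᵥ P.1) = Q.1 := by
  refine Quotient.eq.trans ⟨?_, ?_⟩
  · rintro ⟨P', Q', A, hP, hQ, h⟩
    obtain ⟨a, ha⟩ := LP.mk_eq_mk.mp hP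
    obtain ⟨b, hb⟩ := LP.mk_eq_mk.mp hQ
    refine ⟨-b + a, A, ?_⟩
    have h1 : A • (a +ᵥ P.1) = b +ᵥ Q.1 := by
      rw [← show P'.1 = a +ᵥ P.1 from congrArg Subtype.val ha.symm,
        ← show Q'.1 = b +ᵥ Q.1 from congrArg Subtype.val hb.symm, h]
    have h2 : A • ((-b + a) +ᵥ P.1) = -b +ᵥ (A • (a +ᵥ P.1)) := by
      rw [add_vadd]; rfl
    rw [h2, h1, neg_vadd_vadd]
  · rintro ⟨a, A, h⟩
    exact ⟨a +ᵥ P, Q, A, LP.mk_eq_mk.mpr ⟨a, rfl⟩, rfl, h⟩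

lemma mk_TLP_eq_iff {P Q : MarkedLP k} :
    (Quotient.mk _ (TLP.mk P) : AddAction.orbitRel.Quotient (ZMod k) (TLP k))
      = Quotient.mk _ (TLP.mk Q) ↔ ∃ (a : ZMod k) (A : SO0), A • (a +ᵥ P.1) = Q.1 := by
  refine Quotient.eq.trans (AddAction.orbitRel_apply.trans ⟨?_, ?_⟩)
  · rintro ⟨a, ha⟩
    obtain ⟨A, hA⟩ := TLP.mk_eq_mk.mp (show TLP.mk (a +ᵥ Q) = TLP.mk P from ha)
    refine ⟨-a, A⁻¹, ?_⟩
    have h : A⁻¹ • P.1 = a +ᵥ Q.1 := by rw [← hA, inv_smul_smul]; rfl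
    have h2 : A⁻¹ • (-a +ᵥ P.1) = -a +ᵥ (A⁻¹ • P.1) := rfl
    rw [h2, h, neg_vadd_vadd]
  · rintro ⟨a, A, h⟩
    refine ⟨-a, ?_⟩
    refine (TLP.mk_eq_mk (P := -a +ᵥ Q) (Q := P)).mpr ⟨A⁻¹, ?_⟩
    change A⁻¹ • (-a +ᵥ Q.1) = P.1
    have h2 : A⁻¹ • (-a +ᵥ Q.1) = -a +ᵥ (A⁻¹ • Q.1) := rfl
    rw [h2, ← h, inv_smul_smul, neg_vadd_vadd]

lemma exists_homeomorph_MLP : ∃ h : AddAction.orbitRel.Quotient (ZMod k) (TLP k) ≃ₜ MLP k,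
    ∀ P : MarkedLP k, h (Quotient.mk _ (TLP.mk P)) = MLP.mk (LP.mk P) :=
  exists_homeomorph_of_isQuotientMap
    (f := fun P : MarkedLP k =>
      (Quotient.mk _ (TLP.mk P) : AddAction.orbitRel.Quotient (ZMod k) (TLP k)))
    (g := fun P : MarkedLP k => MLP.mk (LP.mk P))
    (isQuotientMap_quot_mk.comp TLP.isQuotientMap_mk)
    (MLP.isQuotientMap_mk.comp LP.isQuotientMap_mk)
    fun _ _ => mk_TLP_eq_iff.trans MLP.mk_eq_mk_iff.symm

end forgetMarking
end

noncomputable section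
open R23 Ein MarkedPolygon Topology

/-! ### Orbifold structures -/

section quotients

/-- A quotient map whose fibres are the orbits of a group of homeomorphisms is open. -/
lemma isOpenMap_of_fibers {M X : Type*} [TopologicalSpace M] [TopologicalSpace X]
    {Γ : Subgroup (Equiv.Perm M)} (hΓ : ∀ g ∈ Γ, Continuous g) {q : M → X} (hq : IsQuotientMap q)
    (hfib : ∀ x y, q x = q y ↔ ∃ g ∈ Γ, g x = y) : IsOpenMap q := by
  intro O hO
  rw [← hq.isOpen_preimage]
  have : q ⁻¹' (q '' O) = ⋃ g ∈ Γ, g ⁻¹' O := by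
    ext x
    simp only [Set.mem_preimage, Set.mem_image, Set.mem_iUnion, exists_prop]
    constructor
    · rintro ⟨y, hy, e⟩
      obtain ⟨g, hg, rfl⟩ := (hfib x y).mp e.symm
      exact ⟨g, hg, hy⟩
    · rintro ⟨g, hg, h⟩
      exact ⟨g x, h, ((hfib x _).mpr ⟨g, hg, rfl⟩).symm⟩
  rw [this]
  exact isOpen_biUnion fun g hg => hO.preimage (hΓ g hg)

lemma t2Space_of_fibers {M X : Type*} [TopologicalSpace M] [T2Space M] [TopologicalSpace X]
    {Γ : Subgroup (Equiv.Perm M)} [Finite Γ] (hΓ : ∀ g ∈ Γ, Continuous g) {q : M → X}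
    (hq : IsQuotientMap q) (hfib : ∀ x y, q x = q y ↔ ∃ g ∈ Γ, g x = y) : T2Space X := by
  have hopen := isOpenMap_of_fibers hΓ hq hfib
  rw [t2Space_iff_of_isOpenQuotientMap ⟨hq.surjective, hq.continuous, hopen⟩]
  have : {p : M × M | q p.1 = q p.2} = ⋃ g : Γ, {p : M × M | g.1 p.1 = p.2} := by
    ext p
    simp only [Set.mem_ofPred_eq, Set.mem_iUnion, hfib, Subtype.exists, exists_prop]
  rw [this]
  exact isClosed_iUnion_of_finite fun g =>
    isClosed_eq ((hΓ g.1 g.2).comp continuous_fst) continuous_snd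

/-- The quotient of an open set of `ℝⁿ` by a finite group of diffeomorphisms is an orbifold, with a
single chart. -/
lemma isOrbifold_of_fibers {n : ℕ} {X : Type} [TopologicalSpace X]
    (U : TopologicalSpace.Opens (EuclideanSpace ℝ (Fin n))) (Γ : Subgroup (Equiv.Perm U))
    [Finite Γ] (hΓ : ∀ g ∈ Γ, ∃ f : EuclideanSpace ℝ (Fin n) → EuclideanSpace ℝ (Fin n),
      ContDiffOn ℝ ∞ f U ∧ ∀ x : U, (g x : EuclideanSpace ℝ (Fin n)) = f x)
    {q : U → X} (hq : IsQuotientMap q) (hfib : ∀ x y, q x = q y ↔ ∃ g ∈ Γ, g x = y) :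
    IsOrbifold n X := by
  have hcont : ∀ g ∈ Γ, Continuous g := by
    intro g hg
    obtain ⟨f, hf, e⟩ := hΓ g hg
    refine continuous_induced_rng.mpr ?_
    exact (continuousOn_iff_continuous_domRestrict.mp hf.continuousOn).congr fun x => (e x).symm
  have hopen := isOpenMap_of_fibers hcont hq hfib
  refine ⟨t2Space_of_fibers hcont hq hfib, hq.secondCountableTopology hopen, ?_⟩
  let c : OrbifoldChart n X :=
    { source := U
      group := Γ
      effective := inferInstance
      smooth_smul := fun g => hΓ g.1 g.2
      proj := q
      continuous_proj := hq.continuous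
      isOpenMap_proj := hopen
      proj_eq_iff := fun x y => (hfib x y).trans
        ⟨fun ⟨g, hg, e⟩ => ⟨⟨g, hg⟩, e⟩, fun ⟨g, e⟩ => ⟨g.1, g.2, e⟩⟩ }
  -- the elements of the group are the diffeomorphisms between points with the same image
  refine ⟨{c}, fun x => ⟨c, rfl, hq.surjective x⟩, ?_⟩
  rintro _ rfl _ rfl x y hxy
  obtain ⟨g, hg, rfl⟩ := (hfib x y).mp hxy
  obtain ⟨f, hf, e⟩ := hΓ g hg
  obtain ⟨f', hf', e'⟩ := hΓ g⁻¹ (Γ.inv_mem hg)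
  have hgf : ∀ z (hz : z ∈ U), f z = g ⟨z, hz⟩ := fun z hz => (e ⟨z, hz⟩).symm
  have hgf' : ∀ z (hz : z ∈ U), f' z = g⁻¹ ⟨z, hz⟩ := fun z hz => (e' ⟨z, hz⟩).symm
  refine ⟨{ toFun := f, invFun := f', source := U, target := U
            map_source' := fun z hz => by rw [hgf z hz]; exact (g ⟨z, hz⟩).2
            map_target' := fun z hz => by rw [hgf' z hz]; exact (g⁻¹ ⟨z, hz⟩).2
            left_inv' := fun z hz => by
              rw [hgf z hz, hgf' _ (g ⟨z, hz⟩).2]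
              exact congrArg Subtype.val (g.symm_apply_apply ⟨z, hz⟩)
            right_inv' := fun z hz => by
              rw [hgf' z hz, hgf _ (g⁻¹ ⟨z, hz⟩).2]
              exact congrArg Subtype.val (g.apply_symm_apply ⟨z, hz⟩)
            open_source := U.isOpen
            open_target := U.isOpen
            continuousOn_toFun := hf.continuousOn
            continuousOn_invFun := hf'.continuousOn },
    x.2, (e x).symm, subset_rfl, subset_rfl, hf, hf', fun z w _ hzw => ?_⟩
  exact (hfib z w).mpr ⟨g, hg, Subtype.ext ((e z).trans hzw)⟩

/-- A space that is covered by open embeddings of open sets of `ℝⁿ` is a manifold. -/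
lemma isTopologicalManifold_of_isOpenEmbedding {n : ℕ} {X : Type} [TopologicalSpace X] [T2Space X]
    [SecondCountableTopology X]
    (h : ∀ x : X, ∃ (V : TopologicalSpace.Opens (EuclideanSpace ℝ (Fin n))) (f : V → X),
      IsOpenEmbedding f ∧ x ∈ Set.range f) : IsTopologicalManifold n X := by
  refine ⟨inferInstance, inferInstance, ?_⟩
  have h' : ∀ x : X, ∃ e : OpenPartialHomeomorph X (EuclideanSpace ℝ (Fin n)), x ∈ e.source := by
    intro x
    obtain ⟨V, f, hf, v, rfl⟩ := h x
    have : Nonempty V := ⟨v⟩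
    refine ⟨(hf.toOpenPartialHomeomorph f).symm.trans (V.openPartialHomeomorphSubtypeCoe this), ?_⟩
    simp
  choose e he using h'
  exact ⟨{ atlas := Set.range e, chartAt := e, mem_chart_source := he,
           chart_mem_atlas := fun x => ⟨x, rfl⟩ }⟩

end quotients

section symmetries

variable {k : ℕ}

/-- The group generated by the changes of marking and by the exchange of the two lifts. -/
abbrev Symmetries (k : ℕ) : Type := Multiplicative (ZMod k) × ℤˣ

/-- The action of the symmetries on families of vectors. -/
def Symmetries.act (g : Symmetries k) (v : ZMod k → R23) : ZMod k → R23 :=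
  fun i => ((g.2 : ℤ) : ℝ) • v (i + g.1.toAdd)

lemma Symmetries.act_one (v : ZMod k → R23) : Symmetries.act 1 v = v := by
  funext i; simp [Symmetries.act]

lemma Symmetries.act_mul (g h : Symmetries k) (v : ZMod k → R23) :
    Symmetries.act (g * h) v = Symmetries.act g (Symmetries.act h v) := by
  funext i
  simp only [Symmetries.act, Prod.fst_mul, Prod.snd_mul, toAdd_mul, Units.val_mul, Int.cast_mul,
    mul_smul, add_assoc]

lemma Symmetries.isNegativeCycle_act (g : Symmetries k) {v : ZMod k → R23}
    (h : IsNegativeCycle v) : IsNegativeCycle (g.act v) := by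
  rcases Int.units_eq_one_or g.2 with e | e
  · have : g.act v = fun i => v (i + g.1.toAdd) := by funext i; simp [Symmetries.act, e]
    rw [this]; exact h.shift _
  · have : g.act v = -fun i => v (i + g.1.toAdd) := by funext i; simp [Symmetries.act, e]
    rw [this]; exact (h.shift _).neg_vec

/-- The action of the symmetries on lifted polygons. -/
def Symmetries.lift (hk : 6 ≤ k) (g : Symmetries k) (v : LiftedLP k) : LiftedLP k :=
  LiftedLP.ofCycle hk (g.act v.1) (g.isNegativeCycle_act (v.isNegativeCycle hk))

/-- The action of the symmetries on the moduli space of lifted marked polygons. -/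
def Symmetries.onLTLP (hk : 6 ≤ k) (g : Symmetries k) : LTLP k → LTLP k :=
  Quotient.map (g.lift hk) fun v w ⟨A, c, hc, e⟩ =>
    ⟨A, fun i => c (i + g.1.toAdd), fun _ => hc _, fun i => by
      change ((g.2 : ℤ) : ℝ) • w.1 _ = _ • A.1 (((g.2 : ℤ) : ℝ) • v.1 _)
      rw [e, map_smul, smul_comm]⟩

lemma Symmetries.onLTLP_mk (hk : 6 ≤ k) (g : Symmetries k) (v : LiftedLP k) :
    g.onLTLP hk (LTLP.mk v) = LTLP.mk (g.lift hk v) := rfl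

/-- The action of the symmetries in the coordinates of the moduli space. -/
def Symmetries.perm (hk : 6 ≤ k) : Symmetries k →* Equiv.Perm (chartDomain k) :=
  MonoidHom.toHomPerm
    { toFun := fun g u => LTLP.chart hk (g.onLTLP hk ((LTLP.chart hk).symm u))
      map_one' := by
        funext u
        have : ∀ x, Symmetries.onLTLP hk 1 x = x := by
          rintro ⟨v⟩
          exact congrArg LTLP.mk (Subtype.ext (Symmetries.act_one v.1))
        rw [this, Homeomorph.apply_symm_apply]
        rfl
      map_mul' := fun g h => by
        funext u
        have : ∀ x, Symmetries.onLTLP hk (g * h) x = g.onLTLP hk (h.onLTLP hk x) := by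
          rintro ⟨v⟩
          exact congrArg LTLP.mk (Subtype.ext (Symmetries.act_mul g h v.1))
        change LTLP.chart hk _ = LTLP.chart hk (g.onLTLP hk
          ((LTLP.chart hk).symm (LTLP.chart hk (h.onLTLP hk _))))
        rw [this, Homeomorph.symm_apply_apply] }

lemma Symmetries.perm_apply (hk : 6 ≤ k) (g : Symmetries k) (u : chartDomain k) :
    Symmetries.perm hk g u = LTLP.chart hk (g.onLTLP hk ((LTLP.chart hk).symm u)) := rfl

lemma Symmetries.perm_apply_coe (hk : 6 ≤ k) (g : Symmetries k) (u : chartDomain k) :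
    (Symmetries.perm hk g u : Model k) = coordMap k (g.act u.1.cycle) := rfl

lemma Symmetries.perm_apply_eq_iff (hk : 6 ≤ k) (g : Symmetries k) (x y : chartDomain k) :
    Symmetries.perm hk g x = y ↔ g.onLTLP hk ((LTLP.chart hk).symm x) = (LTLP.chart hk).symm y := by
  rw [Symmetries.perm_apply, ← Homeomorph.eq_symm_apply]

lemma Symmetries.contDiffOn_perm (hk : 6 ≤ k) (g : Symmetries k) :
    ContDiffOn ℝ ∞ (fun u : Model k => coordMap k (g.act u.cycle)) (chartDomain k) := by
  have : NeZero k := ⟨by omega⟩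
  intro u hu
  refine ContDiffAt.contDiffWithinAt ?_
  have h1 : ContDiffAt ℝ ∞ (fun u : Model k => g.act u.cycle) u :=
    contDiffAt_pi.mpr fun i => (contDiffAt_pi.mp (Model.contDiffAt_cycle hu.1)
      (i + g.1.toAdd)).const_smul (((g.2 : ℤ) : ℝ))
  exact ContDiffAt.comp (g := coordMap k) (f := fun u : Model k => g.act u.cycle) u
    (contDiffAt_coordMap hk (g.isNegativeCycle_act (chartDomain.isNegativeCycle hk hu))) h1

/-- The domain of the coordinates as an open set. -/
def chartOpens (k : ℕ) : TopologicalSpace.Opens (Model k) := ⟨chartDomain k, isOpen_chartDomain k⟩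

/-- A quotient of the moduli space of lifted marked polygons by symmetries is an orbifold. -/
lemma isOrbifold_of_symmetries (hk : 6 ≤ k) {X : Type} [TopologicalSpace X] {q : LTLP k → X}
    (hq : IsQuotientMap q) {G : Type} [Group G] [Finite G] (ι : G →* Symmetries k)
    (hfib : ∀ x y, q x = q y ↔ ∃ g, (ι g).onLTLP hk x = y) : IsOrbifold (2 * (k - 5)) X := by
  let ρ : G →* Equiv.Perm (chartOpens k) := (Symmetries.perm hk).comp ι
  have : Finite ρ.range := Set.finite_range ρ |>.to_subtype
  refine isOrbifold_of_fibers (chartOpens k) ρ.range ?_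
    (q := fun u => q ((LTLP.chart hk).symm u))
    (hq.comp (LTLP.chart hk).symm.isQuotientMap) ?_
  · rintro _ ⟨g, rfl⟩
    exact ⟨_, Symmetries.contDiffOn_perm hk (ι g), Symmetries.perm_apply_coe hk (ι g)⟩
  · intro x y
    rw [hfib]
    constructor
    · rintro ⟨g, hg⟩
      exact ⟨ρ g, ⟨g, rfl⟩, (Symmetries.perm_apply_eq_iff hk (ι g) x y).mpr hg⟩
    · rintro ⟨_, ⟨g, rfl⟩, hg⟩
      exact ⟨g, (Symmetries.perm_apply_eq_iff hk (ι g) x y).mp hg⟩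

/-- The exchange of the two lifts. -/
abbrev Symmetries.sign (k : ℕ) : ℤˣ →* Symmetries k := MonoidHom.inr _ _

lemma Symmetries.act_neg_one (a : ZMod k) (v : ZMod k → R23) :
    Symmetries.act (Multiplicative.ofAdd a, -1) v
      = -Symmetries.act (Multiplicative.ofAdd a, 1) v := by
  funext i; simp [Symmetries.act]

lemma LTLP.forget_eq_forget_iff (hk : 6 ≤ k) (x y : LTLP k) :
    LTLP.forget hk x = LTLP.forget hk y ↔ ∃ ε, (Symmetries.sign k ε).onLTLP hk x = y := by
  obtain ⟨v, rfl⟩ := LTLP.isQuotientMap_mk.surjective x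
  obtain ⟨w, rfl⟩ := LTLP.isQuotientMap_mk.surjective y
  have h1 : (Symmetries.sign k 1).lift hk v = v := Subtype.ext (Symmetries.act_one v.1)
  have h2 : ((Symmetries.sign k (-1)).lift hk v).1 = -v.1 :=
    (Symmetries.act_neg_one 0 v.1).trans (congrArg _ (Symmetries.act_one v.1))
  rw [eq_comm, LTLP.forget_mk, LTLP.forget_mk, LiftedLP.mk_toMarked_eq_iff hk h2]
  constructor
  · rintro (h | h)
    · exact ⟨1, by rw [Symmetries.onLTLP_mk, h1, h]⟩
    · exact ⟨-1, by rw [Symmetries.onLTLP_mk, h]⟩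
  · rintro ⟨ε, h⟩
    rcases Int.units_eq_one_or ε with rfl | rfl
    · exact .inl (by rw [← h, Symmetries.onLTLP_mk, h1])
    · exact .inr (by rw [← h, Symmetries.onLTLP_mk])

lemma isOrbifold_TLP (hk : 6 ≤ k) : IsOrbifold (2 * (k - 5)) (TLP k) :=
  isOrbifold_of_symmetries hk (LTLP.isQuotientMap_forget hk) (Symmetries.sign k)
    (LTLP.forget_eq_forget_iff hk)

lemma LiftedLP.toMarked_shift (hk : 6 ≤ k) (a : ZMod k) (v : LiftedLP k) :
    (Symmetries.lift hk (Multiplicative.ofAdd a, 1) v).toMarked hk = a +ᵥ v.toMarked hk := by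
  refine LiftedLP.toMarked_eq hk fun i => ?_
  have h := v.isLift_toMarked hk (i + a)
  have e : ∀ j, (Symmetries.lift hk (Multiplicative.ofAdd a, 1) v).1 j = v.1 (j + a) := by
    intro j
    change (((1 : ℤˣ) : ℤ) : ℝ) • v.1 (j + a) = _
    simp
  rw [e, e, add_right_comm]
  exact h

/-- Passing to unmarked polygons is the quotient by all symmetries of the moduli space of lifted
marked polygons. -/
lemma isOrbifold_MLP (hk : 6 ≤ k) : IsOrbifold (2 * (k - 5)) (MLP k) := by
  have : NeZero k := ⟨by omega⟩
  obtain ⟨h, hh⟩ := exists_homeomorph_MLP (k := k)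
  refine isOrbifold_of_symmetries hk (q := fun x => h (Quotient.mk _ (LTLP.forget hk x)))
    (h.isQuotientMap.comp (isQuotientMap_quot_mk.comp (LTLP.isQuotientMap_forget hk)))
    (MonoidHom.id (Symmetries k)) ?_
  intro x y
  obtain ⟨v, rfl⟩ := LTLP.isQuotientMap_mk.surjective x
  obtain ⟨w, rfl⟩ := LTLP.isQuotientMap_mk.surjective y
  rw [h.injective.eq_iff, LTLP.forget_mk, LTLP.forget_mk, mk_TLP_eq_iff]
  have key : ∀ a : ZMod k, (∃ A : SO0, A • (a +ᵥ (v.toMarked hk).1) = (w.toMarked hk).1) ↔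
      LTLP.mk w = LTLP.mk (Symmetries.lift hk (Multiplicative.ofAdd a, 1) v) ∨
      LTLP.mk w = LTLP.mk (Symmetries.lift hk (Multiplicative.ofAdd a, -1) v) := by
    intro a
    rw [← LiftedLP.mk_toMarked_eq_iff hk (Symmetries.act_neg_one a v.1),
      LiftedLP.toMarked_shift, eq_comm, TLP.mk_eq_mk]
    rfl
  constructor
  · rintro ⟨a, ha⟩
    rcases (key a).mp ha with e | e
    · exact ⟨_, e.symm⟩
    · exact ⟨_, e.symm⟩
  · rintro ⟨⟨a, ε⟩, e⟩
    refine ⟨a.toAdd, (key a.toAdd).mpr ?_⟩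
    rcases Int.units_eq_one_or ε with rfl | rfl
    · exact .inl e.symm
    · exact .inr e.symm

end symmetries
end

noncomputable section
open R23 Ein MarkedPolygon Topology

/-! ### Manifold structures -/

section sign

variable {k : ℕ}

/-- The exchange of the two lifts in the coordinates: it changes the signs of the numbers
`wedge (p j) (p (j + 2))`. -/
def Model.flip (u : Model k) : Model k :=
  WithLp.toLp 2 fun i => if (i : ℕ) < k - 4 then -u i else u i

lemma Model.continuous_flip : Continuous (Model.flip : Model k → Model k) := by
  refine (PiLp.continuous_toLp 2 _).comp (continuous_pi fun i => ?_)
  split_ifs <;> fun_prop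

lemma Model.coord_flip (u : Model k) {i : ℕ} (hi : i < k - 4) : u.flip.coord i = -u.coord i := by
  rw [Model.coord, Model.coord]
  split_ifs
  · exact if_pos hi
  · exact neg_zero.symm

lemma rescale_neg (V : ℕ → R23) : rescale k (fun n => -V n) = fun n => -rescale k V n := by
  funext n
  simp only [rescale, scale, scaleZero, scaleAff, form_neg_left, form_neg_right, neg_neg,
    smul_neg]

lemma normalizedCoord_neg (W : ℕ → R23) :
    normalizedCoord k (fun n => -W n) = (normalizedCoord k W).flip := by
  have hs : ∀ j, sigmaInv (fun n => -W n) j = sigmaInv W j := fun j => by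
    simp only [sigmaInv, form_neg_left, form_neg_right, neg_neg]
  have ht : ∀ j, tauInv (fun n => -W n) j = -tauInv W j := fun j => by
    simp only [tauInv, hs, dVol_eq, Pi.neg_apply]
    ring
  ext i
  simp only [normalizedCoord, Model.flip, hs, ht]
  split_ifs <;> rfl

lemma coordMap_neg (v : ZMod k → R23) : coordMap k (-v) = (coordMap k v).flip := by
  rw [coordMap, coordMap, ← normalizedCoord_neg, ← rescale_neg]
  rfl

lemma coordMap_neg_cycle (hk : 6 ≤ k) {u : Model k} (hu : u ∈ chartDomain k) :
    coordMap k (-u.cycle) = u.flip := by rw [coordMap_neg, coordMap_cycle hk hu]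

lemma chartDomain.flip_mem (hk : 6 ≤ k) {u : Model k} (hu : u ∈ chartDomain k) :
    u.flip ∈ chartDomain k := by
  rw [← coordMap_neg_cycle hk hu]
  exact coordMap_mem hk (chartDomain.isNegativeCycle hk hu).neg_vec

/-- The marked polygon with given coordinates. -/
def TLP.ofCoord (hk : 6 ≤ k) (u : chartDomain k) : TLP k :=
  LTLP.forget hk ((LTLP.chart hk).symm u)

lemma TLP.isQuotientMap_ofCoord (hk : 6 ≤ k) : IsQuotientMap (TLP.ofCoord hk) :=
  (LTLP.isQuotientMap_forget hk).comp (LTLP.chart hk).symm.isQuotientMap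

lemma TLP.ofCoord_eq_iff (hk : 6 ≤ k) (x y : chartDomain k) :
    TLP.ofCoord hk x = TLP.ofCoord hk y ↔ y = x ∨ y.1 = x.1.flip := by
  have h1 : (Symmetries.perm hk (Symmetries.sign k 1) x).1 = x.1 := by
    rw [Symmetries.perm_apply_coe]
    exact (congrArg _ (Symmetries.act_one _)).trans (coordMap_cycle hk x.2)
  have h2 : (Symmetries.perm hk (Symmetries.sign k (-1)) x).1 = x.1.flip := by
    rw [Symmetries.perm_apply_coe, ← coordMap_neg_cycle hk x.2]
    exact congrArg _ ((Symmetries.act_neg_one 0 _).trans (congrArg _ (Symmetries.act_one _)))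
  rw [TLP.ofCoord, TLP.ofCoord, LTLP.forget_eq_forget_iff]
  simp only [← Symmetries.perm_apply_eq_iff]
  constructor
  · rintro ⟨ε, rfl⟩
    rcases Int.units_eq_one_or ε with rfl | rfl
    · exact .inl (Subtype.ext h1)
    · exact .inr h2
  · rintro (h | h)
    · exact ⟨1, Subtype.ext (h1.trans (congrArg _ h.symm))⟩
    · exact ⟨-1, Subtype.ext (h2.trans h.symm)⟩

lemma TLP.isOpenMap_ofCoord (hk : 6 ≤ k) : IsOpenMap (TLP.ofCoord (k := k) hk) := by
  intro O hO
  obtain ⟨O', hO', rfl⟩ := isOpen_induced_iff.mp hO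
  rw [← (TLP.isQuotientMap_ofCoord hk).isOpen_preimage]
  have : TLP.ofCoord hk ⁻¹' (TLP.ofCoord hk '' (Subtype.val ⁻¹' O'))
      = Subtype.val ⁻¹' (O' ∪ Model.flip ⁻¹' O') := by
    ext x
    constructor
    · rintro ⟨y, hy, e⟩
      rcases (TLP.ofCoord_eq_iff hk x y).mp e.symm with rfl | h
      · exact .inl hy
      · refine .inr ?_
        change x.1.flip ∈ O'
        rw [← h]; exact hy
    · rintro (h | h)
      · exact ⟨x, h, rfl⟩
      · exact ⟨⟨x.1.flip, chartDomain.flip_mem hk x.2⟩, h,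
          ((TLP.ofCoord_eq_iff hk x _).mpr (.inr rfl)).symm⟩
  rw [this]
  exact (hO'.union (hO'.preimage Model.continuous_flip)).preimage continuous_subtype_val

/-- If all numbers `wedge (p j) (p (j + 2))` vanish, then the directions `p j` with even `j` are
parallel. -/
lemma wedge_path_two_mul {u : Model k} (h : ∀ j < k - 4, u.coord j = 0) {n : ℕ}
    (hn : 2 * n + 3 ≤ k) : wedge (u.path (2 * n)) (u.path 0) = 0 := by
  induction n with
  | zero => exact wedge_self _
  | succ n ih =>
    rw [mul_add, mul_one, Model.path, steps_add_two, h (2 * n) (by omega), zero_smul, zero_sub]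
    have := ih (by omega)
    rw [wedge, Model.path] at this
    rw [wedge]
    simp only [Prod.smul_fst, Prod.smul_snd, Prod.fst_neg, Prod.snd_neg, smul_eq_mul]
    linear_combination -(u.sigma (2 * n))⁻¹ * u.sigma (2 * n + 1) * this

lemma exists_coord_ne_zero (hk : Odd k) (hk6 : 6 ≤ k) {u : Model k} (hu : u ∈ chartDomain k) :
    ∃ j < k - 4, u.coord j ≠ 0 := by
  by_contra! h
  obtain ⟨m, rfl⟩ := hk
  refine hu.2 ?_
  rw [show 2 * m + 1 - 3 = 2 * (m - 1) by omega]
  exact wedge_path_two_mul h (by omega)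

/-- For odd `k`, the exchange of the two lifts has no fixed points, so that the quotient map is a
local homeomorphism. -/
lemma isTopologicalManifold_TLP_of_odd (hk : 6 ≤ k) (hodd : Odd k) :
    IsTopologicalManifold (2 * (k - 5)) (TLP k) := by
  obtain ⟨_, _, -⟩ := isOrbifold_TLP hk
  refine isTopologicalManifold_of_isOpenEmbedding fun x => ?_
  obtain ⟨u, rfl⟩ := (TLP.isQuotientMap_ofCoord hk).surjective x
  obtain ⟨j, hj, hne⟩ := exists_coord_ne_zero hodd hk u.2
  have hV : IsOpen (chartDomain k ∩ {w : Model k | 0 < u.1.coord j * w.coord j}) :=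
    (isOpen_chartDomain k).inter (isOpen_lt continuous_const
      (continuous_const.mul (Model.contDiff_coord j).continuous))
  let V : TopologicalSpace.Opens (Model k) := ⟨_, hV⟩
  have hι : IsOpenEmbedding (fun w : V => (⟨w.1, w.2.1⟩ : chartDomain k)) :=
    .of_continuous_injective_isOpenMap (continuous_subtype_val.subtype_mk _)
      (fun a b h => Subtype.ext (Subtype.mk.inj h))
      (V.isOpen.isOpenMap_subtype_val.subtype_mk _)
  refine ⟨V, fun w => TLP.ofCoord hk ⟨w.1, w.2.1⟩, .of_continuous_injective_isOpenMap
    ((TLP.isQuotientMap_ofCoord hk).continuous.comp hι.continuous) ?_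
    ((TLP.isOpenMap_ofCoord hk).comp hι.isOpenMap),
    ⟨⟨u.1, u.2, mul_self_pos.mpr hne⟩, rfl⟩⟩
  intro a b h
  rcases (TLP.ofCoord_eq_iff hk _ _).mp h with h | h
  · exact Subtype.ext (Subtype.mk.inj h).symm
  · exfalso
    have ha : 0 < u.1.coord j * Model.coord a.1 j := a.2.2
    have hb : 0 < u.1.coord j * Model.coord b.1 j := b.2.2
    rw [show b.1 = Model.flip a.1 from h, Model.coord_flip _ hj] at hb
    linarith

lemma isOpenMap_complex_sq : IsOpenMap fun z : ℂ => z ^ 2 := by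
  refine (AnalyticOnNhd.is_constant_or_isOpenMap (g := fun z : ℂ => z ^ 2)
    fun z _ => by fun_prop).resolve_left ?_
  rintro ⟨w, hw⟩
  have h0 := hw 0
  have h1 := hw 1
  rw [← h0] at h1
  norm_num at h1

/-- For `k = 6`, the exchange of the two lifts is the rotation of an open set of the plane by `π`,
and the squaring map identifies the quotient with an open set of the plane. -/
lemma isTopologicalManifold_TLP_six : IsTopologicalManifold (2 * (6 - 5)) (TLP 6) := by
  obtain ⟨_, _, -⟩ := isOrbifold_TLP le_rfl
  let L : Model 6 ≃L[ℝ] ℂ := ContinuousLinearEquiv.ofFinrankEq (by simp [Complex.finrank_real_complex])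
  let g : chartDomain 6 → Model 6 := fun u => L.symm (L u.1 ^ 2)
  have hg : IsOpenMap g := L.symm.toHomeomorph.isOpenMap.comp
    (isOpenMap_complex_sq.comp (L.toHomeomorph.isOpenMap.comp
      (isOpen_chartDomain 6).isOpenMap_subtype_val))
  have hgc : Continuous g := by fun_prop
  let V : TopologicalSpace.Opens (Model 6) := ⟨Set.range g, hg.isOpen_range⟩
  have hgV : IsQuotientMap (fun u => (⟨g u, u, rfl⟩ : V)) :=
    (hg.subtype_mk _).isQuotientMap (hgc.subtype_mk _) fun ⟨_, u, e⟩ => ⟨u, Subtype.ext e⟩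
  have hflip : ∀ u : Model 6, u.flip = -u := fun u => by
    ext i
    exact if_pos i.2
  obtain ⟨e, -⟩ := exists_homeomorph_of_isQuotientMap (TLP.isQuotientMap_ofCoord le_rfl) hgV
    fun a b => by
      have h1 : (⟨g a, a, rfl⟩ : V) = ⟨g b, b, rfl⟩ ↔ L b.1 ^ 2 = L a.1 ^ 2 :=
        Subtype.ext_iff.trans (L.symm.injective.eq_iff.trans eq_comm)
      rw [TLP.ofCoord_eq_iff, h1, sq_eq_sq_iff_eq_or_eq_neg, hflip, Subtype.ext_iff, ← map_neg,
        L.injective.eq_iff, L.injective.eq_iff]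
  exact isTopologicalManifold_of_isOpenEmbedding fun x =>
    ⟨V, e.symm, e.symm.isOpenEmbedding, e x, e.symm_apply_apply x⟩

lemma isTopologicalManifold_LTLP (hk : 6 ≤ k) : IsTopologicalManifold (2 * (k - 5)) (LTLP k) := by
  have : T2Space (LTLP k) := (LTLP.chart hk).symm.t2Space
  have : SecondCountableTopology (LTLP k) := (LTLP.chart hk).secondCountableTopology
  exact isTopologicalManifold_of_isOpenEmbedding fun x =>
    ⟨chartOpens k, (LTLP.chart hk).symm, (LTLP.chart hk).symm.isOpenEmbedding,
      LTLP.chart hk x, (LTLP.chart hk).symm_apply_apply x⟩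

/-- The coordinates with `wedge (p n) (p (n + 1)) = 1` for all `n`, with
`wedge (p 0) (p 2) = 1`, and with `wedge (p n) (p (n + 2)) = 0` for `n > 0`. -/
def Model.base (k : ℕ) : Model k :=
  WithLp.toLp 2 fun i => if (i : ℕ) = 0 ∨ k ≤ (i : ℕ) + 4 then 1 else 0

lemma Model.sigma_base (k n : ℕ) : (Model.base k).sigma n = 1 := by
  rw [Model.sigma]
  split_ifs with h
  · rw [Model.coord, dif_pos (by omega)]
    exact if_pos (.inr (by simp only; omega))
  · rfl

lemma base_mem_chartDomain (hk : 6 ≤ k) : Model.base k ∈ chartDomain k := by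
  refine ⟨fun n => by rw [Model.sigma_base]; exact one_pos, ?_⟩
  have h0 : (Model.base k).coord 0 = 1 := by
    rw [Model.coord, dif_pos (by omega)]
    simp [Model.base]
  -- from the first step on, the directions are `(1, 0)` and `(0, 1)` in turn, up to sign
  have key : ∀ n, n + 4 ≤ k → wedge ((Model.base k).path (n + 1)) ((Model.base k).path 0) ≠ 0 := by
    intro n
    induction n using Nat.strong_induction_on with
    | _ n ih =>
      intro hn
      match n with
      | 0 => rw [Model.path_zero, Model.path_one, h0]; simp [wedge]
      | 1 => rw [Model.path_zero, Model.path_two, h0]; simp [wedge]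
      | n + 2 =>
        have hz : (Model.base k).coord (n + 1) = 0 := by
          rw [Model.coord, dif_pos (by omega)]
          exact if_neg (by simp only; omega)
        have e : (Model.base k).path (n + 2 + 1) = -(Model.base k).path (n + 1) := by
          rw [Model.path, show n + 2 + 1 = n + 1 + 2 by rfl, steps_add_two, hz]
          simp [Model.sigma_base]
        rw [e]
        have := ih n (by omega) (by omega)
        contrapose! this
        simp only [wedge, Prod.fst_neg, Prod.snd_neg] at this ⊢
        linarith
  have := key (k - 4) (by omega)
  rwa [show k - 4 + 1 = k - 3 by omega] at this

lemma nonempty_MLP (hk : 6 ≤ k) : Nonempty (MLP k) :=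
  ⟨MLP.mk (LP.mk ((LiftedLP.ofCycle hk _
    (chartDomain.isNegativeCycle hk (base_mem_chartDomain hk))).toMarked hk))⟩

end sign
end

theorem mainTheorem7 (k : ℕ) (hk : 6 ≤ k) :
    -- the moduli space of polygons is a real orbifold of dimension 2(k - 5)
    (Nonempty (MLP k) ∧ IsOrbifold (2 * (k - 5)) (MLP k)) ∧
    -- it is the quotient by ℤ_k of the moduli space of marked polygons
    (∃ h : AddAction.orbitRel.Quotient (ZMod k) (TLP k) ≃ₜ MLP k,
      ∀ P : MarkedLP k, h (Quotient.mk _ (TLP.mk P)) = MLP.mk (LP.mk P)) ∧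
    -- the latter is an orbifold, and a topological manifold if k is odd or k = 6
    IsOrbifold (2 * (k - 5)) (TLP k) ∧
    (k = 6 ∨ Odd k → IsTopologicalManifold (2 * (k - 5)) (TLP k)) ∧
    -- for every k, lifted marked polygons form a topological manifold, and the moduli space of
    -- marked polygons is its quotient by the involution that exchanges the two lifts
    IsTopologicalManifold (2 * (k - 5)) (LTLP k) ∧
    (∃ π : LTLP k → TLP k, Topology.IsQuotientMap π ∧
      (∀ (v : LiftedLP k) (P : MarkedLP k), P.1.IsFutureNegativeLift v.1 →
        π (LTLP.mk v) = TLP.mk P) ∧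
      (∀ v : LiftedLP k, ∃ w : LiftedLP k, w.1 = -v.1) ∧
      ∀ v v' w : LiftedLP k, v'.1 = -v.1 →
        (π (LTLP.mk w) = π (LTLP.mk v) ↔ LTLP.mk w = LTLP.mk v ∨ LTLP.mk w = LTLP.mk v')) := by
  refine ⟨⟨nonempty_MLP hk, isOrbifold_MLP hk⟩, exists_homeomorph_MLP, isOrbifold_TLP hk, ?_,
    isTopologicalManifold_LTLP hk, LTLP.forget hk, LTLP.isQuotientMap_forget hk,
    fun v P h => ?_, fun v => ⟨v.opposite hk, rfl⟩, fun v v' w h => ?_⟩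
  · rintro (rfl | hodd)
    · exact isTopologicalManifold_TLP_six
    · exact isTopologicalManifold_TLP_of_odd hk hodd
  · rw [LTLP.forget_mk, LiftedLP.toMarked_eq hk h.1]
  · exact LiftedLP.mk_toMarked_eq_iff hk h
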